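/- Let $1<p<2$. For $T>0$ write $Q^T=(0,T)\times(0,\infty)$, with points $(t,x)$. For $\ell>0$, a function $u$ on $(0,\infty)\times[0,\infty)$ is called a solution of $$(P_\ell)\qquad u_t-u_{xx}=0\ \text{ in } (0,\infty)\times(0,\infty),\qquad -u_x(t,0)+|u|^{p-1}u(t,0)=\ell\delta_0\ \text{ on } [0,\infty),\qquad u(0,\cdot)=0,$$ where $\delta_0$ is the Dirac mass at time $t=0$, if for every finite $T>0$ one has $u\in L^1(Q^T)$, $u(\cdot,0)\in L^1(0,T)$, $|u(\cdot,0)|^{p}\in L^1(0,T)$, the function $u(\cdot,0)$ is the trace of $u$ on $\{x=0\}$, in the sense that $\varepsilon^{-1}\int_0^\varepsilon\int_0^T|u(t,x)-u(t,0)|\,dt\,dx\to0$ as $\varepsilon\downarrow0$, and $$-\int_0^T\!\!\int_0^\infty(\zeta_t+\zeta_{xx})\,u\,dx\,dt+\int_0^T\big(|u|^{p-1}u\,\zeta\big)(t,0)\,dt=\ell\,\zeta(0,0)$$ for every $\zeta\in C^{1,2}_c([0,T)\times[0,\infty))$ with $\zeta_x(t,0)=0$ for all $t\in[0,T)$. For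 every $\ell>0$ problem $(P_\ell)$ has a solution $u_{\ell\delta_0}$. It is unique up to equality almost everywhere in $(0,\infty)\times(0,\infty)$ and almost everywhere on the lateral boundary $(0,\infty)\times\{0\}$, and it has a representative that is continuous on $(0,\infty)\times[0,\infty)$; this representative is meant below. (i) If $1<p\le\frac32$, then $u_{\ell\delta_0}\to\infty$ as $\ell\to\infty$, uniformly on compact subsets of $(0,\infty)\times[0,\infty)$. (ii) Let $\frac32<p<2$, and put $K(\eta)=e^{\eta^2/4}$. Let $H^1_K$ be the space of locally absolutely continuous functions $\phi$ on $[0,\infty)$ with $\int_0^\infty(\phi^2+\phi'^2)K\,d\eta<\infty$. Then there is a unique $\omega_s\in H^1_K$, positive on $(0,\infty)$, that is a weak solution of $-\omega''-\frac12\eta\,\omega'-\frac1{2(p-1)}\omega=0$ in $(0,\infty)$, $-\omega'(0)+|\omega|^{p-1}\omega(0)=0$, that is, $$\int_0^\infty\Big(\omega_s'\zeta'-\frac1{2(p-1)}\,\omega_s\zeta\Big)K\,d\eta+\big(|\omega_s|^{p-1}\omega_s\,\zeta\big)(0)=0\qquad\text{for all }\zeta\in H^1_K,$$ and $u_{\ell\delta_0}(t,x)\to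 t^{-\frac1{2(p-1)}}\,\omega_s\big(x/\sqrt t\big)$ as $\ell\to\infty$, uniformly on compact subsets of $(0,\infty)\times[0,\infty)$. -/

import Mathlib

open Set Filter Topology MeasureTheory

namespace HalfLineHeat

/-- The power nonlinearity `g(r) = |r|^(p-1) r`. -/
noncomputable def powerFlux (p : ℝ) (r : ℝ) : ℝ := |r| ^ (p - 1) * r

/-- The space-time half strip `Q^T = (0,T) × (0,∞)`; points are pairs `(t, x)`. -/
def strip (T : ℝ) : Set (ℝ × ℝ) := Ioo 0 T ×ˢ Ioi 0

/-- Test functions: `ζ ∈ C_c^{1,2}([0,T) × [0,∞))` with `ζ_x(t,0) = 0`. The functions `ζt`, `ζx`,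
`ζxx` are the derivatives of `ζ` (one-sided at the edges `t = 0` and `x = 0`). -/
structure IsTestFunction (T : ℝ) (ζ ζt ζx ζxx : ℝ × ℝ → ℝ) : Prop where
  continuousOn : ContinuousOn ζ (Ico 0 T ×ˢ Ici 0)
  continuousOn_t : ContinuousOn ζt (Ico 0 T ×ˢ Ici 0)
  continuousOn_x : ContinuousOn ζx (Ico 0 T ×ˢ Ici 0)
  continuousOn_xx : ContinuousOn ζxx (Ico 0 T ×ˢ Ici 0)
  hasDeriv_t : ∀ t ∈ Ico 0 T, ∀ x ∈ Ici (0 : ℝ),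
    HasDerivWithinAt (fun s => ζ (s, x)) (ζt (t, x)) (Ici 0) t
  hasDeriv_x : ∀ t ∈ Ico 0 T, ∀ x ∈ Ici (0 : ℝ),
    HasDerivWithinAt (fun y => ζ (t, y)) (ζx (t, x)) (Ici 0) x
  hasDeriv_xx : ∀ t ∈ Ico 0 T, ∀ x ∈ Ici (0 : ℝ),
    HasDerivWithinAt (fun y => ζx (t, y)) (ζxx (t, x)) (Ici 0) x
  compactSupport : ∃ S : Set (ℝ × ℝ), IsCompact S ∧ S ⊆ Ico 0 T ×ˢ Ici 0 ∧
    ∀ z ∈ Ico 0 T ×ˢ Ici 0, z ∉ S → ζ z = 0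
  neumann : ∀ t ∈ Ico 0 T, ζx (t, 0) = 0

/-- `u` is a weak solution in `L¹(Q^T)` of
`u_t - u_xx = 0` in `Q^T`, `-u_x(t,0) + g(u(t,0)) = μ` on `[0,T)`, `u(0,·) = ν` on `(0,∞)`,
for nonnegative Borel measures `ν`, `μ`.
The boundary values `u(t,0)` are the trace of `u` on the lateral boundary; this is expressed in
the averaged `L¹` sense, which does not depend on the almost-everywhere representative of `u` in
`Q^T`. -/
structure IsWeakSolution (g : ℝ → ℝ) (ν μ : Measure ℝ) (T : ℝ) (u : ℝ × ℝ → ℝ) : Prop where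
  integrable : IntegrableOn u (strip T)
  integrable_boundary : IntegrableOn (fun t => u (t, 0)) (Ioo 0 T)
  integrable_flux : IntegrableOn (fun t => g (u (t, 0))) (Ioo 0 T)
  trace : Tendsto (fun ε : ℝ => ε⁻¹ * ∫ z in Ioo 0 T ×ˢ Ioo 0 ε, |u z - u (z.1, 0)|)
    (𝓝[>] 0) (𝓝 0)
  weak_eq : ∀ ζ ζt ζx ζxx : ℝ × ℝ → ℝ, IsTestFunction T ζ ζt ζx ζxx →
    -(∫ z in strip T, (ζt z + ζxx z) * u z) + ∫ t in Ioo 0 T, g (u (t, 0)) * ζ (t, 0) =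
      (∫ x in Ioi 0, ζ (0, x) ∂ν) + ∫ t in Ico 0 T, ζ (t, 0) ∂μ

/-- `u` solves, in `(0,∞) × (0,∞)`, the heat equation with zero initial data and boundary
condition `-u_x(t,0) + |u|^(p-1) u(t,0) = ℓ δ₀`, where `δ₀` is the Dirac mass at time `t = 0`.
The solution is global in time: it is a weak solution on `Q^T` for every finite `T`. -/
def IsDiracFluxSolution (p ℓ : ℝ) (u : ℝ × ℝ → ℝ) : Prop :=
  ∀ T : ℝ, 0 < T →
    IsWeakSolution (powerFlux p) 0 (ENNReal.ofReal ℓ • Measure.dirac 0) T u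

/-- The weight `K(η) = exp(η²/4)`. -/
noncomputable def weight (η : ℝ) : ℝ := Real.exp (η ^ 2 / 4)

/-- The measure `K(η) dη` on `(0,∞)`. -/
noncomputable def weightMeasure : Measure ℝ :=
  (volume.restrict (Ioi 0)).withDensity (fun η => ENNReal.ofReal (weight η))

/-- `φ ∈ H¹_K(0,∞)` with derivative `φ'`: both lie in `L²_K`, and `φ` is the representative that
is locally absolutely continuous on `[0,∞)`, so that `φ 0` is its boundary value. -/
structure MemH1K (φ φ' : ℝ → ℝ) : Prop where
  memLp : MemLp φ 2 weightMeasure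
  memLp_deriv : MemLp φ' 2 weightMeasure
  eq_integral : ∀ η : ℝ, 0 ≤ η → φ η = φ 0 + ∫ s in (0 : ℝ)..η, φ' s

/-- `ω ∈ H¹_K(0,∞)` is a weak solution of the self-similar profile problem
`-ω'' - (η/2) ω' - ω/(2(p-1)) = 0` in `(0,∞)`, `-ω'(0) + |ω|^(p-1) ω(0) = 0`. -/
def IsWeakProfile (p : ℝ) (ω : ℝ → ℝ) : Prop :=
  ∃ ω' : ℝ → ℝ, MemH1K ω ω' ∧ ∀ ζ ζ' : ℝ → ℝ, MemH1K ζ ζ' →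
    (∫ η in Ioi 0, (ω' η * ζ' η - 1 / (2 * (p - 1)) * ω η * ζ η) * weight η)
      + |ω 0| ^ (p - 1) * ω 0 * ζ 0 = 0

/-- A positive weak solution of the profile problem. -/
def IsPositiveProfile (p : ℝ) (ω : ℝ → ℝ) : Prop :=
  IsWeakProfile p ω ∧ ∀ η : ℝ, 0 < η → 0 < ω η

/-- The self-similar function `U_ω(t,x) = t^(-1/(2(p-1))) ω(x/√t)`. -/
noncomputable def selfSimilar (p : ℝ) (ω : ℝ → ℝ) (z : ℝ × ℝ) : ℝ :=
  z.1 ^ (-(1 / (2 * (p - 1)))) * ω (z.2 / √z.1)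

end HalfLineHeat

/-! The problem lives on the boundary. Let `k(t) = 1/√(πt)` be the Neumann heat kernel at `x = 0`. A
solution with flux `c δ₀` is determined by its trace `v`, which solves the Abel–Volterra equation `v
= c k - k * g(v)` with `g(r) = |r|^(p-1) r`. Conversely, such a `v` yields the solution as the heat
potential of the flux `c δ₀ - g(v)` (`isWeakSolution_of_fluxSolution`). That every weak solution has
this form (`IsWeakSolution.ae_eq_fluxSolution`) follows from uniqueness for the homogeneous Neumann
problem in `L¹`, proved with cosine transforms (`ae_eq_zero_of_weak`).

Order comes from `comparison`: the resolvent kernel of `l k` is nonnegative with mass at most one,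
so the Abel equation is accretive in `L¹`. This gives uniqueness and monotonicity in `c`. Existence
for `c = 1` is a contraction argument for the nonlinearity clamped at level `k`; comparison shows
that the clamp is inactive. Scaling reaches every `c > 0`.

Write `m = 1/(2(p-1)) > 1/2`. Scaling gives `v_c(t) = t^(-m) v_{c'}(1)` with `c' = t^(m-1/2) c`. So
everything depends on `sup_c v_c(1)`, and `t^m v_c(t)` is nondecreasing in `t`. Since `k * k = 1` on
`(0,∞)`, convolving the equation with `k` gives the mass balance `(k * v)(t) = c - ∫₀ᵗ v^p`
(`IsBoundarySolution.integral_heatKernel_mul`), whose difference between `t = 1` and `t = 2` no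
longer contains `c`.

If `m < 1`, that is `p > 3/2`, the power `s^(-m)` is integrable at `0`, and the balance bounds
`v_c(1)^p` by a multiple of `v_c(1)`. If `m ≥ 1`, boundedness of `v_c(1)` would bound `∫₀¹ v_c`
uniformly in `c`, while `v_c(s)` dominates a fixed multiple of `1/s` on `(a,1)` once `c` is large: a
logarithmic contradiction.

In the bounded case `v_c(t) → L t^(-m)`, and the limiting balance determines `L`. Interior values
are Poisson integrals of boundary values, and the Poisson integral of `t^(-m)` is computed
explicitly by writing the power as a superposition of differences of heat kernels. The result is
self-similar with an explicit profile, and the value of `L` is exactly what its boundary condition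
requires. Monotonicity in `c` turns pointwise limits into locally uniform ones. Two positive
profiles agree at `0`, by testing each equation with the other profile, and hence everywhere, by a
Gronwall argument. -/

namespace HalfLineHeat

/-! ### Neumann and Poisson kernels of the half line -/

/-- The Neumann heat kernel of the half line, for flux prescribed at `x = 0`;
it vanishes for `t ≤ 0`. -/
noncomputable def heatKernel (t x : ℝ) : ℝ := Real.exp (-(x ^ 2 / (4 * t))) / √(Real.pi * t)

/-- The Dirichlet (Poisson) kernel of the heat equation on the half line. -/
noncomputable def poissonKernel (x t : ℝ) : ℝ := x / (2 * t) * heatKernel t x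

theorem heatKernel_nonneg (t x : ℝ) : 0 ≤ heatKernel t x := by
  unfold heatKernel; positivity

/-- The conventions for `√` of nonpositive reals and for division by zero give the value `0`.
Convolutions can therefore be written over all of `ℝ` and are causal automatically. -/
theorem heatKernel_of_nonpos {t : ℝ} (ht : t ≤ 0) (x : ℝ) : heatKernel t x = 0 := by
  have : Real.pi * t ≤ 0 := mul_nonpos_of_nonneg_of_nonpos Real.pi_pos.le ht
  simp [heatKernel, Real.sqrt_eq_zero_of_nonpos this]

theorem heatKernel_pos {t : ℝ} (ht : 0 < t) (x : ℝ) : 0 < heatKernel t x := by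
  have := Real.pi_pos
  unfold heatKernel; positivity

theorem heatKernel_at_zero (t : ℝ) : heatKernel t 0 = 1 / √(Real.pi * t) := by
  simp [heatKernel]

theorem heatKernel_le (t x : ℝ) : heatKernel t x ≤ heatKernel t 0 := by
  rcases le_or_gt t 0 with ht | ht
  · simp [heatKernel_of_nonpos ht]
  · rw [heatKernel_at_zero, heatKernel]
    gcongr
    exact Real.exp_le_one_iff.2 (neg_nonpos.2 (by positivity))

theorem measurable_heatKernel : Measurable fun z : ℝ × ℝ => heatKernel z.1 z.2 := by
  unfold heatKernel; fun_prop

theorem measurable_heatKernel_left (x : ℝ) : Measurable fun t => heatKernel t x := by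
  unfold heatKernel; fun_prop

theorem continuousOn_heatKernel :
    ContinuousOn (fun z : ℝ × ℝ => heatKernel z.1 z.2) (Ioi 0 ×ˢ univ) := by
  unfold heatKernel
  have h4 : ∀ z ∈ Ioi (0 : ℝ) ×ˢ (univ : Set ℝ), 4 * z.1 ≠ 0 := fun z hz => by
    have : 0 < z.1 := hz.1
    positivity
  have hp : ∀ z ∈ Ioi (0 : ℝ) ×ˢ (univ : Set ℝ), √(Real.pi * z.1) ≠ 0 := fun z hz => by
    have : 0 < z.1 := hz.1
    have := Real.pi_pos
    positivity
  refine ContinuousOn.div ?_ (by fun_prop) hp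
  exact (Real.continuous_exp.comp_continuousOn
    (ContinuousOn.neg (ContinuousOn.div (by fun_prop) (by fun_prop) h4)))

theorem continuous_heatKernel_right (t : ℝ) : Continuous (heatKernel t) := by
  unfold heatKernel; fun_prop

/-- Parabolic scaling: the source of the scaling law of the boundary equation, and the tool that
freezes the Gaussian near its pole. -/
theorem heatKernel_scale {l : ℝ} (hl : 0 < l) (t x : ℝ) :
    heatKernel (l ^ 2 * t) (l * x) = l⁻¹ * heatKernel t x := by
  unfold heatKernel
  rw [show Real.pi * (l ^ 2 * t) = l ^ 2 * (Real.pi * t) by ring,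
    Real.sqrt_mul (by positivity), Real.sqrt_sq hl.le,
    show (l * x) ^ 2 / (4 * (l ^ 2 * t)) = x ^ 2 / (4 * t) by
      rw [mul_pow, show 4 * (l ^ 2 * t) = l ^ 2 * (4 * t) by ring,
        mul_div_mul_left _ _ (by positivity)]]
  rw [div_mul_eq_div_div_swap, div_eq_inv_mul (b := l)]

theorem heatKernel_at_zero_rpow {t : ℝ} (ht : 0 ≤ t) :
    heatKernel t 0 = (√Real.pi)⁻¹ * t ^ (-(1 / 2) : ℝ) := by
  rw [heatKernel_at_zero, Real.sqrt_mul Real.pi_pos.le, Real.rpow_neg ht, ← Real.sqrt_eq_rpow,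
    one_div, mul_inv]

theorem heatKernel_antitone {s t : ℝ} (hs : 0 < s) (hst : s ≤ t) :
    heatKernel t 0 ≤ heatKernel s 0 := by
  have := Real.pi_pos
  rw [heatKernel_at_zero, heatKernel_at_zero]
  gcongr

theorem integrableOn_heatKernel_right {t : ℝ} (ht : 0 < t) :
    IntegrableOn (heatKernel t) (Ioi 0) := by
  have h := (integrable_exp_neg_mul_sq (b := 1 / (4 * t)) (by positivity)).integrableOn
    (s := Ioi (0 : ℝ))
  refine IntegrableOn.congr_fun (h.div_const √(Real.pi * t)) (fun x _ => ?_) measurableSet_Ioi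
  simp only [heatKernel]; congr 2; ring

theorem integral_heatKernel_right {t : ℝ} (ht : 0 < t) : ∫ x in Ioi 0, heatKernel t x = 1 := by
  have h := integral_gaussian_Ioi (1 / (4 * t))
  have hpt : 0 < √(Real.pi * t) := Real.sqrt_pos.2 (mul_pos Real.pi_pos ht)
  calc ∫ x in Ioi 0, heatKernel t x
      = (∫ x in Ioi (0 : ℝ), Real.exp (-(1 / (4 * t)) * x ^ 2)) / √(Real.pi * t) := by
        rw [← integral_div]
        refine setIntegral_congr_fun measurableSet_Ioi fun x _ => ?_
        simp only [heatKernel]; congr 2; ring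
    _ = 1 := by
        rw [h, show Real.pi / (1 / (4 * t)) = 2 ^ 2 * (Real.pi * t) by field_simp; norm_num,
          Real.sqrt_mul (by positivity), Real.sqrt_sq (by norm_num)]
        field_simp

theorem integrableOn_heatKernel_left (T x : ℝ) :
    IntegrableOn (fun t => heatKernel t x) (Iio T) := by
  have h0 : IntegrableOn (fun t => heatKernel t 0) (Iio T) := by
    have h1 : IntegrableOn (fun t => heatKernel t 0) (Ioc 0 (max T 0)) := by
      have := (intervalIntegral.intervalIntegrable_rpow' (a := 0) (b := max T 0)
        (r := -(1 / 2)) (by norm_num)).const_mul (√Real.pi)⁻¹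
      rw [intervalIntegrable_iff_integrableOn_Ioc_of_le (le_max_right _ _)] at this
      exact this.congr_fun (fun t ht => (heatKernel_at_zero_rpow ht.1.le).symm) measurableSet_Ioc
    have h2 : IntegrableOn (fun t => heatKernel t 0) (Iic 0) :=
      integrableOn_zero.congr_fun (fun t ht => (heatKernel_of_nonpos ht 0).symm) measurableSet_Iic
    refine (h2.union h1).mono_set fun t ht => ?_
    rcases le_or_gt t 0 with h | h
    · exact Or.inl h
    · exact Or.inr ⟨h, ht.le.trans (le_max_left _ _)⟩
  refine h0.mono' (measurable_heatKernel_left x).aestronglyMeasurable (ae_of_all _ fun t => ?_)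
  rw [Real.norm_of_nonneg (heatKernel_nonneg _ _)]
  exact heatKernel_le t x

theorem hasDerivAt_heatKernel_x (t x : ℝ) :
    HasDerivAt (fun y => heatKernel t y) (-poissonKernel x t) x := by
  have h := (((hasDerivAt_pow 2 x).div_const (4 * t)).neg.exp).div_const √(Real.pi * t)
  refine h.congr_deriv ?_
  rcases eq_or_ne t 0 with rfl | ht
  · simp [poissonKernel]
  · simp only [poissonKernel, heatKernel]; field_simp; simp; ring

theorem hasDerivAt_poissonKernel_x {t : ℝ} (ht : t ≠ 0) (x : ℝ) :
    HasDerivAt (fun y => poissonKernel y t)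
      (-((x ^ 2 / (4 * t ^ 2) - 1 / (2 * t)) * heatKernel t x)) x := by
  have h := ((hasDerivAt_id x).div_const (2 * t)).mul (hasDerivAt_heatKernel_x t x)
  refine h.congr_deriv ?_
  simp only [poissonKernel, id]
  field_simp; ring

theorem hasDerivAt_heatKernel_t {t : ℝ} (ht : 0 < t) (x : ℝ) :
    HasDerivAt (fun s => heatKernel s x)
      ((x ^ 2 / (4 * t ^ 2) - 1 / (2 * t)) * heatKernel t x) t := by
  have hpt : 0 < Real.pi * t := mul_pos Real.pi_pos ht
  have hs : 0 < √(Real.pi * t) := Real.sqrt_pos.2 hpt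
  have h1 : HasDerivAt (fun s : ℝ => x ^ 2 / (4 * s)) (-(x ^ 2 / (4 * t ^ 2))) t := by
    have := (((hasDerivAt_id t).const_mul 4).fun_inv (by simp; exact ht.ne')).const_mul (x ^ 2)
    refine (this.congr_deriv ?_).congr_of_eventuallyEq
        (.of_forall fun s => by simp [div_eq_mul_inv])
    simp only [id]; field_simp
  have h2 : HasDerivAt (fun s : ℝ => √(Real.pi * s)) (Real.pi / (2 * √(Real.pi * t))) t := by
    have := ((hasDerivAt_id t).const_mul Real.pi).sqrt hpt.ne'
    simpa using this
  have h := h1.neg.exp.div h2 hs.ne'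
  refine h.congr_deriv ?_
  simp only [heatKernel]
  have h3 : √(Real.pi * t) ^ 2 = Real.pi * t := Real.sq_sqrt hpt.le
  rw [div_eq_iff (by positivity)]
  set E := Real.exp (-(x ^ 2 / (4 * t)))
  set q := √(Real.pi * t)
  rw [show (x ^ 2 / (4 * t ^ 2) - 1 / (2 * t)) * (E / q) * q ^ 2
    = (x ^ 2 / (4 * t ^ 2) - 1 / (2 * t)) * E * q by field_simp]
  have h4 : Real.pi / (2 * q) = q / (2 * t) := by
    rw [div_eq_div_iff (by positivity) (by positivity)]; linear_combination -2 * h3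
  rw [h4, show Real.exp ((-fun s => x ^ 2 / (4 * s)) t) = E from rfl]; field_simp

theorem poissonKernel_nonneg {x : ℝ} (hx : 0 ≤ x) (t : ℝ) : 0 ≤ poissonKernel x t := by
  rcases le_or_gt t 0 with ht | ht
  · simp [poissonKernel, heatKernel_of_nonpos ht]
  · exact mul_nonneg (by positivity) (heatKernel_nonneg _ _)

theorem poissonKernel_pos {x t : ℝ} (hx : 0 < x) (ht : 0 < t) : 0 < poissonKernel x t :=
  mul_pos (by positivity) (heatKernel_pos ht x)

theorem poissonKernel_of_nonpos {t : ℝ} (ht : t ≤ 0) (x : ℝ) : poissonKernel x t = 0 := by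
  simp [poissonKernel, heatKernel_of_nonpos ht]

theorem measurable_poissonKernel : Measurable fun z : ℝ × ℝ => poissonKernel z.1 z.2 := by
  unfold poissonKernel heatKernel; fun_prop

theorem measurable_poissonKernel_right (x : ℝ) : Measurable (poissonKernel x) := by
  unfold poissonKernel heatKernel; fun_prop

/-! ### Beta integrals and convolution identities -/

/-- The beta density has total mass one, which yields integrability and value together. -/
theorem integrableOn_beta {a b : ℝ} (ha : 0 < a) (hb : 0 < b) :
    IntegrableOn (fun s : ℝ => s ^ (a - 1) * (1 - s) ^ (b - 1)) (Ioo 0 1) ∧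
      ∫ s in Ioo (0 : ℝ) 1, s ^ (a - 1) * (1 - s) ^ (b - 1) = ProbabilityTheory.beta a b := by
  have hbe := ProbabilityTheory.beta_pos ha hb
  have h := ProbabilityTheory.lintegral_betaPDF_eq_one ha hb
  rw [ProbabilityTheory.lintegral_betaPDF] at h
  have hint : IntegrableOn (fun s : ℝ => 1 / ProbabilityTheory.beta a b * s ^ (a - 1) *
      (1 - s) ^ (b - 1)) (Ioo 0 1) := by
    refine ⟨by fun_prop, ?_⟩
    rw [hasFiniteIntegral_iff_ofReal, h]
    · exact ENNReal.one_lt_top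
    · filter_upwards [ae_restrict_mem measurableSet_Ioo] with s hs
      have h1 := hs.1
      have h2 : 0 < 1 - s := by linarith [hs.2]
      positivity
  have hval : ∫ s in Ioo (0 : ℝ) 1, 1 / ProbabilityTheory.beta a b * s ^ (a - 1) *
      (1 - s) ^ (b - 1) = 1 := by
    rw [integral_eq_lintegral_of_nonneg_ae _ hint.1, h, ENNReal.toReal_one]
    filter_upwards [ae_restrict_mem measurableSet_Ioo] with s hs
    have h1 := hs.1
    have h2 : 0 < 1 - s := by linarith [hs.2]
    simp only [Pi.zero_apply]
    positivity
  have he : (fun s : ℝ => s ^ (a - 1) * (1 - s) ^ (b - 1)) = fun s => ProbabilityTheory.beta a b *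
      (1 / ProbabilityTheory.beta a b * s ^ (a - 1) * (1 - s) ^ (b - 1)) := by
    funext s; field_simp
  rw [he]
  exact ⟨hint.const_mul _, by rw [integral_const_mul, hval, mul_one]⟩

/-- Substituting `s = t σ` in an integral over `(0,t)`. -/
theorem integrableOn_Ioo_scale {t : ℝ} (ht : 0 < t) (F : ℝ → ℝ) :
    (IntegrableOn F (Ioo 0 t) ↔ IntegrableOn (fun s => t * F (t * s)) (Ioo 0 1)) ∧
      ∫ s in Ioo 0 t, F s = ∫ s in Ioo 0 1, t * F (t * s) := by
  have him : (fun s => t * s) '' Ioo 0 1 = Ioo 0 t := by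
    rw [image_mul_left_Ioo ht]; simp
  have hd : ∀ x ∈ Ioo (0 : ℝ) 1, HasDerivWithinAt (fun s => t * s) t (Ioo 0 1) x := fun x _ => by
    simpa using ((hasDerivAt_id x).const_mul t).hasDerivWithinAt
  have hinj : InjOn (fun s => t * s) (Ioo 0 1) := fun a _ b _ h => mul_left_cancel₀ ht.ne' h
  have h1 := integrableOn_image_iff_integrableOn_abs_deriv_smul measurableSet_Ioo hd hinj F
  have h2 := integral_image_eq_integral_abs_deriv_smul measurableSet_Ioo hd hinj F
  rw [him] at h1 h2
  simpa [abs_of_pos ht] using And.intro h1 h2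

theorem integrableOn_beta_scaled {a b t : ℝ} (ha : 0 < a) (hb : 0 < b) (ht : 0 < t) :
    IntegrableOn (fun s : ℝ => s ^ (a - 1) * (t - s) ^ (b - 1)) (Ioo 0 t) ∧
      ∫ s in Ioo (0 : ℝ) t, s ^ (a - 1) * (t - s) ^ (b - 1)
        = t ^ (a + b - 1) * ProbabilityTheory.beta a b := by
  have hs := integrableOn_Ioo_scale ht fun s : ℝ => s ^ (a - 1) * (t - s) ^ (b - 1)
  have he : EqOn (fun s : ℝ => t ^ (a + b - 1) * (s ^ (a - 1) * (1 - s) ^ (b - 1)))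
      (fun s => t * ((t * s) ^ (a - 1) * (t - t * s) ^ (b - 1))) (Ioo 0 1) := fun s hs => by
    have h1 := hs.1
    have h2 : 0 < 1 - s := by linarith [hs.2]
    simp only
    rw [show t - t * s = t * (1 - s) by ring, Real.mul_rpow ht.le h1.le, Real.mul_rpow ht.le h2.le,
      show a + b - 1 = 1 + (a - 1) + (b - 1) by ring, Real.rpow_add ht, Real.rpow_add ht,
      Real.rpow_one]
    ring
  obtain ⟨hi, hv⟩ := integrableOn_beta ha hb
  refine ⟨hs.1.2 (IntegrableOn.congr_fun (hi.const_mul _) he measurableSet_Ioo), ?_⟩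
  rw [hs.2, ← setIntegral_congr_fun measurableSet_Ioo he, integral_const_mul, hv]

/-- The Cauchy–Schlömilch substitution for the Gaussian integral. -/
theorem integral_exp_neg_sub_div_sq {a b : ℝ} (ha : 0 < a) (hb : 0 ≤ b) :
    IntegrableOn (fun q : ℝ => Real.exp (-(a * q - b / q) ^ 2)) (Ioi 0) ∧
      ∫ q in Ioi (0 : ℝ), Real.exp (-(a * q - b / q) ^ 2) = √Real.pi / (2 * a) := by
  rcases hb.eq_or_lt with rfl | hb
  · have he : (fun q : ℝ => Real.exp (-(a * q - 0 / q) ^ 2))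
        = fun q => Real.exp (-(a ^ 2) * q ^ 2) := by
      funext q; congr 1; ring
    rw [he]
    refine ⟨(integrable_exp_neg_mul_sq (by positivity)).integrableOn, ?_⟩
    rw [integral_gaussian_Ioi, Real.sqrt_div Real.pi_pos.le, Real.sqrt_sq ha.le]
    field_simp
  -- For `b > 0` the map `q ↦ a q - b/q` is a bijection of `(0,∞)` onto `ℝ` with Jacobian `a +
  -- b/q²`.
  have hd : ∀ q ∈ Ioi (0 : ℝ), HasDerivWithinAt (fun q => a * q - b / q) (a + b / q ^ 2)
      (Ioi 0) q := by
    intro q hq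
    have h := ((hasDerivAt_id q).const_mul a).sub
      (((hasDerivAt_id q).fun_inv (ne_of_gt hq)).const_mul b)
    refine HasDerivAt.hasDerivWithinAt ((h.congr_deriv ?_).congr_of_eventuallyEq
      (.of_forall fun s => by simp [div_eq_mul_inv]))
    simp only [id]; ring
  have hinj : InjOn (fun q => a * q - b / q) (Ioi 0) := by
    intro q hq r hr h
    have hq' : 0 < q := hq
    have hr' : 0 < r := hr
    simp only at h
    have : (q - r) * (a + b / (q * r)) = 0 := by
      have : (q - r) * (a + b / (q * r)) = (a * q - b / q) - (a * r - b / r) := by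
        field_simp; ring
      rw [this, h, sub_self]
    rcases mul_eq_zero.1 this with h | h
    · linarith
    · have : 0 < a + b / (q * r) := by positivity
      linarith
  have him : (fun q => a * q - b / q) '' Ioi 0 = univ := by
    refine eq_univ_of_forall fun w => ?_
    have hs : √(w ^ 2 + 4 * a * b) ^ 2 = w ^ 2 + 4 * a * b := Real.sq_sqrt (by positivity)
    have hpos : 0 < w + √(w ^ 2 + 4 * a * b) := by
      have : |w| < √(w ^ 2 + 4 * a * b) := by
        rw [← Real.sqrt_sq_eq_abs]
        exact Real.sqrt_lt_sqrt (sq_nonneg _) (by linarith [mul_pos (mul_pos four_pos ha) hb])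
      linarith [neg_abs_le w]
    -- The positive root of `a q² - w q - b = 0`.
    refine ⟨(w + √(w ^ 2 + 4 * a * b)) / (2 * a), by simp only [mem_Ioi]; positivity, ?_⟩
    simp only
    generalize √(w ^ 2 + 4 * a * b) = r at hs hpos
    rw [div_div_eq_mul_div]
    field_simp
    linear_combination hs
  -- The inversion `q ↦ b/(a q)` changes the sign of `a q - b/q`. Hence the two terms of the
  -- Jacobian `a + b/q²` contribute equally, and each contributes half of `√π`.
  have hinv : (fun q : ℝ => b / (a * q)) '' Ioi 0 = Ioi 0 := by
    ext w; constructor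
    · rintro ⟨q, hq, rfl⟩
      have hq' : 0 < q := hq
      simp only [mem_Ioi]; positivity
    · intro hw
      have hw' : 0 < w := hw
      exact ⟨b / (a * w), by simp only [mem_Ioi]; positivity, by simp only; field_simp⟩
  have hd2 : ∀ q ∈ Ioi (0 : ℝ), HasDerivWithinAt (fun q => b / (a * q)) (-(b / (a * q ^ 2)))
      (Ioi 0) q := by
    intro q hq
    have h := ((hasDerivAt_id q).fun_inv (ne_of_gt hq)).const_mul (b / a)
    refine HasDerivAt.hasDerivWithinAt ((h.congr_deriv ?_).congr_of_eventuallyEq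
      (.of_forall fun s => by simp only [id, div_eq_mul_inv, mul_inv]; ring))
    simp only [id]; field_simp
  have hinj2 : InjOn (fun q : ℝ => b / (a * q)) (Ioi 0) := by
    intro q hq r hr h
    have hq' : 0 < q := hq
    have hr' : 0 < r := hr
    simp only at h
    field_simp at h
    exact h.symm
  have hG : Integrable fun w : ℝ => Real.exp (-w ^ 2) := by
    simpa using integrable_exp_neg_mul_sq one_pos
  have hGv : ∫ w : ℝ, Real.exp (-w ^ 2) = √Real.pi := by
    simpa using integral_gaussian 1
  have h1 := (integrableOn_image_iff_integrableOn_abs_deriv_smul measurableSet_Ioi hd hinj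
    fun w => Real.exp (-w ^ 2))
  have h2 := integral_image_eq_integral_abs_deriv_smul measurableSet_Ioi hd hinj
    fun w => Real.exp (-w ^ 2)
  have h3 := integral_image_eq_integral_abs_deriv_smul measurableSet_Ioi hd2 hinj2
    fun q => Real.exp (-(a * q - b / q) ^ 2)
  rw [him, integrableOn_univ] at h1
  rw [him, setIntegral_univ, hGv] at h2
  rw [hinv] at h3
  replace h1 := h1.1 hG
  have hI : IntegrableOn (fun q : ℝ => Real.exp (-(a * q - b / q) ^ 2)) (Ioi 0) := by
    refine Integrable.mono' (h1.const_mul a⁻¹) (by fun_prop) ?_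
    filter_upwards [ae_restrict_mem measurableSet_Ioi] with q hq
    have hq' : 0 < q := hq
    rw [Real.norm_of_nonneg (Real.exp_pos _).le, smul_eq_mul, abs_of_pos (by positivity),
        ← mul_assoc]
    refine le_mul_of_one_le_left (Real.exp_pos _).le ?_
    rw [mul_add, inv_mul_cancel₀ ha.ne']
    have : 0 ≤ a⁻¹ * (b / q ^ 2) := by positivity
    linarith
  refine ⟨hI, ?_⟩
  have h4 : ∫ q in Ioi (0 : ℝ), |a + b / q ^ 2| • Real.exp (-(a * q - b / q) ^ 2)
      = ∫ q in Ioi (0 : ℝ), (a * Real.exp (-(a * q - b / q) ^ 2)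
        + a * (|-(b / (a * q ^ 2))| • Real.exp (-(a * (b / (a * q)) - b / (b /
            (a * q))) ^ 2))) := by
    refine setIntegral_congr_fun measurableSet_Ioi fun q hq => ?_
    have hq' : 0 < q := hq
    have : a * (b / (a * q)) - b / (b / (a * q)) = -(a * q - b / q) := by field_simp; ring
    simp only [this]
    rw [abs_of_pos (by positivity), abs_neg, abs_of_pos (by positivity), neg_sq, smul_eq_mul,
      smul_eq_mul]
    field_simp
  have hI2 := (integrableOn_image_iff_integrableOn_abs_deriv_smul measurableSet_Ioi hd2 hinj2
    fun q => Real.exp (-(a * q - b / q) ^ 2)).1 (by rwa [hinv])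
  rw [h4, integral_add (hI.const_mul _) (hI2.const_mul _), integral_const_mul,
    integral_const_mul, ← h3] at h2
  rw [eq_div_iff (by positivity)]; linarith

/-- The heat kernel is the Poisson extension of its values on a parallel line. -/
theorem poissonKernel_conv_heatKernel_Ioo {x z t : ℝ} (hx : 0 < x) (hz : 0 ≤ z) (ht : 0 < t) :
    IntegrableOn (fun s => poissonKernel x (t - s) * heatKernel s z) (Ioo 0 t) ∧
      ∫ s in Ioo 0 t, poissonKernel x (t - s) * heatKernel s z = heatKernel t (x + z) := by
  -- With `s = t q²/(1+q²)`, that is `q = √(s/(t-s))`, the two Gaussian exponents combine to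
  -- `(x+z)²/(4t)` plus a perfect square in `q` and `1/q`, and the remaining algebraic factors
  -- become constant.
  have him : (fun q : ℝ => t * q ^ 2 / (1 + q ^ 2)) '' Ioi 0 = Ioo 0 t := by
    ext s; constructor
    · rintro ⟨q, hq, rfl⟩
      have hq' : 0 < q := hq
      simp only
      refine ⟨by positivity, ?_⟩
      rw [div_lt_iff₀ (by positivity)]; linarith [ht]
    · rintro ⟨h0, h1⟩
      have h2 : 0 < t - s := by linarith
      refine ⟨√(s / (t - s)), Real.sqrt_pos.2 (by positivity), ?_⟩
      simp only
      rw [Real.sq_sqrt (by positivity)]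
      field_simp; ring
  have hd : ∀ q ∈ Ioi (0 : ℝ), HasDerivWithinAt (fun q => t * q ^ 2 / (1 + q ^ 2))
      (2 * t * q / (1 + q ^ 2) ^ 2) (Ioi 0) q := by
    intro q hq
    have h := ((hasDerivAt_pow 2 q).const_mul t).div ((hasDerivAt_pow 2 q).const_add 1)
      (by positivity)
    refine (h.congr_deriv ?_).hasDerivWithinAt
    congr 1; simp; ring
  have hinj : InjOn (fun q : ℝ => t * q ^ 2 / (1 + q ^ 2)) (Ioi 0) := by
    intro q hq r hr h
    have hq' : 0 < q := hq
    have hr' : 0 < r := hr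
    simp only at h
    field_simp at h
    have : q ^ 2 = r ^ 2 := by linarith
    exact (pow_left_inj₀ hq'.le hr'.le two_ne_zero).1 this
  have h1 := integrableOn_image_iff_integrableOn_abs_deriv_smul measurableSet_Ioi hd hinj
    fun s => poissonKernel x (t - s) * heatKernel s z
  have h2 := integral_image_eq_integral_abs_deriv_smul measurableSet_Ioi hd hinj
    fun s => poissonKernel x (t - s) * heatKernel s z
  rw [him] at h1 h2
  have hst : 0 < √t := Real.sqrt_pos.2 ht
  have hss : √t ^ 2 = t := Real.sq_sqrt ht.le
  obtain ⟨hi, hv⟩ := integral_exp_neg_sub_div_sq (a := x / (2 * √t)) (b := z / (2 * √t))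
    (by positivity) (by positivity)
  have he : EqOn (fun q : ℝ => x / (Real.pi * t) * Real.exp (-((x + z) ^ 2 / (4 * t))) *
      Real.exp (-(x / (2 * √t) * q - z / (2 * √t) / q) ^ 2))
      (fun q => |2 * t * q / (1 + q ^ 2) ^ 2| • (poissonKernel x (t - t * q ^ 2 / (1 + q ^ 2)) *
        heatKernel (t * q ^ 2 / (1 + q ^ 2)) z)) (Ioi 0) := by
    intro q hq
    have hq' : 0 < q := hq
    have hD : 0 < 1 + q ^ 2 := by positivity
    have hpi := Real.pi_pos
    simp only
    have e1 : t - t * q ^ 2 / (1 + q ^ 2) = t / (1 + q ^ 2) := by field_simp; ring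
    rw [abs_of_pos (by positivity), smul_eq_mul, e1, poissonKernel, heatKernel, heatKernel]
    have e2 : √(Real.pi * (t / (1 + q ^ 2))) = √(Real.pi * t) / √(1 + q ^ 2) := by
      rw [← mul_div_assoc, Real.sqrt_div (by positivity)]
    have e3 : √(Real.pi * (t * q ^ 2 / (1 + q ^ 2))) = √(Real.pi * t) * q / √(1 + q ^ 2) := by
      rw [← mul_div_assoc, Real.sqrt_div (by positivity), ← mul_assoc,
        Real.sqrt_mul (by positivity), Real.sqrt_sq hq'.le]
    have e4 : √(Real.pi * t) ^ 2 = Real.pi * t := Real.sq_sqrt (by positivity)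
    have e5 : √(1 + q ^ 2) ^ 2 = 1 + q ^ 2 := Real.sq_sqrt (by positivity)
    have e6 : Real.exp (-((x + z) ^ 2 / (4 * t))) *
        Real.exp (-(x / (2 * √t) * q - z / (2 * √t) / q) ^ 2) =
        Real.exp (-(x ^ 2 / (4 * (t / (1 + q ^ 2))))) *
        Real.exp (-(z ^ 2 / (4 * (t * q ^ 2 / (1 + q ^ 2))))) := by
      rw [← Real.exp_add, ← Real.exp_add]
      congr 1
      have : (x / (2 * √t) * q - z / (2 * √t) / q) ^ 2 = (x * q - z / q) ^ 2 / (4 * t) := by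
        rw [← hss]; field_simp; norm_num; ring
      rw [this]; field_simp; ring
    rw [mul_assoc, e6, e2, e3]
    generalize Real.exp (-(x ^ 2 / (4 * (t / (1 + q ^ 2))))) = E1
    generalize Real.exp (-(z ^ 2 / (4 * (t * q ^ 2 / (1 + q ^ 2))))) = E2
    have hS : 0 < √(Real.pi * t) := Real.sqrt_pos.2 (by positivity)
    have hR : 0 < √(1 + q ^ 2) := Real.sqrt_pos.2 (by positivity)
    generalize √(Real.pi * t) = S at *
    generalize √(1 + q ^ 2) = R at *
    rw [← e4, ← e5]
    field_simp
  refine ⟨h1.2 (IntegrableOn.congr_fun (hi.const_mul _) he measurableSet_Ioi), ?_⟩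
  rw [h2, ← setIntegral_congr_fun measurableSet_Ioi he, integral_const_mul, hv, heatKernel]
  have hpi := Real.pi_pos
  have hp : √(Real.pi * t) = √Real.pi * √t := Real.sqrt_mul hpi.le _
  have hpp : √Real.pi ^ 2 = Real.pi := Real.sq_sqrt hpi.le
  have hsp : 0 < √Real.pi := Real.sqrt_pos.2 hpi
  rw [hp]
  nth_rw 1 [← hpp]
  generalize Real.exp (-((x + z) ^ 2 / (4 * t))) = E
  nth_rw 1 [← hss]
  field_simp

theorem integral_causal {F : ℝ → ℝ} {t : ℝ} (h0 : ∀ s ≤ 0, F s = 0) (h1 : ∀ s, t ≤ s → F s = 0) :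
    (Integrable F ↔ IntegrableOn F (Ioo 0 t)) ∧ ∫ s, F s = ∫ s in Ioo 0 t, F s := by
  have hsupp : Function.support F ⊆ Ioo 0 t := fun s hs => by
    by_contra h
    rcases not_and_or.1 h with h | h
    · exact hs (h0 s (not_lt.1 h))
    · exact hs (h1 s (not_lt.1 h))
  exact ⟨(integrableOn_iff_integrable_of_support_subset hsupp).symm,
    (setIntegral_eq_integral_of_forall_compl_eq_zero fun s hs => by
      by_contra h; exact hs (hsupp h)).symm⟩

theorem poissonKernel_conv_heatKernel {x z : ℝ} (hx : 0 < x) (hz : 0 ≤ z) (t : ℝ) :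
    Integrable (fun s => poissonKernel x (t - s) * heatKernel s z) ∧
      ∫ s, poissonKernel x (t - s) * heatKernel s z = heatKernel t (x + z) := by
  have hc := integral_causal (F := fun s => poissonKernel x (t - s) * heatKernel s z) (t := t)
    (fun s hs => by simp [heatKernel_of_nonpos hs])
    (fun s hs => by simp [poissonKernel_of_nonpos (sub_nonpos.2 hs)])
  rcases le_or_gt t 0 with ht | ht
  · have : Ioo 0 t = ∅ := Ioo_eq_empty (not_lt.2 ht)
    rw [hc.1, hc.2, this, heatKernel_of_nonpos ht]
    simp
  · rw [hc.1, hc.2]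
    exact poissonKernel_conv_heatKernel_Ioo hx hz ht

/-- The heat kernel on the lateral boundary is its own Sonine conjugate. -/
theorem heatKernel_conv_heatKernel (t : ℝ) :
    Integrable (fun s => heatKernel (t - s) 0 * heatKernel s 0) ∧
      ∫ s, heatKernel (t - s) 0 * heatKernel s 0 = (Ioi (0 : ℝ)).indicator 1 t := by
  have hc := integral_causal (F := fun s => heatKernel (t - s) 0 * heatKernel s 0) (t := t)
    (fun s hs => by simp [heatKernel_of_nonpos hs])
    (fun s hs => by simp [heatKernel_of_nonpos (sub_nonpos.2 hs)])
  rcases le_or_gt t 0 with ht | ht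
  · have : Ioo 0 t = ∅ := Ioo_eq_empty (not_lt.2 ht)
    rw [hc.1, hc.2, this]
    simp [ht]
  · have hhalf : (0 : ℝ) < 1 / 2 := by norm_num
    obtain ⟨hi, hv⟩ := integrableOn_beta_scaled hhalf hhalf ht
    have he : EqOn (fun s : ℝ => Real.pi⁻¹ * (s ^ ((1 / 2 : ℝ) - 1) * (t - s) ^ ((1 / 2 : ℝ) - 1)))
        (fun s => heatKernel (t - s) 0 * heatKernel s 0) (Ioo 0 t) := fun s hs => by
      simp only
      rw [heatKernel_at_zero_rpow hs.1.le, heatKernel_at_zero_rpow (by linarith [hs.2]),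
        ← Real.mul_self_sqrt Real.pi_pos.le, mul_inv, Real.mul_self_sqrt Real.pi_pos.le,
        show (1 / 2 : ℝ) - 1 = -(1 / 2) by norm_num]
      ring
    rw [hc.1, hc.2]
    refine ⟨IntegrableOn.congr_fun (hi.const_mul _) he measurableSet_Ioo, ?_⟩
    rw [← setIntegral_congr_fun measurableSet_Ioo he, integral_const_mul, hv,
      ProbabilityTheory.beta, Real.Gamma_one_half_eq, Real.mul_self_sqrt Real.pi_pos.le]
    norm_num [ht, Real.pi_ne_zero]

/-- Associativity of convolution for nonnegative kernels: if `c = a * b` then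
`a * (b * h) = c * h` wherever `|h|` is integrable against `c`. -/
theorem conv_assoc {a b c h : ℝ → ℝ} (ha : ∀ t, 0 ≤ a t) (hb : ∀ t, 0 ≤ b t)
    (hma : Measurable a) (hmb : Measurable b)
    (hc : ∀ t, Integrable (fun s => a (t - s) * b s) ∧ ∫ s, a (t - s) * b s = c t)
    (hh : AEStronglyMeasurable h) {t : ℝ} (hch : Integrable fun s => c (t - s) * h s) :
    Integrable (fun τ => a (t - τ) * ∫ s, b (τ - s) * h s) ∧
      ∫ τ, a (t - τ) * ∫ s, b (τ - s) * h s = ∫ s, c (t - s) * h s := by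
  have hcs : ∀ s, Integrable (fun τ => a (t - τ) * b (τ - s)) ∧
      ∫ τ, a (t - τ) * b (τ - s) = c (t - s) := fun s => by
    obtain ⟨h1, h2⟩ := hc (t - s)
    have e : (fun τ => a (t - τ) * b (τ - s)) = fun τ => (fun r => a (t - s - r) * b r)
        (τ - s) := by
      funext τ; simp
    rw [e]
    exact ⟨h1.comp_sub_right s, by
      rw [← h2]; exact integral_sub_right_eq_self (fun r => a (t - s - r) * b r) s⟩
  have hmeas : AEStronglyMeasurable (fun q : ℝ × ℝ => a (t - q.2) * b (q.2 - q.1) * h q.1)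
      (volume.prod volume) := by
    refine AEStronglyMeasurable.mul ?_ hh.comp_fst
    exact (Measurable.mul (hma.comp (by fun_prop)) (hmb.comp (by fun_prop))).aestronglyMeasurable
  have hprod : Integrable (fun q : ℝ × ℝ => a (t - q.2) * b (q.2 - q.1) * h q.1)
      (volume.prod volume) := by
    rw [integrable_prod_iff hmeas]
    refine ⟨.of_forall fun s => (hcs s).1.mul_const (h s), ?_⟩
    refine hch.norm.congr (.of_forall fun s => ?_)
    simp only [norm_mul]
    rw [integral_mul_const]
    congr 1
    have hcn : 0 ≤ c (t - s) := by
      rw [← (hcs s).2]; exact integral_nonneg fun τ => mul_nonneg (ha _) (hb _)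
    rw [Real.norm_of_nonneg hcn, ← (hcs s).2]
    refine integral_congr_ae (.of_forall fun τ => ?_)
    simp only [Real.norm_of_nonneg (ha _), Real.norm_of_nonneg (hb _)]
  have hin : ∀ τ, ∫ s, a (t - τ) * b (τ - s) * h s = a (t - τ) * ∫ s, b (τ - s) * h s := fun τ => by
    rw [← integral_const_mul]; simp_rw [mul_assoc]
  constructor
  · have := hprod.integral_prod_right
    simpa only [hin] using this
  · have := integral_integral_swap (f := fun s τ => a (t - τ) * b (τ - s) * h s) hprod
    simp only [hin] at this
    rw [← this]
    refine integral_congr_ae (.of_forall fun s => ?_)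
    simp only
    rw [integral_mul_const, (hcs s).2]

/-! ### Resolvent kernel and comparison principle for the Abel equation -/

/-- The resolvent kernel of `l * heatKernel · 0`; see `resolvent_conv_heatKernel`. -/
noncomputable def resolvent (l t : ℝ) : ℝ :=
  ∫ y in Ioi 0, l * Real.exp (-(l * y)) * poissonKernel y t

theorem resolvent_nonneg {l : ℝ} (hl : 0 < l) (t : ℝ) : 0 ≤ resolvent l t := by
  refine setIntegral_nonneg measurableSet_Ioi fun y hy => ?_
  exact mul_nonneg (by positivity) (poissonKernel_nonneg (le_of_lt hy) t)

theorem resolvent_of_nonpos {t : ℝ} (ht : t ≤ 0) (l : ℝ) : resolvent l t = 0 := by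
  simp [resolvent, poissonKernel_of_nonpos ht]

theorem measurable_resolvent (l : ℝ) : Measurable (resolvent l) := by
  have : StronglyMeasurable (Function.uncurry fun (t : ℝ) (y : ℝ) =>
      l * Real.exp (-(l * y)) * poissonKernel y t) := by
    refine Measurable.stronglyMeasurable ?_
    refine Measurable.mul (by fun_prop) ?_
    exact measurable_poissonKernel.comp (measurable_snd.prodMk measurable_fst)
  exact (this.integral_prod_right (ν := volume.restrict (Ioi 0))).measurable

theorem integrableOn_exp_mul_heatKernel {l : ℝ} (hl : 0 < l) (t : ℝ) :
    IntegrableOn (fun y => l * Real.exp (-(l * y)) * heatKernel t y) (Ioi 0) := by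
  rcases le_or_gt t 0 with ht | ht
  · simp [heatKernel_of_nonpos ht]
  refine Integrable.mono' ((integrableOn_heatKernel_right ht).const_mul l) ?_ ?_
  · exact (Continuous.mul (by fun_prop) (continuous_heatKernel_right t)).aestronglyMeasurable
  · filter_upwards [ae_restrict_mem measurableSet_Ioi] with y hy
    have hy' : 0 < y := hy
    rw [Real.norm_of_nonneg (mul_nonneg (by positivity) (heatKernel_nonneg _ _))]
    have h1 : Real.exp (-(l * y)) ≤ 1 := Real.exp_le_one_iff.2 (neg_nonpos.2 (by positivity))
    exact mul_le_mul_of_nonneg_right (mul_le_of_le_one_right hl.le h1) (heatKernel_nonneg _ _)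

/-- Integration by parts in `y`: the derivative of the heat kernel in space is minus the Poisson
kernel, and the boundary term at `y = 0` is the kernel at the boundary. -/
theorem resolvent_eq {l : ℝ} (hl : 0 < l) (t : ℝ) :
    ∫ y in Ioi 0, l * Real.exp (-(l * y)) * heatKernel t y =
        heatKernel t 0 - resolvent l t / l := by
  rcases le_or_gt t 0 with ht | ht
  · simp [heatKernel_of_nonpos ht, resolvent_of_nonpos ht]
  have hI1 := integrableOn_exp_mul_heatKernel hl t
  have hI2 : IntegrableOn (fun y => l * Real.exp (-(l * y)) * poissonKernel y t) (Ioi 0) := by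
    refine Integrable.mono' ((integrableOn_heatKernel_right ht).const_mul (1 / (2 * t))) ?_ ?_
    · refine Measurable.aestronglyMeasurable (Measurable.mul (by fun_prop) ?_)
      exact measurable_poissonKernel.comp (measurable_id.prodMk measurable_const)
    · filter_upwards [ae_restrict_mem measurableSet_Ioi] with y hy
      have hy' : 0 < y := hy
      rw [Real.norm_of_nonneg (mul_nonneg (by positivity) (poissonKernel_nonneg hy'.le _)),
        poissonKernel, ← mul_assoc]
      refine mul_le_mul_of_nonneg_right ?_ (heatKernel_nonneg _ _)
      have h1 : l * y * Real.exp (-(l * y)) ≤ 1 := by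
        rw [Real.exp_neg, ← div_eq_mul_inv, div_le_one (Real.exp_pos _)]
        linarith [Real.add_one_le_exp (l * y)]
      calc l * Real.exp (-(l * y)) * (y / (2 * t)) = (l * y * Real.exp (-(l * y))) / (2 * t) :=
          by ring
        _ ≤ 1 / (2 * t) := by gcongr
  have hd : ∀ y ∈ Ioi (0 : ℝ), HasDerivAt (fun y => -Real.exp (-(l * y)) * heatKernel t y)
      (l * Real.exp (-(l * y)) * heatKernel t y + 1 / l * (l * Real.exp
          (-(l * y)) * poissonKernel y t))
      y := fun y _ => by
    have h := ((((hasDerivAt_id y).const_mul l).fun_neg.exp).fun_neg).mul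
        (hasDerivAt_heatKernel_x t y)
    refine h.congr_deriv ?_
    simp only [id]; field_simp
  have htend : Tendsto (fun y => -Real.exp (-(l * y)) * heatKernel t y) atTop (𝓝 0) := by
    have h1 : Tendsto (fun y => Real.exp (-(l * y)) * heatKernel t 0) atTop (𝓝 0) := by
      have := Real.tendsto_exp_neg_atTop_nhds_zero.comp (tendsto_id.const_mul_atTop hl)
      simpa using this.mul_const (heatKernel t 0)
    refine squeeze_zero_norm (fun y => ?_) h1
    rw [norm_mul, norm_neg, Real.norm_of_nonneg (Real.exp_pos _).le,
      Real.norm_of_nonneg (heatKernel_nonneg _ _)]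
    exact mul_le_mul_of_nonneg_left (heatKernel_le _ _) (Real.exp_pos _).le
  have h := integral_Ioi_of_hasDerivAt_of_tendsto (a := 0) (Continuous.continuousWithinAt
    (Continuous.mul (by fun_prop) (continuous_heatKernel_right t))) hd (hI1.add
        (hI2.const_mul _)) htend
  rw [integral_add hI1 (hI2.const_mul _), integral_const_mul] at h
  simp only [Pi.mul_apply, mul_zero, neg_zero, Real.exp_zero] at h
  change _ + 1 / l * resolvent l t = _ at h
  rw [eq_sub_iff_add_eq, div_eq_mul_one_div, mul_comm (resolvent l t)]
  linarith

/-- Convolution with the Poisson kernel at distance `y` moves the heat kernel from `0` to `y`.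
Averaging this over the density `l exp(-l y) dy` and applying `resolvent_eq` gives the resolvent
equation, with positivity of the resolvent visible from its definition. -/
theorem resolvent_conv_heatKernel {l : ℝ} (hl : 0 < l) (t : ℝ) :
    Integrable (fun s => resolvent l (t - s) * heatKernel s 0) ∧
      ∫ s, resolvent l (t - s) * heatKernel s 0 = heatKernel t 0 - resolvent l t / l := by
  have hA : ∀ y ∈ Ioi (0 : ℝ), Integrable (fun s => poissonKernel y (t - s) * heatKernel s 0) ∧
      ∫ s, poissonKernel y (t - s) * heatKernel s 0 = heatKernel t y := fun y hy => by
    simpa only [add_zero] using poissonKernel_conv_heatKernel (z := 0) hy le_rfl t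
  have hprod : Integrable (fun q : ℝ × ℝ =>
      l * Real.exp (-(l * q.1)) * poissonKernel q.1 (t - q.2) * heatKernel q.2 0)
      ((volume.restrict (Ioi 0)).prod volume) := by
    rw [integrable_prod_iff]
    · constructor
      · filter_upwards [ae_restrict_mem measurableSet_Ioi] with y hy
        simpa only [mul_assoc] using (hA y hy).1.const_mul (l * Real.exp (-(l * y)))
      · refine (integrableOn_exp_mul_heatKernel hl t).congr ?_
        filter_upwards [ae_restrict_mem measurableSet_Ioi] with y hy
        rw [← (hA y hy).2, ← integral_const_mul]
        refine integral_congr_ae (.of_forall fun s => ?_)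
        simp only
        rw [← mul_assoc, Real.norm_of_nonneg]
        exact mul_nonneg (mul_nonneg (by positivity) (poissonKernel_nonneg (le_of_lt hy) _))
          (heatKernel_nonneg _ _)
    · refine Measurable.aestronglyMeasurable ?_
      refine Measurable.mul (Measurable.mul (by fun_prop) ?_) ?_
      · exact measurable_poissonKernel.comp (measurable_fst.prodMk (measurable_snd.const_sub t))
      · exact (measurable_heatKernel_left 0).comp measurable_snd
  have hin : ∀ s, ∫ y in Ioi 0, l * Real.exp (-(l * y)) * poissonKernel y (t - s) * heatKernel s 0
      = resolvent l (t - s) * heatKernel s 0 := fun s => by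
    rw [integral_mul_const]; rfl
  constructor
  · simpa only [hin] using hprod.integral_prod_right
  · have := integral_integral_swap (f := fun y s =>
      l * Real.exp (-(l * y)) * poissonKernel y (t - s) * heatKernel s 0) hprod
    simp only [hin] at this
    rw [← this, ← resolvent_eq hl t]
    refine setIntegral_congr_fun measurableSet_Ioi fun y hy => ?_
    rw [← (hA y hy).2, ← integral_const_mul]
    simp only [mul_assoc]

theorem resolvent_le {l : ℝ} (hl : 0 < l) (t : ℝ) : resolvent l t ≤ l * heatKernel t 0 := by
  have h : 0 ≤ heatKernel t 0 - resolvent l t / l := by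
    rw [← resolvent_eq hl t]
    exact setIntegral_nonneg measurableSet_Ioi fun y _ =>
      mul_nonneg (by positivity) (heatKernel_nonneg _ _)
  rw [sub_nonneg, div_le_iff₀ hl] at h
  linarith

/-- As `k` decreases, `(r * k)(T) ≥ k(T) ∫₀ᵀ r`, while the resolvent equation gives `r * k ≤ k`.
Dividing by `k(T) > 0` bounds the mass. -/
theorem integral_resolvent_le {l : ℝ} (hl : 0 < l) {T : ℝ} (hT : 0 < T) :
    IntegrableOn (resolvent l) (Ioo 0 T) ∧ ∫ t in Ioo 0 T, resolvent l t ≤ 1 := by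
  obtain ⟨h1, h2⟩ := resolvent_conv_heatKernel hl T
  have h1' : Integrable fun s => resolvent l s * heatKernel (T - s) 0 := by
    simpa using h1.comp_sub_left T
  have h2' : ∫ s, resolvent l s * heatKernel (T - s) 0 = heatKernel T 0 - resolvent l T / l := by
    rw [← h2, ← integral_sub_left_eq_self (fun s => resolvent l (T - s) * heatKernel s 0) volume T]
    simp
  have hk := heatKernel_pos hT 0
  have hle : ∀ s ∈ Ioo 0 T, resolvent l s * heatKernel T 0 ≤ resolvent l s * heatKernel (T - s) 0 :=
    fun s hs => mul_le_mul_of_nonneg_left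
      (heatKernel_antitone (by linarith [hs.2]) (by linarith [hs.1])) (resolvent_nonneg hl s)
  have hi : IntegrableOn (fun s => resolvent l s * heatKernel T 0) (Ioo 0 T) := by
    refine Integrable.mono' (h1'.integrableOn (s := Ioo 0 T)) ?_ ?_
    · exact ((measurable_resolvent l).mul_const _).aestronglyMeasurable
    · filter_upwards [ae_restrict_mem measurableSet_Ioo] with s hs
      rw [Real.norm_of_nonneg (mul_nonneg (resolvent_nonneg hl s) hk.le)]
      exact hle s hs
  have hi' : IntegrableOn (resolvent l) (Ioo 0 T) := by
    refine IntegrableOn.congr_fun (hi.mul_const (heatKernel T 0)⁻¹)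
        (fun s _ => ?_) measurableSet_Ioo
    field_simp
  refine ⟨hi', ?_⟩
  have h3 : (∫ t in Ioo 0 T, resolvent l t) * heatKernel T 0 ≤ 1 * heatKernel T 0 := by
    rw [← integral_mul_const, one_mul]
    calc ∫ t in Ioo 0 T, resolvent l t * heatKernel T 0
        ≤ ∫ s in Ioo 0 T, resolvent l s * heatKernel (T - s) 0 :=
          setIntegral_mono_on hi h1'.integrableOn measurableSet_Ioo hle
      _ ≤ ∫ s, resolvent l s * heatKernel (T - s) 0 :=
          setIntegral_le_integral h1' (.of_forall fun s =>
            mul_nonneg (resolvent_nonneg hl s) (heatKernel_nonneg _ _))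
      _ ≤ heatKernel T 0 := by
          rw [h2']
          have : 0 ≤ resolvent l T / l := div_nonneg (resolvent_nonneg hl T) hl.le
          linarith
  exact le_of_mul_le_mul_right h3 hk

/-- Young's inequality for causal kernels of mass at most one. -/
theorem integral_causal_conv_le {a f : ℝ → ℝ} {T A : ℝ} (ha : ∀ t, 0 ≤ a t)
    (ham : Measurable a) (ha0 : ∀ t ≤ 0, a t = 0) (hai : IntegrableOn a (Ioo 0 T))
    (ha1 : ∫ t in Ioo 0 T, a t ≤ A) (hf : Integrable f) (hf0 : ∀ t ≤ 0, f t = 0)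
    (hfn : ∀ t, 0 ≤ f t) :
    (∀ᵐ t, t ∈ Ioo 0 T → Integrable fun s => a (t - s) * f s) ∧
      IntegrableOn (fun t => ∫ s, a (t - s) * f s) (Ioo 0 T) ∧
      ∫ t in Ioo 0 T, ∫ s, a (t - s) * f s ≤ A * ∫ s, f s := by
  set b := (Ioo 0 T).indicator a with hb
  have hbi : Integrable b := (integrable_indicator_iff measurableSet_Ioo).2 hai
  have hbm : Measurable b := ham.indicator measurableSet_Ioo
  have hbn : ∀ t, 0 ≤ b t := fun t => indicator_nonneg (fun t _ => ha t) t
  have hprod : Integrable (fun q : ℝ × ℝ => b (q.2 - q.1) * f q.1) (volume.prod volume) := by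
    rw [integrable_prod_iff]
    · refine ⟨.of_forall fun s => (hbi.comp_sub_right s).mul_const (f s), ?_⟩
      have : ∀ s, ∫ t, ‖b (t - s) * f s‖ = (∫ t, b t) * f s := fun s => by
        rw [← integral_sub_right_eq_self b s, ← integral_mul_const]
        refine integral_congr_ae (.of_forall fun t => ?_)
        simp only
        rw [Real.norm_of_nonneg (mul_nonneg (hbn _) (hfn _))]
      simp only [this]
      exact hf.const_mul _
    · exact (hbm.comp (by fun_prop)).aestronglyMeasurable.mul hf.1.comp_fst
  have heq : ∀ t < T, ∀ s, a (t - s) * f s = b (t - s) * f s := fun t ht s => by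
    rcases le_or_gt s 0 with h | h
    · simp [hf0 s h]
    · rcases le_or_gt (t - s) 0 with h' | h'
      · simp [hb, ha0 _ h', not_lt.2 h']
      · rw [hb, indicator_of_mem (mem_Ioo.2 ⟨h', by linarith⟩)]
  have hnn : ∀ t, 0 ≤ ∫ s, b (t - s) * f s := fun t =>
    integral_nonneg fun s => mul_nonneg (hbn _) (hfn _)
  refine ⟨?_, ?_, ?_⟩
  · filter_upwards [hprod.prod_left_ae] with t ht htT
    simpa only [heq t htT.2] using ht
  · refine IntegrableOn.congr_fun hprod.integral_prod_right.integrableOn (fun t ht => ?_)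
      measurableSet_Ioo
    simp only [heq t ht.2]
  · calc ∫ t in Ioo 0 T, ∫ s, a (t - s) * f s = ∫ t in Ioo 0 T, ∫ s, b (t - s) * f s := by
          refine setIntegral_congr_fun measurableSet_Ioo fun t ht => ?_
          simp only [heq t ht.2]
      _ ≤ ∫ t, ∫ s, b (t - s) * f s :=
          setIntegral_le_integral hprod.integral_prod_right (.of_forall hnn)
      _ = ∫ s, (∫ t, b t) * f s := by
          rw [← integral_integral_swap (f := fun s t => b (t - s) * f s) hprod]
          refine integral_congr_ae (.of_forall fun s => ?_)
          simp only
          rw [integral_mul_const, integral_sub_right_eq_self b s]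
      _ ≤ A * ∫ s, f s := by
          rw [integral_const_mul, hb, integral_indicator measurableSet_Ioo]
          exact mul_le_mul_of_nonneg_right ha1 (integral_nonneg hfn)

theorem ae_integrable_causal_conv {a h : ℝ → ℝ} {T : ℝ} (ha : ∀ t, 0 ≤ a t)
    (ham : Measurable a) (ha0 : ∀ t ≤ 0, a t = 0) (hai : IntegrableOn a (Ioo 0 T))
    (hh : Integrable h) (hh0 : ∀ t ≤ 0, h t = 0) :
    ∀ᵐ t, t ∈ Ioo 0 T → Integrable fun s => a (t - s) * h s := by
  filter_upwards [(integral_causal_conv_le ha ham ha0 hai le_rfl hh.norm (fun t ht => by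
    simp [hh0 t ht]) fun t => norm_nonneg _).1] with t ht htT
  refine (ht htT).mono ?_ (.of_forall fun s => by simp)
  exact (ham.comp (by fun_prop)).aestronglyMeasurable.mul hh.1

/-- Convolving the equation with `r` and inserting `r * k = k - r/l` gives `w = r * (w - h/l) - c
r/l`, and the last term has a favourable sign. -/
theorem le_resolvent_conv {T c l : ℝ} {w h : ℝ → ℝ} (hc : 0 ≤ c) (hl : 0 < l)
    (hhi : Integrable h) (hw0 : ∀ t ∉ Ioo 0 T, w t = 0)
    (hh0 : ∀ t ∉ Ioo 0 T, h t = 0)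
    (heq : ∀ᵐ t, t ∈ Ioo 0 T → w t = -(c * heatKernel t 0) - ∫ s, heatKernel (t - s) 0 * h s) :
    ∀ᵐ t, t ∈ Ioo 0 T → Integrable (fun s => resolvent l (t - s) * (w s - h s / l)) ∧
      w t ≤ ∫ s, resolvent l (t - s) * (w s - h s / l) := by
  have hk := ae_integrable_causal_conv (a := fun t => heatKernel t 0) (T := T)
    (fun t => heatKernel_nonneg t 0) (measurable_heatKernel_left 0)
    (fun t ht => heatKernel_of_nonpos ht 0)
    ((integrableOn_heatKernel_left T 0).mono_set fun t ht => ht.2) hhi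
    (fun t ht => hh0 t fun h => absurd h.1 (not_lt.2 ht))
  filter_upwards [heq, hk] with t ht1 ht2 htT
  specialize ht1 htT
  specialize ht2 htT
  have hrm : Measurable fun s => resolvent l (t - s) := (measurable_resolvent l).comp (by fun_prop)
  have hrh : Integrable fun s => resolvent l (t - s) * h s := by
    refine Integrable.mono' (ht2.norm.const_mul l) (hrm.aestronglyMeasurable.mul hhi.1)
      (.of_forall fun s => ?_)
    rw [norm_mul, norm_mul, ← mul_assoc, Real.norm_of_nonneg (resolvent_nonneg hl _),
      Real.norm_of_nonneg (heatKernel_nonneg _ _)]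
    exact mul_le_mul_of_nonneg_right (resolvent_le hl _) (norm_nonneg _)
  have hch : Integrable fun s => (heatKernel (t - s) 0 - resolvent l (t - s) / l) * h s := by
    refine (ht2.sub (hrh.div_const l)).congr (.of_forall fun s => ?_)
    simp only [Pi.sub_apply]; ring
  obtain ⟨hA1, hA2⟩ := conv_assoc (a := resolvent l) (b := fun t => heatKernel t 0)
    (resolvent_nonneg hl) (fun t => heatKernel_nonneg t 0) (measurable_resolvent l)
    (measurable_heatKernel_left 0) (resolvent_conv_heatKernel hl) hhi.1 hch
  obtain ⟨hR1, hR2⟩ := resolvent_conv_heatKernel hl t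
  have hww : ∀ᵐ τ, resolvent l (t - τ) * w τ = -c * (resolvent l (t - τ) * heatKernel τ 0)
      - resolvent l (t - τ) * ∫ s, heatKernel (τ - s) 0 * h s := by
    filter_upwards [heq] with τ hτ
    rcases le_or_gt τ 0 with h1 | h1
    · have : ∀ s, heatKernel (τ - s) 0 * h s = 0 := fun s => by
        rcases le_or_gt s 0 with h2 | h2
        · rw [hh0 s fun h => absurd h.1 (not_lt.2 h2), mul_zero]
        · rw [heatKernel_of_nonpos (by linarith), zero_mul]
      rw [hw0 τ fun h => absurd h.1 (not_lt.2 h1), heatKernel_of_nonpos h1]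
      simp [this]
    · rcases lt_or_ge τ T with h2 | h2
      · rw [hτ ⟨h1, h2⟩]; ring
      · rw [resolvent_of_nonpos (by linarith [htT.2])]; ring
  have hrw : Integrable fun τ => resolvent l (t - τ) * w τ :=
    ((hR1.const_mul (-c)).sub hA1).congr (hww.mono fun τ h => h.symm)
  have hrwv : ∫ τ, resolvent l (t - τ) * w τ = w t + c * (resolvent l t / l)
      + (∫ s, resolvent l (t - s) * h s) / l := by
    rw [integral_congr_ae hww, integral_sub (hR1.const_mul (-c)) hA1, integral_const_mul, hR2, hA2,
      ht1, ← integral_div]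
    have : ∫ s, (heatKernel (t - s) 0 - resolvent l (t - s) / l) * h s
        = (∫ s, heatKernel (t - s) 0 * h s) - ∫ s, resolvent l (t - s) * h s / l := by
      rw [← integral_sub ht2 (hrh.div_const l)]
      refine integral_congr_ae (.of_forall fun s => ?_)
      simp only; ring
    rw [this]; ring
  have hsplit : (fun s => resolvent l (t - s) * (w s - h s / l))
      = fun s => resolvent l (t - s) * w s - resolvent l (t - s) * h s / l := by
    funext s; ring
  rw [hsplit]
  refine ⟨hrw.sub (hrh.div_const l), ?_⟩
  rw [integral_sub hrw (hrh.div_const l), hrwv, integral_div]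
  have : 0 ≤ c * (resolvent l t / l) := mul_nonneg hc (div_nonneg (resolvent_nonneg hl t) hl.le)
  linarith

/-- The bound `w ≤ r * (w - h/l)` passes to positive parts because `r ≥ 0`, and convolution with `r`
does not increase the `L¹` norm because its mass is at most one. -/
theorem integral_pos_part_le {T c l : ℝ} (hT : 0 < T) {w h : ℝ → ℝ} (hc : 0 ≤ c) (hl : 0 < l)
    (hhi : Integrable h) (hw0 : ∀ t ∉ Ioo 0 T, w t = 0)
    (hh0 : ∀ t ∉ Ioo 0 T, h t = 0) (hwi : Integrable w)
    (heq : ∀ᵐ t, t ∈ Ioo 0 T → w t = -(c * heatKernel t 0) - ∫ s, heatKernel (t - s) 0 * h s) :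
    ∫ t, max (w t) 0 ≤ ∫ t, max (w t - h t / l) 0 := by
  have hfi : Integrable fun t => max (w t - h t / l) 0 := (hwi.sub (hhi.div_const l)).pos_part
  obtain ⟨hr1, hr2⟩ := integral_resolvent_le hl hT
  obtain ⟨h1, h2, h3⟩ := integral_causal_conv_le (resolvent_nonneg hl) (measurable_resolvent l)
    (fun t ht => resolvent_of_nonpos ht l) hr1 hr2 hfi
    (fun t ht => by
      have : t ∉ Ioo 0 T := fun h => absurd h.1 (not_lt.2 ht)
      simp [hw0 t this, hh0 t this])
    (fun t => le_max_right _ _)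
  rw [one_mul] at h3
  refine le_trans ?_ h3
  have : ∫ t, max (w t) 0 = ∫ t in Ioo 0 T, max (w t) 0 :=
    (setIntegral_eq_integral_of_forall_compl_eq_zero fun t ht => by simp [hw0 t ht]).symm
  rw [this]
  refine setIntegral_mono_on_ae hwi.pos_part.integrableOn h2 measurableSet_Ioo ?_
  filter_upwards [h1, le_resolvent_conv hc hl hhi hw0 hh0 heq] with t ht1 ht2 htT
  refine max_le ((ht2 htT).2.trans (integral_mono (ht2 htT).1 (ht1 htT) fun s => ?_)) ?_
  · exact mul_le_mul_of_nonneg_left (le_max_left _ _) (resolvent_nonneg hl _)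
  · exact integral_nonneg fun s => mul_nonneg (resolvent_nonneg hl _) (le_max_right _ _)

/-- Comparison principle for the Abel equation `w = -c k - k * h` when `h` has the sign of `w`. -/
theorem comparison {T c : ℝ} (hT : 0 < T) {w h : ℝ → ℝ} (hc : 0 ≤ c)
    (hhi : Integrable h) (hwi : Integrable w) (hw0 : ∀ t ∉ Ioo 0 T, w t = 0)
    (heq : ∀ᵐ t, t ∈ Ioo 0 T → w t = -(c * heatKernel t 0) - ∫ s, heatKernel (t - s) 0 * h s)
    (hpos : ∀ t, 0 < w t → 0 ≤ h t) (hneg : ∀ t, w t < 0 → h t ≤ 0)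
    (hzero : ∀ t, w t = 0 → h t = 0) : ∀ᵐ t, h t ≤ 0 := by
  have hh0 : ∀ t ∉ Ioo 0 T, h t = 0 := fun t ht => hzero t (hw0 t ht)
  -- Take `l = n + 1`. Where `|h| ≤ l |w|`, the sign conditions give `(w - h/l)⁺ = w⁺ - h⁺/l`;
  -- elsewhere the error is at most `|h|/l`. Thus `e n` collects the error, and it tends to `0`
  -- because `h` vanishes where `w` does.
  set e : ℕ → ℝ → ℝ := fun n => {t | (n + 1 : ℝ) * ‖w t‖ < ‖h t‖}.indicator fun t => ‖h t‖ with he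
  have hset : ∀ n : ℕ, NullMeasurableSet {t | (n + 1 : ℝ) * ‖w t‖ < ‖h t‖} := fun n =>
    nullMeasurableSet_lt (hwi.1.norm.aemeasurable.const_mul _) hhi.1.norm.aemeasurable
  have hein : ∀ (n : ℕ) t, (n + 1 : ℝ) * ‖w t‖ < ‖h t‖ → e n t = ‖h t‖ := fun n t ht =>
    indicator_of_mem (s := {t | (n + 1 : ℝ) * ‖w t‖ < ‖h t‖}) ht _
  have heout : ∀ (n : ℕ) t, ¬ (n + 1 : ℝ) * ‖w t‖ < ‖h t‖ → e n t = 0 := fun n t ht =>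
    indicator_of_notMem (s := {t | (n + 1 : ℝ) * ‖w t‖ < ‖h t‖}) ht _
  have hei : ∀ n, Integrable (e n) := fun n => hhi.norm.indicator₀ (hset n)
  have hle : ∀ n, ∫ t, max (h t) 0 ≤ ∫ t, e n t := fun n => by
    have hl : (0 : ℝ) < n + 1 := by positivity
    have h1 := integral_pos_part_le hT hc hl hhi hw0 hh0 hwi heq
    have h2 : ∫ t, max (w t - h t / (n + 1)) 0 ≤
        ∫ t, (max (w t) 0 - max (h t) 0 / (n + 1) + e n t / (n + 1)) := by
      refine integral_mono (hwi.sub (hhi.div_const _)).pos_part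
        ((hwi.pos_part.sub (hhi.pos_part.div_const _)).add ((hei n).div_const _)) fun t => ?_
      simp only
      rcases lt_trichotomy (w t) 0 with hw | hw | hw
      · have hh := hneg t hw
        rw [max_eq_right hw.le, max_eq_right hh]
        refine max_le ?_ ?_
        · by_cases hm : (n + 1 : ℝ) * ‖w t‖ < ‖h t‖
          · rw [hein n t hm,
              Real.norm_of_nonpos hh, neg_div]
            simp only [zero_div]; linarith
          · rw [heout n t hm]
            rw [not_lt, Real.norm_of_nonpos hh, Real.norm_of_nonpos hw.le] at hm
            have : -h t / (n + 1) ≤ -w t := by rw [div_le_iff₀ hl]; linarith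
            rw [neg_div] at this
            simp only [zero_div]; linarith
        · have : 0 ≤ e n t := indicator_nonneg (fun t _ => norm_nonneg _) t
          have := div_nonneg this hl.le
          simp only [zero_div]; linarith
      · have hh := hzero t hw
        have : 0 ≤ e n t := indicator_nonneg (fun t _ => norm_nonneg _) t
        have := div_nonneg this hl.le
        simp only [hw, hh, zero_div, sub_zero, max_self, zero_add]
        exact this
      · have hh := hpos t hw
        rw [max_eq_left hw.le, max_eq_left hh]
        by_cases hm : (n + 1 : ℝ) * ‖w t‖ < ‖h t‖
        · rw [hein n t hm]
          rw [Real.norm_of_nonneg hh, Real.norm_of_nonneg hw.le] at hm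
          have h3 : w t ≤ h t / (n + 1) := by rw [le_div_iff₀ hl]; linarith
          rw [Real.norm_of_nonneg hh]
          exact max_le (by linarith) (by linarith)
        · rw [heout n t hm]
          rw [not_lt, Real.norm_of_nonneg hh, Real.norm_of_nonneg hw.le] at hm
          have h3 : h t / (n + 1) ≤ w t := by rw [div_le_iff₀ hl]; linarith
          exact max_le (by simp) (by simp; linarith)
    have hi1 : Integrable fun t => max (w t) 0 - max (h t) 0 / ((n : ℝ) + 1) :=
      hwi.pos_part.sub (hhi.pos_part.div_const _)
    rw [integral_add hi1 ((hei n).div_const _),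
      integral_sub hwi.pos_part (hhi.pos_part.div_const _), integral_div, integral_div] at h2
    -- The integrals of `w⁺` cancel, and the common factor `1/(n+1)` then drops out.
    have h4 : (∫ t, max (h t) 0) / ((n : ℝ) + 1) ≤ (∫ t, e n t) / ((n : ℝ) + 1) := by linarith
    exact (div_le_div_iff_of_pos_right hl).1 h4
  have hlim : Tendsto (fun n => ∫ t, e n t) atTop (𝓝 (∫ _ : ℝ, (0 : ℝ))) := by
    refine tendsto_integral_of_dominated_convergence (fun t => ‖h t‖) (fun n => (hei n).1) hhi.norm
      (fun n => .of_forall fun t => ?_) (.of_forall fun t => ?_)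
    · rw [Real.norm_of_nonneg (indicator_nonneg (fun t _ => norm_nonneg _) t)]
      exact indicator_le_self' (fun _ _ => norm_nonneg _) t
    · by_cases hw : w t = 0
      · have : ∀ n, e n t = 0 := fun n => by simp [he, indicator, hzero t hw]
        simp only [this]; exact tendsto_const_nhds
      · refine tendsto_const_nhds.congr' ?_
        have hw' : 0 < ‖w t‖ := norm_pos_iff.2 hw
        filter_upwards [eventually_ge_atTop ⌈‖h t‖ / ‖w t‖⌉₊] with n hn
        have h5 : ‖h t‖ / ‖w t‖ ≤ n := (Nat.le_ceil _).trans (by exact_mod_cast hn)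
        rw [div_le_iff₀ hw'] at h5
        refine (heout n t (not_lt.2 ?_)).symm
        nlinarith
  rw [integral_zero] at hlim
  have h0 : ∫ t, max (h t) 0 ≤ 0 := ge_of_tendsto' hlim hle
  have h1 : ∫ t, max (h t) 0 = 0 := le_antisymm h0 (integral_nonneg fun t => le_max_right _ _)
  have h2 := (integral_eq_zero_iff_of_nonneg (f := fun t => max (h t) 0)
    (fun t => le_max_right _ _) hhi.pos_part).1 h1
  filter_upwards [h2] with t ht
  exact max_eq_right_iff.1 ht

/-! ### The power nonlinearity and continuity of heat potentials -/

theorem powerFlux_of_nonneg {p r : ℝ} (hp : p ≠ 0) (hr : 0 ≤ r) : powerFlux p r = r ^ p := by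
  rcases hr.eq_or_lt with rfl | hr
  · simp [powerFlux, Real.zero_rpow hp]
  · rw [powerFlux, abs_of_pos hr, ← Real.rpow_add_one hr.ne']; simp

theorem powerFlux_neg (p r : ℝ) : powerFlux p (-r) = -powerFlux p r := by
  simp [powerFlux]

theorem powerFlux_zero (p : ℝ) : powerFlux p 0 = 0 := by simp [powerFlux]

theorem abs_powerFlux {p : ℝ} (hp : p ≠ 0) (r : ℝ) : |powerFlux p r| = |r| ^ p := by
  rcases le_total 0 r with h | h
  · rw [powerFlux_of_nonneg hp h, abs_of_nonneg h, abs_of_nonneg (Real.rpow_nonneg h _)]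
  · have := powerFlux_of_nonneg hp (neg_nonneg.2 h)
    rw [powerFlux_neg] at this
    rw [← abs_neg, this, abs_of_nonpos h, abs_of_nonneg (Real.rpow_nonneg (neg_nonneg.2 h) _)]

theorem continuous_powerFlux {p : ℝ} (hp : 1 ≤ p) : Continuous (powerFlux p) := by
  unfold powerFlux
  exact (continuous_abs.rpow_const fun _ => Or.inr (by linarith)).mul continuous_id

theorem strictMono_powerFlux {p : ℝ} (hp : 0 < p) : StrictMono (powerFlux p) := by
  refine strictMono_of_odd_strictMonoOn_nonneg (powerFlux_neg p) fun a ha b hb hab => ?_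
  rw [powerFlux_of_nonneg hp.ne' ha, powerFlux_of_nonneg hp.ne' hb]
  exact Real.rpow_lt_rpow ha hab hp

/-- The mean value theorem on `[0,M]` covers equal signs; for opposite signs one adds the bounds
against `0`. -/
theorem abs_powerFlux_sub_le {p M a b : ℝ} (hp : 1 ≤ p) (ha : |a| ≤ M) (hb : |b| ≤ M) :
    |powerFlux p a - powerFlux p b| ≤ p * M ^ (p - 1) * |a - b| := by
  have hM : 0 ≤ M := (abs_nonneg a).trans ha
  have hp0 : p ≠ 0 := by linarith
  have key : ∀ x y : ℝ, 0 ≤ x → 0 ≤ y → x ≤ M → y ≤ M →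
      |x ^ p - y ^ p| ≤ p * M ^ (p - 1) * |x - y| := fun x y hx hy hxM hyM => by
    refine Convex.norm_image_sub_le_of_norm_hasDerivWithin_le (s := Icc 0 M) (f := fun r => r ^ p)
      (f' := fun r => p * r ^ (p - 1))
      (fun r _ => (Real.hasDerivAt_rpow_const (Or.inr hp)).hasDerivWithinAt) (fun r hr => ?_)
      (convex_Icc 0 M) ⟨hy, hyM⟩ ⟨hx, hxM⟩
    rw [Real.norm_of_nonneg (mul_nonneg (by linarith) (Real.rpow_nonneg hr.1 _))]
    exact mul_le_mul_of_nonneg_left (Real.rpow_le_rpow hr.1 hr.2 (by linarith)) (by linarith)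
  have hmix : ∀ x y : ℝ, 0 ≤ x → 0 ≤ y → x ≤ M → y ≤ M →
      |x ^ p + y ^ p| ≤ p * M ^ (p - 1) * |x + y| := fun x y hx hy hxM hyM => by
    have h1 : ∀ z, 0 ≤ z → z ≤ M → z ^ p ≤ p * M ^ (p - 1) * z := fun z hz hzM => by
      have h2 := key z 0 hz le_rfl hzM hM
      rwa [Real.zero_rpow hp0, sub_zero, sub_zero, abs_of_nonneg hz,
        abs_of_nonneg (Real.rpow_nonneg hz _)] at h2
    rw [abs_of_nonneg (add_nonneg hx hy),
      abs_of_nonneg (add_nonneg (Real.rpow_nonneg hx _) (Real.rpow_nonneg hy _)), mul_add]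
    exact add_le_add (h1 x hx hxM) (h1 y hy hyM)
  have e : ∀ r, r ≤ 0 → powerFlux p r = -(-r) ^ p := fun r hr => by
    rw [← powerFlux_of_nonneg hp0 (neg_nonneg.2 hr), powerFlux_neg, neg_neg]
  rw [abs_le] at ha hb
  rcases le_total 0 a with h1 | h1 <;> rcases le_total 0 b with h2 | h2
  · rw [powerFlux_of_nonneg hp0 h1, powerFlux_of_nonneg hp0 h2]
    exact key a b h1 h2 ha.2 hb.2
  · rw [powerFlux_of_nonneg hp0 h1, e b h2]
    have := hmix a (-b) h1 (by linarith) ha.2 (by linarith)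
    rwa [sub_neg_eq_add, sub_eq_add_neg a b]
  · rw [powerFlux_of_nonneg hp0 h2, e a h1, ← abs_neg, ← abs_neg (a - b)]
    have := hmix b (-a) h2 (by linarith) hb.2 (by linarith)
    convert this using 2 <;> ring_nf
  · rw [e a h1, e b h2]
    have := key (-b) (-a) (by linarith) (by linarith) (by linarith) (by linarith)
    convert this using 2 <;> ring_nf

theorem heatKernel_bound {b C t x s r : ℝ} (hst : s < t) (hr : |r| ≤ C * s ^ (-b)) :
    ‖heatKernel (t - s) x * r‖ ≤
      (√Real.pi)⁻¹ * C * (s ^ ((1 - b) - 1) * (t - s) ^ ((1 / 2 : ℝ) - 1)) := by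
  rw [norm_mul, Real.norm_of_nonneg (heatKernel_nonneg _ _)]
  calc heatKernel (t - s) x * ‖r‖ ≤ heatKernel (t - s) 0 * (C * s ^ (-b)) :=
        mul_le_mul (heatKernel_le _ _) hr (norm_nonneg _) (heatKernel_nonneg _ _)
    _ = _ := by
        rw [heatKernel_at_zero_rpow (by linarith), show (1 - b) - 1 = -b by ring,
          show (1 / 2 : ℝ) - 1 = -(1 / 2) by norm_num]
        ring

theorem integrable_heatKernel_mul {h : ℝ → ℝ} {C b t : ℝ} (hb : b < 1) (hm : AEStronglyMeasurable h)
    (h0 : ∀ s ≤ 0, h s = 0) (hbd : ∀ s, 0 < s → |h s| ≤ C * s ^ (-b)) (x : ℝ) :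
    Integrable (fun s => heatKernel (t - s) x * h s) := by
  rw [(integral_causal (t := t) (fun s hs => by rw [h0 s hs, mul_zero]) (fun s hs => by
    rw [heatKernel_of_nonpos (by linarith), zero_mul])).1]
  rcases le_or_gt t 0 with ht | ht
  · simp [Ioo_eq_empty (not_lt.2 ht)]
  refine Integrable.mono' ((integrableOn_beta_scaled (a := 1 - b) (b := 1 / 2) (by linarith)
    (by norm_num) ht).1.const_mul ((√Real.pi)⁻¹ * C)) ?_ ?_
  · exact ((((measurable_heatKernel_left x).comp (measurable_const.sub
      measurable_id)).aestronglyMeasurable).mul hm).restrict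
  · filter_upwards [ae_restrict_mem measurableSet_Ioo] with s hs
    exact heatKernel_bound hs.2 (hbd s hs.1)

theorem aestronglyMeasurable_of_causal {h : ℝ → ℝ} (hc : ContinuousOn h (Ioi 0))
    (h0 : ∀ s ≤ 0, h s = 0) : AEStronglyMeasurable h := by
  have : h = (Ioi 0).indicator h := by
    funext s
    by_cases hs : s ∈ Ioi (0 : ℝ)
    · rw [indicator_of_mem hs]
    · rw [indicator_of_notMem hs, h0 s (not_lt.1 hs)]
  rw [this, aestronglyMeasurable_indicator_iff measurableSet_Ioi]
  exact hc.aestronglyMeasurable measurableSet_Ioi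

/-- The substitution `s = t σ` fixes the domain of integration to `(0,1)`, where a Beta integrand
dominates locally uniformly in `(t,x)`. -/
theorem continuousOn_heatPotential {h : ℝ → ℝ} {C b : ℝ} (hb : b < 1)
    (hc : ContinuousOn h (Ioi 0)) (h0 : ∀ s ≤ 0, h s = 0)
    (hbd : ∀ s, 0 < s → |h s| ≤ C * s ^ (-b)) :
    ContinuousOn (fun z : ℝ × ℝ => ∫ s, heatKernel (z.1 - s) z.2 * h s) (Ioi 0 ×ˢ univ) := by
  have heq : EqOn (fun z : ℝ × ℝ => ∫ s, heatKernel (z.1 - s) z.2 * h s)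
      (fun z => ∫ s in Ioo (0 : ℝ) 1, z.1 * (heatKernel (z.1 - z.1 * s) z.2 * h (z.1 * s)))
      (Ioi 0 ×ˢ univ) := fun z hz => by
    have hz1 : 0 < z.1 := hz.1
    simp only
    rw [(integral_causal (t := z.1) (fun s hs => by rw [h0 s hs, mul_zero]) (fun s hs => by
      rw [heatKernel_of_nonpos (by linarith), zero_mul])).2]
    exact (integrableOn_Ioo_scale hz1 fun s => heatKernel (z.1 - s) z.2 * h s).2
  refine ContinuousOn.congr ?_ heq
  intro z₀ hz₀
  have hz₀1 : 0 < z₀.1 := hz₀.1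
  -- The scaled integrand carries the factor `t^(1/2-b)`, which stays below `M` near `z₀`.
  set M := z₀.1 ^ (1 - b + 1 / 2 - 1) + 1
  have hM : ∀ᶠ z in 𝓝[Ioi 0 ×ˢ univ] z₀, z.1 ^ (1 - b + 1 / 2 - 1) ≤ M := by
    refine Filter.Eventually.filter_mono nhdsWithin_le_nhds ?_
    have : ContinuousAt (fun z : ℝ × ℝ => z.1 ^ (1 - b + 1 / 2 - 1)) z₀ :=
      continuousAt_fst.rpow_const (Or.inl hz₀1.ne')
    exact (this.eventually_lt_const (lt_add_one _)).mono fun z hz => hz.le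
  have hC : 0 ≤ C := by
    have := (abs_nonneg _).trans (hbd 1 one_pos); simpa using this
  refine continuousWithinAt_of_dominated
    (bound := fun s => (√Real.pi)⁻¹ * C * M * (s ^ ((1 - b) - 1) * (1 - s) ^ ((1 / 2 : ℝ) - 1)))
    ?_ ?_ ?_ ?_
  · filter_upwards [self_mem_nhdsWithin] with z hz
    have hz1 : 0 < z.1 := hz.1
    refine AEStronglyMeasurable.const_mul (AEStronglyMeasurable.mul ?_ ?_) _
    · exact ((measurable_heatKernel_left z.2).comp (by fun_prop)).aestronglyMeasurable
    · refine ContinuousOn.aestronglyMeasurable (hc.comp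
          (by fun_prop) fun s hs => ?_) measurableSet_Ioo
      exact mul_pos hz1 hs.1
  · filter_upwards [self_mem_nhdsWithin, hM] with z hz hzM
    have hz1 : 0 < z.1 := hz.1
    filter_upwards [ae_restrict_mem measurableSet_Ioo] with s hs
    have hs1 := hs.1
    have hs2 : 0 < 1 - s := by linarith [hs.2]
    have := heatKernel_bound (t := z.1) (x := z.2)
      (by nlinarith [hs.2]) (hbd (z.1 * s) (mul_pos hz1 hs1))
    rw [norm_mul, Real.norm_of_nonneg hz1.le]
    calc z.1 * ‖heatKernel (z.1 - z.1 * s) z.2 * h (z.1 * s)‖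
        ≤ z.1 * ((√Real.pi)⁻¹ * C * ((z.1 * s) ^ ((1 - b) - 1)
          * (z.1 - z.1 * s) ^ ((1 / 2 : ℝ) - 1))) := by gcongr
      _ = (√Real.pi)⁻¹ * C * z.1 ^ (1 - b + 1 / 2 - 1)
          * (s ^ ((1 - b) - 1) * (1 - s) ^ ((1 / 2 : ℝ) - 1)) := by
          rw [show z.1 - z.1 * s = z.1 * (1 - s) by ring, Real.mul_rpow hz1.le hs1.le,
            Real.mul_rpow hz1.le hs2.le,
            show 1 - b + 1 / 2 - 1 = 1 + (1 - b - 1) + ((1 / 2 : ℝ) - 1) by ring,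
            Real.rpow_add hz1, Real.rpow_add hz1, Real.rpow_one]
          ring
      _ ≤ _ := by gcongr
  · exact (integrableOn_beta (by linarith) (by norm_num)).1.const_mul _
  · filter_upwards [ae_restrict_mem measurableSet_Ioo] with s hs
    have hs2 : 0 < 1 - s := by linarith [hs.2]
    have h1 : ContinuousAt (fun z : ℝ × ℝ => heatKernel (z.1 - z.1 * s) z.2) z₀ := by
      have := (continuousOn_heatKernel.continuousAt (x := (z₀.1 - z₀.1 * s, z₀.2))
        ((isOpen_Ioi.prod isOpen_univ).mem_nhds ⟨by
          show 0 < z₀.1 - z₀.1 * s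
          nlinarith, trivial⟩))
      exact ContinuousAt.comp (f := fun z : ℝ × ℝ => (z.1 - z.1 * s, z.2)) this (by fun_prop)
    have h2 : ContinuousAt (fun z : ℝ × ℝ => h (z.1 * s)) z₀ :=
      ContinuousAt.comp (f := fun z : ℝ × ℝ => z.1 * s)
        (hc.continuousAt (isOpen_Ioi.mem_nhds (mul_pos hz₀1 hs.1))) (by fun_prop)
    exact (continuousAt_fst.mul (h1.mul h2)).continuousWithinAt

theorem ContinuousOn.slice {f : ℝ × ℝ → ℝ} {s t : Set ℝ} (hf : ContinuousOn f (s ×ˢ t)) {x : ℝ}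
    (hx : x ∈ t) : ContinuousOn (fun r => f (r, x)) s :=
  ContinuousOn.comp (g := f) (f := fun r => (r, x)) hf
    (continuous_id.prodMk continuous_const).continuousOn fun _ hr => ⟨hr, hx⟩

theorem continuousOn_heatKernel_left (x : ℝ) : ContinuousOn (fun t => heatKernel t x) (Ioi 0) :=
  ContinuousOn.slice (f := fun z => heatKernel z.1 z.2) continuousOn_heatKernel (mem_univ x)

/-! ### Existence for the boundary Volterra equation -/

/-- The flux nonlinearity clamped at the level of the heat kernel. -/
noncomputable def clampedFlux (p s r : ℝ) : ℝ :=
  powerFlux p (max (-heatKernel s 0) (min (heatKernel s 0) r))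

theorem abs_clamp_le {k : ℝ} (hk : 0 ≤ k) (r : ℝ) : |max (-k) (min k r)| ≤ k :=
  abs_le.2 ⟨le_max_left _ _, max_le (by linarith) (min_le_left _ _)⟩

theorem abs_clampedFlux_le {p s : ℝ} (hp : 1 < p) (hs : 0 < s) (r : ℝ) :
    |clampedFlux p s r| ≤ (√Real.pi)⁻¹ ^ p * s ^ (-(p / 2)) := by
  rw [clampedFlux, abs_powerFlux (by linarith)]
  refine (Real.rpow_le_rpow (abs_nonneg _) (abs_clamp_le (heatKernel_nonneg s 0) r)
    (by linarith)).trans_eq ?_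
  rw [heatKernel_at_zero_rpow hs.le, Real.mul_rpow (by positivity) (by positivity),
    ← Real.rpow_mul hs.le]
  congr 2; ring

theorem clampedFlux_of_nonpos {p s : ℝ} (hs : s ≤ 0) (r : ℝ) : clampedFlux p s r = 0 := by
  have : max (-heatKernel s 0) (min (heatKernel s 0) r) = 0 := by
    have := abs_clamp_le (heatKernel_nonneg s 0) r
    rw [heatKernel_of_nonpos hs] at this ⊢
    exact abs_nonpos_iff.1 this
  rw [clampedFlux, this, powerFlux_zero]

theorem abs_clampedFlux_sub_le {p s : ℝ} (hp : 1 < p) (hs : 0 < s) (r r' : ℝ) :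
    |clampedFlux p s r - clampedFlux p s r'| ≤
      p * ((√Real.pi)⁻¹ ^ (p - 1) * s ^ (-((p - 1) / 2))) * |r - r'| := by
  have hk := heatKernel_nonneg s 0
  refine (abs_powerFlux_sub_le hp.le (abs_clamp_le hk r) (abs_clamp_le hk r')).trans ?_
  rw [heatKernel_at_zero_rpow hs.le, Real.mul_rpow (by positivity) (by positivity),
    ← Real.rpow_mul hs.le, show -(1 / 2) * (p - 1) = -((p - 1) / 2) by ring]
  have h1 := abs_max_sub_max_le_max (-heatKernel s 0) (min (heatKernel s 0) r) (-heatKernel s 0)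
    (min (heatKernel s 0) r')
  have h2 := abs_min_sub_min_le_max (heatKernel s 0) r (heatKernel s 0) r'
  simp only [sub_self, abs_zero, heatKernel_at_zero_rpow hs.le] at h1 h2
  refine mul_le_mul_of_nonneg_left ?_ (by positivity)
  exact h1.trans (max_le (abs_nonneg _) (h2.trans (max_le (abs_nonneg _) le_rfl)))

theorem continuousOn_clampedFlux {p : ℝ} (hp : 1 < p) {v : ℝ → ℝ} (hv : ContinuousOn v (Ioi 0)) :
    ContinuousOn (fun s => clampedFlux p s (v s)) (Ioi 0) := by
  have hk := continuousOn_heatKernel_left 0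
  exact (continuous_powerFlux hp.le).comp_continuousOn (ContinuousOn.sup hk.neg
      (ContinuousOn.inf hk hv))

/-- Trades exponential decay for a weak singularity. With `y = μ (t-s)` this produces the small
factor `μ^(-δ)` of the contraction estimate. -/
theorem rpow_mul_exp_neg_le {δ y : ℝ} (hδ : 0 ≤ δ) (hδ1 : δ ≤ 1) (hy : 0 < y) :
    Real.exp (-y) ≤ y ^ (-δ) := by
  rw [Real.exp_neg, Real.rpow_neg hy.le]
  refine inv_anti₀ (by positivity) ?_
  refine le_trans ?_ (Real.add_one_le_exp y)
  rcases le_total y 1 with h | h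
  · linarith [Real.rpow_le_one hy.le h hδ]
  · have := Real.rpow_le_rpow_of_exponent_le h hδ1
    rw [Real.rpow_one] at this
    linarith

/-- The Volterra operator of the clamped problem. -/
noncomputable def volterraStep (p : ℝ) (v : ℝ → ℝ) (t : ℝ) : ℝ :=
  heatKernel t 0 - ∫ s, heatKernel (t - s) 0 * clampedFlux p s (v s)

theorem integrable_heatKernel_mul_clampedFlux {p : ℝ} (hp1 : 1 < p) (hp2 : p < 2) {v : ℝ → ℝ}
    (hv : ContinuousOn v (Ioi 0)) (t : ℝ) :
    Integrable fun s => heatKernel (t - s) 0 * clampedFlux p s (v s) :=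
  integrable_heatKernel_mul (b := p / 2) (by linarith)
    (aestronglyMeasurable_of_causal (continuousOn_clampedFlux hp1 hv)
      fun s hs => clampedFlux_of_nonpos hs _)
    (fun s hs => clampedFlux_of_nonpos hs _) (fun s hs => abs_clampedFlux_le hp1 hs _) 0

theorem continuousOn_volterraStep {p : ℝ} (hp1 : 1 < p) (hp2 : p < 2) {v : ℝ → ℝ}
    (hv : ContinuousOn v (Ioi 0)) : ContinuousOn (volterraStep p v) (Ioi 0) := by
  have h1 := continuousOn_heatPotential (b := p / 2) (by linarith) (continuousOn_clampedFlux hp1 hv)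
    (fun s hs => clampedFlux_of_nonpos hs _) (fun s hs => abs_clampedFlux_le hp1 hs _)
  exact (continuousOn_heatKernel_left 0).sub (ContinuousOn.slice h1 (mem_univ 0))

/-- The Volterra operator is a contraction in a weighted supremum norm. -/
theorem abs_volterraStep_sub_le {p : ℝ} (hp1 : 1 < p) (hp2 : p < 2) :
    ∃ μ : ℝ, 0 ≤ μ ∧ ∀ v w : ℝ → ℝ, ContinuousOn v (Ioi 0) → ContinuousOn w (Ioi 0) → ∀ A : ℝ,
      (∀ t, 0 < t → |v t - w t| ≤ A * (t ^ (-(1 / 2) : ℝ) * Real.exp (μ * t))) →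
      ∀ t, 0 < t → |volterraStep p v t - volterraStep p w t| ≤
        A / 2 * (t ^ (-(1 / 2) : ℝ) * Real.exp (μ * t)) := by
  set κ := (√Real.pi)⁻¹ with hκ
  have hκ0 : 0 < κ := inv_pos.2 (Real.sqrt_pos.2 Real.pi_pos)
  -- With this `δ` the kernel `s^(-p/2) (t-s)^(-1/2-δ)` is integrable on `(0,t)` and its integral is
  -- a multiple of `t^(-1/2)`, so the weight reproduces itself.
  set δ := 1 - p / 2 with hδ
  have hδ0 : 0 < δ := by rw [hδ]; linarith
  set β := ProbabilityTheory.beta (1 - p / 2) ((p - 1) / 2) with hβ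
  have hβ0 : 0 < β := ProbabilityTheory.beta_pos (by linarith) (by linarith)
  have hD : 0 < 2 * p * κ ^ p * β := by positivity
  -- Chosen so that `p κ^p β μ^(-δ) = 1/2`.
  set μ := (2 * p * κ ^ p * β) ^ (1 / δ) with hμ
  have hμ0 : 0 < μ := Real.rpow_pos_of_pos hD _
  have hμδ : μ ^ (-δ) = (2 * p * κ ^ p * β)⁻¹ := by
    rw [hμ, ← Real.rpow_mul hD.le, show 1 / δ * -δ = -1 by field_simp, Real.rpow_neg_one]
  refine ⟨μ, hμ0.le, fun v w hv hw A hA t ht => ?_⟩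
  have hA0 : 0 ≤ A := by
    have h := (abs_nonneg _).trans (hA 1 one_pos)
    exact nonneg_of_mul_nonneg_left h (by positivity)
  have e1 : volterraStep p v t - volterraStep p w t =
      ∫ s in Ioo 0 t, heatKernel (t - s) 0 * (clampedFlux p s (w s) - clampedFlux p s (v s)) := by
    have hi := integrable_heatKernel_mul_clampedFlux hp1 hp2 hv t
    have hi' := integrable_heatKernel_mul_clampedFlux hp1 hp2 hw t
    rw [← (integral_causal (t := t) (fun s hs => by
      rw [clampedFlux_of_nonpos hs, clampedFlux_of_nonpos hs, sub_self, mul_zero]) (fun s hs => by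
      rw [heatKernel_of_nonpos (by linarith), zero_mul])).2]
    simp only [mul_sub]
    rw [integral_sub hi' hi, volterraStep, volterraStep]
    ring
  obtain ⟨hbi, hbv⟩ := integrableOn_beta_scaled (a := 1 - p / 2) (b := (p - 1) / 2)
    (by linarith) (by linarith) ht
  have hpt : ∀ s ∈ Ioo 0 t,
      ‖heatKernel (t - s) 0 * (clampedFlux p s (w s) - clampedFlux p s (v s))‖ ≤
      p * κ ^ p * A * μ ^ (-δ) * Real.exp (μ * t) *
        (s ^ (1 - p / 2 - 1) * (t - s) ^ ((p - 1) / 2 - 1)) := fun s hs => by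
    have hs0 := hs.1
    have hts : 0 < t - s := by linarith [hs.2]
    have h1 := abs_clampedFlux_sub_le hp1 hs0 (w s) (v s)
    rw [abs_sub_comm (w s)] at h1
    have h2 := hA s hs0
    have h3 := rpow_mul_exp_neg_le hδ0.le (by rw [hδ]; linarith) (mul_pos hμ0 hts)
    rw [Real.mul_rpow hμ0.le hts.le] at h3
    rw [norm_mul, Real.norm_of_nonneg (heatKernel_nonneg _ _), Real.norm_eq_abs,
      heatKernel_at_zero_rpow hts.le, ← hκ]
    calc κ * (t - s) ^ (-(1 / 2) : ℝ) * |clampedFlux p s (w s) - clampedFlux p s (v s)|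
        ≤ κ * (t - s) ^ (-(1 / 2) : ℝ) * (p * (κ ^ (p - 1) * s ^ (-((p - 1) / 2))) *
            (A * (s ^ (-(1 / 2) : ℝ) * Real.exp (μ * s)))) := by
          refine mul_le_mul_of_nonneg_left (h1.trans ?_) (by positivity)
          exact mul_le_mul_of_nonneg_left h2 (by positivity)
      _ = p * (κ ^ (1 : ℝ) * κ ^ (p - 1)) * A * Real.exp (μ * t) *
            (s ^ (-((p - 1) / 2)) * s ^ (-(1 / 2) : ℝ)) *
            (t - s) ^ (-(1 / 2) : ℝ) * Real.exp (-(μ * (t - s))) := by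
          rw [show μ * s = μ * t + -(μ * (t - s)) by ring, Real.exp_add, Real.rpow_one]; ring
      _ ≤ p * (κ ^ (1 : ℝ) * κ ^ (p - 1)) * A * Real.exp (μ * t) *
            (s ^ (-((p - 1) / 2)) * s ^ (-(1 / 2) : ℝ)) *
            (t - s) ^ (-(1 / 2) : ℝ) * (μ ^ (-δ) * (t - s) ^ (-δ)) := by gcongr
      _ = p * κ ^ p * A * μ ^ (-δ) * Real.exp (μ * t) *
            (s ^ (-((p - 1) / 2)) * s ^ (-(1 / 2) : ℝ)) *
            ((t - s) ^ (-(1 / 2) : ℝ) * (t - s) ^ (-δ)) := by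
          rw [← Real.rpow_add hκ0]; ring_nf
      _ = _ := by
          rw [← Real.rpow_add hs0, ← Real.rpow_add hts, mul_assoc _ (s ^ _),
            show -((p - 1) / 2) + -(1 / 2) = 1 - p / 2 - 1 by ring,
            show -(1 / 2) + -δ = (p - 1) / 2 - 1 by rw [hδ]; ring]
  rw [e1, ← Real.norm_eq_abs]
  calc ‖∫ s in Ioo 0 t, heatKernel (t - s) 0 * (clampedFlux p s (w s) - clampedFlux p s (v s))‖
      ≤ ∫ s in Ioo 0 t, p * κ ^ p * A * μ ^ (-δ) * Real.exp (μ * t) *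
        (s ^ (1 - p / 2 - 1) * (t - s) ^ ((p - 1) / 2 - 1)) :=
        norm_integral_le_of_norm_le (hbi.const_mul _)
          ((ae_restrict_mem measurableSet_Ioo).mono hpt)
    _ = A / 2 * (t ^ (-(1 / 2) : ℝ) * Real.exp (μ * t)) := by
        rw [integral_const_mul, hbv, hμδ, ← hβ,
          show 1 - p / 2 + (p - 1) / 2 - 1 = (-(1 / 2) : ℝ) by ring]
        field_simp

/-- The clamped Volterra equation has a solution that is continuous on `(0,∞)`. -/
theorem exists_clamped_solution {p : ℝ} (hp1 : 1 < p) (hp2 : p < 2) :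
    ∃ v : ℝ → ℝ, ∃ μ : ℝ, ContinuousOn v (Ioi 0) ∧ volterraStep p v = v ∧
      ∀ t, 0 < t → |v t| ≤ 2 * (√Real.pi)⁻¹ * (t ^ (-(1 / 2) : ℝ) * Real.exp (μ * t)) := by
  obtain ⟨μ, hμ0, hμ⟩ := abs_volterraStep_sub_le hp1 hp2
  set W : ℝ → ℝ := fun t => t ^ (-(1 / 2) : ℝ) * Real.exp (μ * t) with hW
  set κ := (√Real.pi)⁻¹ with hκ
  -- Picard iteration from zero. The first iterate is the heat kernel, at most `κ W`, so the
  -- increments decay like `κ W / 2^n` and convergence is locally uniform on `(0,∞)`.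
  set V : ℕ → ℝ → ℝ := fun n => (volterraStep p)^[n] (fun _ => 0) with hV
  have hVs : ∀ n, V (n + 1) = volterraStep p (V n) := fun n => Function.iterate_succ_apply' _ _ _
  have hVc : ∀ n, ContinuousOn (V n) (Ioi 0) := fun n => by
    induction n with
    | zero => exact continuousOn_const
    | succ n ih => rw [hVs]; exact continuousOn_volterraStep hp1 hp2 ih
  have hV0 : ∀ n, ∀ t ≤ 0, V n t = 0 := fun n t ht => by
    cases n with
    | zero => rfl
    | succ n =>
      rw [hVs, volterraStep, heatKernel_of_nonpos ht, zero_sub, neg_eq_zero]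
      refine integral_eq_zero_of_ae (.of_forall fun s => ?_)
      rcases le_total s 0 with h | h
      · simp [clampedFlux_of_nonpos h]
      · simp [heatKernel_of_nonpos (show t - s ≤ 0 by linarith)]
  have hVd : ∀ n, ∀ t, 0 < t → |V (n + 1) t - V n t| ≤ κ / 2 ^ n * W t := fun n => by
    induction n with
    | zero =>
      intro t ht
      have h1 : V 1 t = heatKernel t 0 := by
        have : ∀ s, clampedFlux p s 0 = 0 := fun s => by
          simp [clampedFlux, heatKernel_nonneg, powerFlux_zero]
        rw [hVs, volterraStep]
        simp [hV, this]
      have h2 : V 0 t = 0 := rfl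
      rw [zero_add, h1, h2, sub_zero, abs_of_nonneg (heatKernel_nonneg _ _), pow_zero, div_one,
        heatKernel_at_zero_rpow ht.le]
      refine mul_le_mul_of_nonneg_left (le_mul_of_one_le_right (by positivity) ?_) (by positivity)
      exact Real.one_le_exp (by positivity)
    | succ n ih =>
      intro t ht
      rw [hVs (n + 1)]
      nth_rw 2 [hVs n]
      refine (hμ _ _ (hVc _) (hVc _) _ ih t ht).trans_eq ?_
      rw [pow_succ]; ring
  have hgeo : ∀ t, 0 < t → ∀ n, dist (V n t) (V (n + 1) t) ≤ 2 * κ * W t / 2 / 2 ^ n :=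
    fun t ht n => by
      rw [dist_comm, Real.dist_eq]
      exact (hVd n t ht).trans_eq (by ring)
  have hlim : ∀ t, ∃ a, Tendsto (fun n => V n t) atTop (𝓝 a) := fun t => by
    rcases le_or_gt t 0 with ht | ht
    · exact ⟨0, by simp only [hV0 _ t ht]; exact tendsto_const_nhds⟩
    · exact cauchySeq_tendsto_of_complete (cauchySeq_of_le_geometric_two (hgeo t ht))
  choose v hv using hlim
  have hvW : ∀ n t, 0 < t → dist (V n t) (v t) ≤ 2 * κ * W t / 2 ^ n := fun n t ht =>
    dist_le_of_le_geometric_two_of_tendsto (hgeo t ht) (hv t) n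
  refine ⟨v, μ, ?_, ?_, fun t ht => ?_⟩
  · refine TendstoLocallyUniformlyOn.continuousOn (F := V) (p := atTop) ?_ (.of_forall hVc)
    rw [Metric.tendstoLocallyUniformlyOn_iff]
    intro ε hε t₀ ht₀
    have hWc : ContinuousAt W t₀ :=
      (Real.continuousAt_rpow_const _ _ (Or.inl (ne_of_gt ht₀))).mul (by fun_prop)
    refine ⟨{t | W t < W t₀ + 1} ∩ Ioi 0, mem_nhdsWithin_of_mem_nhds (inter_mem
      (hWc.eventually_lt_const (lt_add_one _)) (isOpen_Ioi.mem_nhds ht₀)), ?_⟩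
    have h1 : Tendsto (fun n : ℕ => 2 * κ * (W t₀ + 1) / 2 ^ n) atTop (𝓝 0) :=
      tendsto_const_nhds.div_atTop (tendsto_pow_atTop_atTop_of_one_lt one_lt_two)
    filter_upwards [h1.eventually_lt_const hε] with n hn t ht
    rw [dist_comm]
    refine (hvW n t ht.2).trans_lt (lt_of_le_of_lt ?_ hn)
    have h2 : W t ≤ W t₀ + 1 := le_of_lt ht.1
    gcongr
  · funext t
    have h1 : Tendsto (fun n => ∫ s, heatKernel (t - s) 0 * clampedFlux p s (V n s)) atTop
        (𝓝 (∫ s, heatKernel (t - s) 0 * clampedFlux p s (v s))) := by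
      -- The clamp supplies the dominating function: the flux never exceeds its value at the heat
      -- kernel.
      refine tendsto_integral_of_dominated_convergence
        (fun s => heatKernel (t - s) 0 * powerFlux p (heatKernel s 0))
        (fun n => (integrable_heatKernel_mul_clampedFlux hp1 hp2 (hVc n) t).1) ?_ ?_ ?_
      · have := integrable_heatKernel_mul_clampedFlux hp1 hp2 (continuousOn_heatKernel_left 0) t
        refine this.congr (.of_forall fun s => ?_)
        simp only [clampedFlux, min_self]
        rw [max_eq_right (by linarith [heatKernel_nonneg s 0])]
      · refine fun n => .of_forall fun s => ?_
        rw [norm_mul, Real.norm_of_nonneg (heatKernel_nonneg _ _)]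
        refine mul_le_mul_of_nonneg_left ?_ (heatKernel_nonneg _ _)
        rw [Real.norm_eq_abs, clampedFlux, abs_powerFlux (by linarith),
          powerFlux_of_nonneg (by linarith) (heatKernel_nonneg _ _)]
        exact Real.rpow_le_rpow (abs_nonneg _) (abs_clamp_le (heatKernel_nonneg s 0) _)
          (by linarith)
      · refine .of_forall fun s => Tendsto.const_mul _ ?_
        have : Continuous (clampedFlux p s) := (continuous_powerFlux hp1.le).comp (by fun_prop)
        exact (this.tendsto _).comp (hv s)
    have h2 := (h1.const_sub (heatKernel t 0))
    refine tendsto_nhds_unique h2 (((tendsto_add_atTop_iff_nat 1).2 (hv t)).congr fun n => ?_)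
    rw [hVs]; rfl
  · have := hvW 0 t ht
    rw [Real.dist_eq, show V 0 t = 0 from rfl, zero_sub, abs_neg, pow_zero, div_one] at this
    exact this

theorem nonneg_of_ae_nonneg {U : Set ℝ} {v : ℝ → ℝ} (hU : IsOpen U) (hv : ContinuousOn v U)
    (h : ∀ᵐ t, t ∈ U → 0 ≤ v t) : ∀ t ∈ U, 0 ≤ v t := by
  intro t₀ ht₀
  by_contra! hneg
  have hopen : {t | v t < 0 ∧ t ∈ U} ∈ 𝓝 t₀ :=
    ((hv.continuousAt (hU.mem_nhds ht₀)).eventually_lt_const hneg).and (hU.mem_nhds ht₀)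
  refine (Measure.measure_pos_of_mem_nhds volume hopen).ne' (measure_mono_null (fun t ht => ?_) h)
  exact fun h' => absurd (h' ht.2) (not_le.2 ht.1)

/-- The boundary values of the solution with unit Dirac flux. -/
theorem exists_boundary_solution {p : ℝ} (hp1 : 1 < p) (hp2 : p < 2) :
    ∃ v : ℝ → ℝ, ContinuousOn v (Ioi 0) ∧ (∀ t, 0 ≤ v t) ∧ (∀ t, v t ≤ heatKernel t 0) ∧
      ∀ t, v t = heatKernel t 0 - ∫ s, heatKernel (t - s) 0 * powerFlux p (v s) := by
  obtain ⟨v, μ, hvc, hve, hvb⟩ := exists_clamped_solution hp1 hp2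
  have hvt : ∀ t, v t = heatKernel t 0 - ∫ s, heatKernel (t - s) 0 * clampedFlux p s (v s) :=
    fun t => (congrFun hve t).symm
  have hv0 : ∀ t ≤ 0, v t = 0 := fun t ht => by
    rw [hvt, heatKernel_of_nonpos ht, zero_sub, neg_eq_zero]
    refine integral_eq_zero_of_ae (.of_forall fun s => ?_)
    rcases le_total s 0 with h | h
    · simp [clampedFlux_of_nonpos h]
    · simp [heatKernel_of_nonpos (show t - s ≤ 0 by linarith)]
  have hΦm := aestronglyMeasurable_of_causal (continuousOn_clampedFlux hp1 hvc)
    fun s hs => clampedFlux_of_nonpos hs _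
  have hsm := strictMono_powerFlux (p := p) (by linarith)
  have hsign : ∀ s, 0 < s → (0 < v s → 0 < clampedFlux p s (v s)) ∧
      (v s < 0 → clampedFlux p s (v s) < 0) ∧ (v s = 0 → clampedFlux p s (v s) = 0) :=
          fun s hs => by
    have hk := heatKernel_pos hs 0
    refine ⟨fun h => ?_, fun h => ?_, fun h => ?_⟩
    · rw [← powerFlux_zero p]
      exact hsm (lt_max_of_lt_right (lt_min hk h))
    · rw [← powerFlux_zero p]
      exact hsm (max_lt (by linarith) (min_lt_of_right_lt h))
    · simp [clampedFlux, h, hk.le, powerFlux_zero]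
  have hnonneg : ∀ t, 0 ≤ v t := by
    by_contra! hneg
    obtain ⟨t₀, ht₀⟩ := hneg
    have ht₀0 : 0 < t₀ := by
      by_contra! h
      rw [hv0 t₀ h] at ht₀
      exact lt_irrefl _ ht₀
    set T := t₀ + 1
    have hT : 0 < T := by positivity
    have hi1 : IntegrableOn (fun s => clampedFlux p s (v s)) (Ioo 0 T) := by
      have := (intervalIntegral.intervalIntegrable_rpow' (a := 0) (b := T)
        (r := -(p / 2)) (by linarith)).const_mul ((√Real.pi)⁻¹ ^ p)
      rw [intervalIntegrable_iff_integrableOn_Ioo_of_le hT.le] at this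
      refine Integrable.mono' this hΦm.restrict ?_
      filter_upwards [ae_restrict_mem measurableSet_Ioo] with s hs
      exact abs_clampedFlux_le hp1 hs.1 _
    have hi2 : IntegrableOn v (Ioo 0 T) := by
      have := (intervalIntegral.intervalIntegrable_rpow' (a := 0) (b := T)
        (r := -(1 / 2)) (by norm_num)).const_mul (2 * (√Real.pi)⁻¹ * Real.exp (|μ| * T))
      rw [intervalIntegrable_iff_integrableOn_Ioo_of_le hT.le] at this
      refine Integrable.mono' this (aestronglyMeasurable_of_causal hvc hv0).restrict ?_
      filter_upwards [ae_restrict_mem measurableSet_Ioo] with s hs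
      refine (hvb s hs.1).trans ?_
      have h1 : Real.exp (μ * s) ≤ Real.exp (|μ| * T) := Real.exp_le_exp.2
        (mul_le_mul (le_abs_self μ) hs.2.le hs.1.le (abs_nonneg μ))
      have h2 : 0 ≤ s ^ (-(1 / 2) : ℝ) := Real.rpow_nonneg hs.1.le _
      calc 2 * (√Real.pi)⁻¹ * (s ^ (-(1 / 2) : ℝ) * Real.exp (μ * s))
          ≤ 2 * (√Real.pi)⁻¹ * (s ^ (-(1 / 2) : ℝ) * Real.exp (|μ| * T)) := by gcongr
        _ = _ := by ring
    -- The Volterra equation with signs reversed: `-v = -k - k * (-Φ)`, where `Φ` is the clamped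
    -- flux, which has the sign of `v`. Comparison gives `Φ ≥ 0`, hence `v ≥ 0`.
    have hcomp := comparison (T := T) (c := 1)
      (w := (Ioo 0 T).indicator fun s => -v s)
      (h := (Ioo 0 T).indicator fun s => -clampedFlux p s (v s)) hT zero_le_one
      ((integrable_indicator_iff measurableSet_Ioo).2 hi1.neg)
      ((integrable_indicator_iff measurableSet_Ioo).2 hi2.neg)
      (fun t ht => indicator_of_notMem ht _)
      (.of_forall fun t ht => by
        rw [indicator_of_mem ht, hvt t]
        have : ∀ s, heatKernel (t - s) 0 * (Ioo 0 T).indicator (fun s => -clampedFlux p s (v s)) s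
            = -(heatKernel (t - s) 0 * clampedFlux p s (v s)) := fun s => by
          by_cases hs : s ∈ Ioo 0 T
          · rw [indicator_of_mem hs]; ring
          · rw [indicator_of_notMem hs]
            rcases not_and_or.1 hs with h | h
            · simp [clampedFlux_of_nonpos (not_lt.1 h)]
            · simp [heatKernel_of_nonpos (show t - s ≤ 0 by linarith [ht.2, not_lt.1 h])]
        simp only [this, integral_neg]; ring)
      (fun t h => by
        by_cases ht : t ∈ Ioo 0 T
        · rw [indicator_of_mem ht] at h ⊢
          linarith [(hsign t ht.1).2.1 (by linarith)]
        · rw [indicator_of_notMem ht])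
      (fun t h => by
        by_cases ht : t ∈ Ioo 0 T
        · rw [indicator_of_mem ht] at h ⊢
          linarith [(hsign t ht.1).1 (by linarith)]
        · rw [indicator_of_notMem ht])
      (fun t h => by
        by_cases ht : t ∈ Ioo 0 T
        · rw [indicator_of_mem ht] at h ⊢
          rw [(hsign t ht.1).2.2 (by linarith), neg_zero]
        · rw [indicator_of_notMem ht])
    have hae : ∀ᵐ t, t ∈ Ioo 0 T → 0 ≤ v t := by
      filter_upwards [hcomp] with t ht htT
      rw [indicator_of_mem htT] at ht
      by_contra! h
      linarith [(hsign t htT.1).2.1 h]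
    exact absurd (nonneg_of_ae_nonneg isOpen_Ioo (hvc.mono fun t ht => ht.1) hae t₀
      ⟨ht₀0, lt_add_one _⟩) (not_le.2 ht₀)
  -- Nonnegative flux only lowers `v` below the heat kernel. With `v ≥ 0` this makes the clamp
  -- inactive.
  have hle : ∀ t, v t ≤ heatKernel t 0 := fun t => by
    rw [hvt t, sub_le_self_iff]
    refine integral_nonneg fun s => mul_nonneg (heatKernel_nonneg _ _) ?_
    rw [← powerFlux_zero p]
    exact hsm.monotone (le_max_of_le_right (le_min (heatKernel_nonneg _ _) (hnonneg s)))
  refine ⟨v, hvc, hnonneg, hle, fun t => ?_⟩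
  rw [hvt t]
  congr 1
  refine integral_congr_ae (.of_forall fun s => ?_)
  simp only [clampedFlux]
  rw [min_eq_right (hle s), max_eq_right (by linarith [hnonneg s, heatKernel_nonneg s 0])]

/-! ### Test functions and Green's identity -/

theorem measurableSet_strip (T : ℝ) : MeasurableSet (strip T) :=
  measurableSet_Ioo.prod measurableSet_Ioi

theorem strip_subset (T : ℝ) : strip T ⊆ Ico 0 T ×ˢ Ici 0 :=
  prod_mono Ioo_subset_Ico_self Ioi_subset_Ici_self

theorem restrict_strip (T : ℝ) : (volume : Measure (ℝ × ℝ)).restrict (strip T)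
    = (volume.restrict (Ioo 0 T)).prod (volume.restrict (Ioi 0)) := by
  rw [strip, Measure.volume_eq_prod, Measure.prod_restrict]

theorem derivWithin_eq_zero {f : ℝ → ℝ} {f' t : ℝ} (ht : t ∈ Ici (0 : ℝ))
    (h : HasDerivWithinAt f f' (Ici 0) t) (h0 : ∀ᶠ s in 𝓝[Ici 0] t, f s = 0) (ht0 : f t = 0) :
    f' = 0 :=
  (uniqueDiffOn_Ici (0 : ℝ) t ht).eq_deriv _ h
    ((hasDerivWithinAt_const t (Ici 0) (0 : ℝ)).congr_of_eventuallyEq h0 ht0)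

namespace IsTestFunction

variable {T : ℝ} {ζ ζt ζx ζxx : ℝ × ℝ → ℝ}

/-- A compact subset of `[0,T) × [0,∞)` stays away from `t = T` and from `x = ∞`, and the
derivatives vanish wherever the function vanishes near the point within the closed quadrant. -/
theorem exists_vanishing (hT : 0 < T) (hζ : IsTestFunction T ζ ζt ζx ζxx) :
    ∃ T' R : ℝ, 0 < T' ∧ T' < T ∧ 0 < R ∧ ∀ t ∈ Ico 0 T, ∀ x ∈ Ici (0 : ℝ), (T' ≤ t ∨ R ≤ x) →
      ζ (t, x) = 0 ∧ ζt (t, x) = 0 ∧ ζx (t, x) = 0 ∧ ζxx (t, x) = 0 := by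
  obtain ⟨S, hS, hSsub, hS0⟩ := hζ.compactSupport
  obtain ⟨T₁, hT₁0, hT₁, hST⟩ : ∃ T₁, 0 ≤ T₁ ∧ T₁ < T ∧ ∀ z ∈ S, z.1 ≤ T₁ := by
    rcases S.eq_empty_or_nonempty with rfl | hne
    · exact ⟨0, le_rfl, hT, by simp⟩
    · obtain ⟨z, hz, hmax⟩ := hS.exists_isMaxOn hne continuous_fst.continuousOn
      exact ⟨z.1, (hSsub hz).1.1, (hSsub hz).1.2, fun w hw => hmax hw⟩
  obtain ⟨R₁, hR₁⟩ : ∃ R₁, ∀ z ∈ S, z.2 ≤ R₁ := by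
    rcases S.eq_empty_or_nonempty with rfl | hne
    · exact ⟨0, by simp⟩
    · obtain ⟨z, hz, hmax⟩ := hS.exists_isMaxOn hne continuous_snd.continuousOn
      exact ⟨z.2, fun w hw => hmax hw⟩
  have hz0 : ∀ t ∈ Ico 0 T, ∀ x ∈ Ici (0 : ℝ), (T₁ < t ∨ R₁ < x) → ζ (t, x) = 0 :=
    fun t ht x hx h => hS0 _ ⟨ht, hx⟩ fun hmem => by
      rcases h with h | h
      · exact absurd (hST _ hmem) (not_le.2 h)
      · exact absurd (hR₁ _ hmem) (not_le.2 h)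
  have hx0 : ∀ t ∈ Ico 0 T, ∀ x ∈ Ici (0 : ℝ), (T₁ < t ∨ R₁ < x) → ζx (t, x) = 0 := by
    intro t ht x hx h
    refine derivWithin_eq_zero hx (hζ.hasDeriv_x t ht x hx) ?_ (hz0 t ht x hx h)
    rcases h with h | h
    · filter_upwards [self_mem_nhdsWithin] with y hy using hz0 t ht y hy (Or.inl h)
    · filter_upwards [self_mem_nhdsWithin, mem_nhdsWithin_of_mem_nhds
          (Ioi_mem_nhds h)] with y hy hy'
        using hz0 t ht y hy (Or.inr hy')
  have hxx0 : ∀ t ∈ Ico 0 T, ∀ x ∈ Ici (0 : ℝ), (T₁ < t ∨ R₁ < x) → ζxx (t, x) = 0 := by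
    intro t ht x hx h
    refine derivWithin_eq_zero hx (hζ.hasDeriv_xx t ht x hx) ?_ (hx0 t ht x hx h)
    rcases h with h | h
    · filter_upwards [self_mem_nhdsWithin] with y hy using hx0 t ht y hy (Or.inl h)
    · filter_upwards [self_mem_nhdsWithin, mem_nhdsWithin_of_mem_nhds
          (Ioi_mem_nhds h)] with y hy hy'
        using hx0 t ht y hy (Or.inr hy')
  have ht0 : ∀ t ∈ Ico 0 T, ∀ x ∈ Ici (0 : ℝ), (T₁ < t ∨ R₁ < x) → ζt (t, x) = 0 := by
    intro t ht x hx h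
    refine derivWithin_eq_zero ht.1 (hζ.hasDeriv_t t ht x hx) ?_ (hz0 t ht x hx h)
    have hlt : Iio T ∈ 𝓝[Ici 0] t := mem_nhdsWithin_of_mem_nhds (Iio_mem_nhds ht.2)
    rcases h with h | h
    · filter_upwards [self_mem_nhdsWithin, hlt, mem_nhdsWithin_of_mem_nhds (Ioi_mem_nhds h)]
        with y hy hy' hy'' using hz0 y ⟨hy, hy'⟩ x hx (Or.inl hy'')
    · filter_upwards [self_mem_nhdsWithin, hlt] with y hy hy'
        using hz0 y ⟨hy, hy'⟩ x hx (Or.inr h)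
  -- Enlarging both bounds turns the strict inequalities, needed for neighbourhoods, into non-strict
  -- ones.
  refine ⟨(T₁ + T) / 2, |R₁| + 1, by linarith, by linarith, by positivity, fun t ht x hx h => ?_⟩
  have h' : T₁ < t ∨ R₁ < x := h.imp (fun h => by linarith) (fun h => by linarith [le_abs_self R₁])
  exact ⟨hz0 t ht x hx h', ht0 t ht x hx h', hx0 t ht x hx h', hxx0 t ht x hx h'⟩

theorem exists_bound (hT : 0 < T) (hζ : IsTestFunction T ζ ζt ζx ζxx) :
    ∃ C : ℝ, 0 ≤ C ∧ ∀ z ∈ Ico 0 T ×ˢ Ici (0 : ℝ), |ζ z| ≤ C ∧ |ζt z + ζxx z| ≤ C := by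
  obtain ⟨T', R, hT'0, hT'T, hR, hv⟩ := hζ.exists_vanishing hT
  have hsub : Icc 0 T' ×ˢ Icc 0 R ⊆ Ico 0 T ×ˢ Ici (0 : ℝ) :=
    prod_mono (fun t ht => ⟨ht.1, ht.2.trans_lt hT'T⟩) fun x hx => hx.1
  have hK : IsCompact (Icc 0 T' ×ˢ Icc 0 R) := isCompact_Icc.prod isCompact_Icc
  obtain ⟨C₁, hC₁⟩ := hK.exists_bound_of_continuousOn (hζ.continuousOn.mono hsub)
  obtain ⟨C₂, hC₂⟩ := hK.exists_bound_of_continuousOn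
    ((hζ.continuousOn_t.add hζ.continuousOn_xx).mono hsub)
  refine ⟨max 0 (max C₁ C₂), le_max_left _ _, fun z hz => ?_⟩
  by_cases hzK : z ∈ Icc 0 T' ×ˢ Icc 0 R
  · exact ⟨(hC₁ z hzK).trans ((le_max_left _ _).trans (le_max_right _ _)),
      (hC₂ z hzK).trans ((le_max_right _ _).trans (le_max_right _ _))⟩
  · have : T' ≤ z.1 ∨ R ≤ z.2 := by
      by_contra! h
      exact hzK ⟨⟨hz.1.1, h.1.le⟩, ⟨hz.2, h.2.le⟩⟩
    obtain ⟨h1, h2, -, h4⟩ := hv z.1 hz.1 z.2 hz.2 this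
    change ζ z = 0 at h1
    change ζt z = 0 at h2
    change ζxx z = 0 at h4
    rw [h1, h2, h4]
    simp

theorem aestronglyMeasurable_heat (hζ : IsTestFunction T ζ ζt ζx ζxx) :
    AEStronglyMeasurable (fun z => ζt z + ζxx z) (volume.restrict (strip T)) :=
  ((hζ.continuousOn_t.add hζ.continuousOn_xx).mono (strip_subset T)).aestronglyMeasurable
    (measurableSet_strip T)

end IsTestFunction

/-- The kernel has unit mass on the half line at every time after `s` and vanishes before, so its
space-time mass is at most the length of the time interval, uniformly in `s`. -/
theorem integrableOn_heatKernel_strip {T : ℝ} (hT : 0 ≤ T) (s : ℝ) :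
    IntegrableOn (fun z : ℝ × ℝ => heatKernel (z.1 - s) z.2) (strip T) ∧
      ∫ z in strip T, heatKernel (z.1 - s) z.2 ≤ T := by
  have hmeas : Measurable fun z : ℝ × ℝ => heatKernel (z.1 - s) z.2 :=
    measurable_heatKernel.comp ((measurable_fst.sub_const s).prodMk measurable_snd)
  have hin : ∀ t : ℝ, IntegrableOn (fun x => heatKernel (t - s) x) (Ioi 0) ∧
      ∫ x in Ioi 0, heatKernel (t - s) x = (Ioi s).indicator (fun _ => (1 : ℝ)) t := fun t => by
    rcases le_or_gt t s with h | h
    · simp [heatKernel_of_nonpos (sub_nonpos.2 h), not_lt.2 h]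
    · have h' : 0 < t - s := by linarith
      rw [indicator_of_mem (show t ∈ Ioi s from h)]
      exact ⟨integrableOn_heatKernel_right h', integral_heatKernel_right h'⟩
  have hone : Integrable (fun _ => (1 : ℝ)) (volume.restrict (Ioo 0 T)) := by simp
  have hi : IntegrableOn (fun z : ℝ × ℝ => heatKernel (z.1 - s) z.2) (strip T) := by
    rw [IntegrableOn, restrict_strip, integrable_prod_iff hmeas.aestronglyMeasurable]
    refine ⟨.of_forall fun t => (hin t).1, ?_⟩
    simp only [Real.norm_of_nonneg (heatKernel_nonneg _ _), (hin _).2]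
    exact hone.indicator measurableSet_Ioi
  refine ⟨hi, ?_⟩
  rw [IntegrableOn, restrict_strip] at hi
  rw [restrict_strip, integral_prod _ hi]
  simp only [(hin _).2]
  calc ∫ t in Ioo 0 T, (Ioi s).indicator (fun _ => (1 : ℝ)) t ≤ ∫ t in Ioo 0 T, (1 : ℝ) :=
        integral_mono (hone.indicator measurableSet_Ioi) hone
          (indicator_le_self' fun _ _ => zero_le_one)
    _ = T := by simp [hT]

theorem integrable_heatPotential {T : ℝ} (hT : 0 ≤ T) {h : ℝ → ℝ} (hh : Integrable h) :
    Integrable (fun q : (ℝ × ℝ) × ℝ => heatKernel (q.1.1 - q.2) q.1.2 * h q.2)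
      ((volume.restrict (strip T)).prod volume) := by
  have hmeas : Measurable fun q : (ℝ × ℝ) × ℝ => heatKernel (q.1.1 - q.2) q.1.2 :=
    measurable_heatKernel.comp (f := fun q : (ℝ × ℝ) × ℝ => (q.1.1 - q.2, q.1.2)) (by fun_prop)
  have hm : AEStronglyMeasurable (fun q : (ℝ × ℝ) × ℝ => heatKernel (q.1.1 - q.2) q.1.2 * h q.2)
      ((volume.restrict (strip T)).prod volume) := hmeas.aestronglyMeasurable.mul hh.1.comp_snd
  rw [integrable_prod_iff' hm]
  refine ⟨.of_forall fun s => (integrableOn_heatKernel_strip hT s).1.mul_const (h s), ?_⟩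
  refine (hh.norm.const_mul T).mono' ?_ (.of_forall fun s => ?_)
  · exact hm.norm.prod_swap.integral_prod_right'
  · rw [Real.norm_of_nonneg (integral_nonneg fun z => norm_nonneg _)]
    simp only [norm_mul, Real.norm_of_nonneg (heatKernel_nonneg _ _)]
    rw [integral_mul_const]
    exact mul_le_mul_of_nonneg_right (integrableOn_heatKernel_strip hT s).2 (norm_nonneg _)

section

/-- The time derivative (and second space derivative) of the heat kernel. -/
noncomputable def heatKernelDt (t x : ℝ) : ℝ :=
  (x ^ 2 / (4 * t ^ 2) - 1 / (2 * t)) * heatKernel t x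

theorem continuousOn_heatKernelDt :
    ContinuousOn (fun z : ℝ × ℝ => heatKernelDt z.1 z.2) (Ioi 0 ×ˢ univ) := by
  refine ContinuousOn.mul (ContinuousOn.sub ?_ ?_) continuousOn_heatKernel
  · refine ContinuousOn.div (by fun_prop) (by fun_prop) fun z hz => ?_
    have : 0 < z.1 := hz.1
    positivity
  · refine ContinuousOn.div (by fun_prop) (by fun_prop) fun z hz => ?_
    have : 0 < z.1 := hz.1
    positivity

theorem continuous_heatKernelDt_right (t : ℝ) : Continuous (heatKernelDt t) := by
  unfold heatKernelDt
  exact Continuous.mul (by fun_prop) (continuous_heatKernel_right t)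

theorem continuous_poissonKernel_left (t : ℝ) : Continuous fun x => poissonKernel x t := by
  unfold poissonKernel
  exact Continuous.mul (by fun_prop) (continuous_heatKernel_right t)

variable {T : ℝ} {ζ ζt ζx ζxx : ℝ × ℝ → ℝ}

/-- There is no boundary term at `x = 0`: the test function satisfies the Neumann condition, and the
kernel is even in `x`, so its slope vanishes there too. -/
theorem integral_green_x (hζ : IsTestFunction T ζ ζt ζx ζxx) {t s R : ℝ} (ht : t ∈ Ico 0 T)
    (hst : s < t) (hR : 0 < R) (h0 : ζ (t, R) = 0) (hx0 : ζx (t, R) = 0) :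
    ∫ x in (0 : ℝ)..R, (ζxx (t, x) * heatKernel (t - s) x - ζ (t, x) * heatKernelDt (t - s) x)
      = 0 := by
  have hslice : ∀ {f : ℝ × ℝ → ℝ}, ContinuousOn f (Ico 0 T ×ˢ Ici 0) →
      ContinuousOn (fun x => f (t, x)) (Icc 0 R) := fun hf =>
    ContinuousOn.comp hf (by fun_prop) fun x hx => ⟨ht, hx.1⟩
  have hcont : ContinuousOn (fun x => ζx (t, x) * heatKernel (t - s) x
      + ζ (t, x) * poissonKernel x (t - s)) (Icc 0 R) :=
    ((hslice hζ.continuousOn_x).mul (continuous_heatKernel_right _).continuousOn).add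
      ((hslice hζ.continuousOn).mul (continuous_poissonKernel_left _).continuousOn)
  have h := intervalIntegral.integral_eq_sub_of_hasDeriv_right_of_le hR.le hcont
    (f' := fun x => ζxx (t, x) * heatKernel (t - s) x - ζ (t, x) * heatKernelDt (t - s) x)
    (fun x hx => ?_) ?_
  · rw [h, h0, hx0, hζ.neumann t ht]
    simp [poissonKernel]
  · have hx' : Ici (0 : ℝ) ∈ 𝓝 x := Ici_mem_nhds hx.1
    have h1 := (hζ.hasDeriv_xx t ht x hx.1.le).hasDerivAt hx'
    have h2 := (hζ.hasDeriv_x t ht x hx.1.le).hasDerivAt hx'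
    have h3 := (h1.mul (hasDerivAt_heatKernel_x (t - s) x)).add
      (h2.mul (hasDerivAt_poissonKernel_x (t := t - s) (by linarith) x))
    refine (h3.congr_deriv ?_).hasDerivWithinAt
    simp only [heatKernelDt]; ring
  · refine ContinuousOn.intervalIntegrable ?_
    rw [uIcc_of_le hR.le]
    exact ((hslice hζ.continuousOn_xx).mul (continuous_heatKernel_right _).continuousOn).sub
      ((hslice hζ.continuousOn).mul (continuous_heatKernelDt_right _).continuousOn)

theorem integral_green_t (hζ : IsTestFunction T ζ ζt ζx ζxx) {a b s x : ℝ} (hs : 0 ≤ s)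
    (hsa : s < a) (hab : a ≤ b) (hbT : b < T) (hx : 0 ≤ x) (h0 : ζ (b, x) = 0) :
    ∫ t in a..b, (ζt (t, x) * heatKernel (t - s) x + ζ (t, x) * heatKernelDt (t - s) x)
      = -(ζ (a, x) * heatKernel (a - s) x) := by
  have hslice : ∀ {f : ℝ × ℝ → ℝ}, ContinuousOn f (Ico 0 T ×ˢ Ici 0) →
      ContinuousOn (fun t => f (t, x)) (Icc a b) := fun hf =>
    ContinuousOn.comp hf (by fun_prop) fun t ht => ⟨⟨by linarith [ht.1], ht.2.trans_lt hbT⟩, hx⟩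
  have hk : ContinuousOn (fun t => heatKernel (t - s) x) (Icc a b) :=
    (continuousOn_heatKernel_left x).comp (by fun_prop)
      fun t ht => show 0 < t - s by linarith [ht.1]
  have hk' : ContinuousOn (fun t => heatKernelDt (t - s) x) (Icc a b) :=
    (ContinuousOn.slice (f := fun z => heatKernelDt z.1 z.2) continuousOn_heatKernelDt
      (mem_univ x)).comp (by fun_prop) fun t ht => show 0 < t - s by linarith [ht.1]
  have h := intervalIntegral.integral_eq_sub_of_hasDeriv_right_of_le hab
    ((hslice hζ.continuousOn).mul hk)
    (f' := fun t => ζt (t, x) * heatKernel (t - s) x + ζ (t, x) * heatKernelDt (t - s) x)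
    (fun t ht => ?_) ?_
  · rw [h]
    simp [h0]
  · have h1 := (hζ.hasDeriv_t t ⟨by linarith [ht.1], by linarith [ht.2]⟩ x hx).hasDerivAt
      (Ici_mem_nhds (by linarith [ht.1]))
    have h2 := (hasDerivAt_heatKernel_t (t := t - s) (by linarith [ht.1]) x).comp_sub_const t s
    exact (h1.mul h2).hasDerivWithinAt
  · refine ContinuousOn.intervalIntegrable ?_
    rw [uIcc_of_le hab]
    exact ((hslice hζ.continuousOn_t).mul hk).add ((hslice hζ.continuousOn).mul hk')

/-- Green's identity for the heat kernel on a rectangle away from its singularity. -/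
theorem setIntegral_green (hζ : IsTestFunction T ζ ζt ζx ζxx) {a b s R : ℝ} (hs : 0 ≤ s)
    (hsa : s < a) (hab : a ≤ b) (hbT : b < T) (hR : 0 < R)
    (hv : ∀ t ∈ Ico 0 T, ∀ x ∈ Ici (0 : ℝ), (b ≤ t ∨ R ≤ x) →
      ζ (t, x) = 0 ∧ ζt (t, x) = 0 ∧ ζx (t, x) = 0 ∧ ζxx (t, x) = 0) :
    ∫ z in Ioc a b ×ˢ Ioc 0 R, (ζt z + ζxx z) * heatKernel (z.1 - s) z.2
      = -∫ x in Ioc 0 R, ζ (a, x) * heatKernel (a - s) x := by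
  have hsub : Icc a b ×ˢ Icc 0 R ⊆ Ico 0 T ×ˢ Ici (0 : ℝ) :=
    prod_mono (fun t ht => ⟨by linarith [ht.1], ht.2.trans_lt hbT⟩) fun x hx => hx.1
  have hmap : MapsTo (fun z : ℝ × ℝ => (z.1 - s, z.2)) (Icc a b ×ˢ Icc 0 R) (Ioi 0 ×ˢ univ) :=
    fun z hz => ⟨show 0 < z.1 - s by linarith [hz.1.1], trivial⟩
  have hk : ContinuousOn (fun z : ℝ × ℝ => heatKernel (z.1 - s) z.2) (Icc a b ×ˢ Icc 0 R) :=
    ContinuousOn.comp (g := fun z : ℝ × ℝ => heatKernel z.1 z.2) continuousOn_heatKernel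
      (by fun_prop) hmap
  have hk' : ContinuousOn (fun z : ℝ × ℝ => heatKernelDt (z.1 - s) z.2) (Icc a b ×ˢ Icc 0 R) :=
    ContinuousOn.comp (g := fun z : ℝ × ℝ => heatKernelDt z.1 z.2) continuousOn_heatKernelDt
      (by fun_prop) hmap
  have hint : ∀ {f : ℝ × ℝ → ℝ}, ContinuousOn f (Icc a b ×ˢ Icc 0 R) →
      IntegrableOn f (Ioc a b ×ˢ Ioc 0 R) := fun hf =>
    (hf.integrableOn_compact (isCompact_Icc.prod isCompact_Icc)).mono_set
      (prod_mono Ioc_subset_Icc_self Ioc_subset_Icc_self)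
  have hA : IntegrableOn (fun z => ζt z * heatKernel (z.1 - s) z.2
      + ζ z * heatKernelDt (z.1 - s) z.2) (Ioc a b ×ˢ Ioc 0 R) :=
          hint ((((hζ.continuousOn_t).mono hsub).mul hk).add
    (((hζ.continuousOn).mono hsub).mul hk'))
  have hB : IntegrableOn (fun z => ζxx z * heatKernel (z.1 - s) z.2
      - ζ z * heatKernelDt (z.1 - s) z.2) (Ioc a b ×ˢ Ioc 0 R) :=
          hint ((((hζ.continuousOn_xx).mono hsub).mul hk).sub
    (((hζ.continuousOn).mono hsub).mul hk'))
  have hres : (volume : Measure (ℝ × ℝ)).restrict (Ioc a b ×ˢ Ioc 0 R)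
      = (volume.restrict (Ioc a b)).prod (volume.restrict (Ioc 0 R)) := by
    rw [Measure.volume_eq_prod, Measure.prod_restrict]
  have hsplit : (fun z => (ζt z + ζxx z) * heatKernel (z.1 - s) z.2) = fun z =>
      (ζt z * heatKernel (z.1 - s) z.2 + ζ z * heatKernelDt (z.1 - s) z.2)
      + (ζxx z * heatKernel (z.1 - s) z.2 - ζ z * heatKernelDt (z.1 - s) z.2) := by
    funext z; ring
  rw [hsplit, integral_add hA hB]
  have hBv : ∫ z in Ioc a b ×ˢ Ioc 0 R,
      (ζxx z * heatKernel (z.1 - s) z.2 - ζ z * heatKernelDt (z.1 - s) z.2) = 0 := by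
    rw [IntegrableOn, hres] at hB
    rw [hres, integral_prod _ hB]
    refine integral_eq_zero_of_ae ?_
    filter_upwards [ae_restrict_mem measurableSet_Ioc] with t ht
    have htT : t ∈ Ico 0 T := ⟨by linarith [ht.1], ht.2.trans_lt hbT⟩
    obtain ⟨h1, -, h3, -⟩ := hv t htT R hR.le (Or.inr le_rfl)
    have := integral_green_x hζ htT (hsa.trans ht.1) hR h1 h3
    rwa [intervalIntegral.integral_of_le hR.le] at this
  have hAv : ∫ z in Ioc a b ×ˢ Ioc 0 R,
      (ζt z * heatKernel (z.1 - s) z.2 + ζ z * heatKernelDt (z.1 - s) z.2)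
      = ∫ x in Ioc 0 R, -(ζ (a, x) * heatKernel (a - s) x) := by
    rw [IntegrableOn, hres] at hA
    rw [hres, integral_prod_symm _ hA]
    refine setIntegral_congr_fun measurableSet_Ioc fun x hx => ?_
    have := integral_green_t hζ hs hsa hab hbT hx.1.le
      (hv b ⟨by linarith, hbT⟩ x hx.1.le (Or.inl le_rfl)).1
    rwa [intervalIntegral.integral_of_le hab] at this
  rw [hAv, hBv, add_zero, integral_neg]

/-- Writing the time gap as `l²` and `x = l y` replaces the concentrating kernel by the fixed
Gaussian at time `1`, and dominated convergence applies. -/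
theorem tendsto_integral_heatKernel (hT : 0 < T) (hζ : IsTestFunction T ζ ζt ζx ζxx) {s : ℝ}
    (hs : s ∈ Ico 0 T) :
    Tendsto (fun l : ℝ => ∫ x in Ioi 0, ζ (s + l ^ 2, x) * heatKernel (l ^ 2) x) (𝓝[>] 0)
      (𝓝 (ζ (s, 0))) := by
  obtain ⟨C, hC0, hC⟩ := hζ.exists_bound hT
  have hlT : ∀ᶠ l : ℝ in 𝓝[>] 0, s + l ^ 2 < T := by
    have : Tendsto (fun l : ℝ => s + l ^ 2) (𝓝[>] 0) (𝓝 (s + 0 ^ 2)) :=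
      (Continuous.tendsto (by fun_prop) 0).mono_left nhdsWithin_le_nhds
    exact this.eventually_lt_const (by simpa using hs.2)
  have hmem : ∀ {l : ℝ}, 0 < l → s + l ^ 2 < T → ∀ {y : ℝ}, 0 < y →
      (s + l ^ 2, l * y) ∈ Ico 0 T ×ˢ Ici (0 : ℝ) := fun hl hlT y hy =>
    ⟨⟨by have := hs.1; positivity, hlT⟩, (mul_pos hl hy).le⟩
  have heq : ∀ᶠ l : ℝ in 𝓝[>] 0, ∫ y in Ioi 0, ζ (s + l ^ 2, l * y) * heatKernel 1 y
      = ∫ x in Ioi 0, ζ (s + l ^ 2, x) * heatKernel (l ^ 2) x := by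
    filter_upwards [self_mem_nhdsWithin] with l hl
    have hl' : 0 < l := hl
    have h := integral_comp_mul_left_Ioi
      (fun x => ζ (s + l ^ 2, x) * heatKernel (l ^ 2) x) 0 hl'
    rw [mul_zero, smul_eq_mul, eq_inv_mul_iff_mul_eq₀ hl'.ne'] at h
    rw [← h, ← integral_const_mul]
    refine setIntegral_congr_fun measurableSet_Ioi fun y _ => ?_
    have := heatKernel_scale hl' 1 y
    rw [mul_one] at this
    simp only [this]
    field_simp
  refine Tendsto.congr' heq ?_
  have hlim : ζ (s, 0) = ∫ y in Ioi 0, ζ (s, 0) * heatKernel 1 y := by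
    rw [integral_const_mul, integral_heatKernel_right one_pos, mul_one]
  rw [hlim]
  refine tendsto_integral_filter_of_dominated_convergence (fun y => C * heatKernel 1 y) ?_ ?_
    ((integrableOn_heatKernel_right one_pos).const_mul C) ?_
  · filter_upwards [self_mem_nhdsWithin, hlT] with l hl hl2
    refine AEStronglyMeasurable.mul (ContinuousOn.aestronglyMeasurable ?_ measurableSet_Ioi)
      (continuous_heatKernel_right 1).aestronglyMeasurable
    exact ContinuousOn.comp hζ.continuousOn (by fun_prop) fun y hy => hmem hl hl2 hy
  · filter_upwards [self_mem_nhdsWithin, hlT] with l hl hl2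
    filter_upwards [ae_restrict_mem measurableSet_Ioi] with y hy
    rw [norm_mul, Real.norm_of_nonneg (heatKernel_nonneg 1 y)]
    exact mul_le_mul_of_nonneg_right (hC _ (hmem hl hl2 hy)).1 (heatKernel_nonneg 1 y)
  · filter_upwards [ae_restrict_mem measurableSet_Ioi] with y hy
    refine Tendsto.mul_const _ ?_
    have h1 := hζ.continuousOn (s, 0) ⟨hs, self_mem_Ici⟩
    refine Tendsto.comp h1 (tendsto_nhdsWithin_iff.2 ⟨?_, ?_⟩)
    · have : Tendsto (fun l : ℝ => (s + l ^ 2, l * y)) (𝓝[>] 0) (𝓝 (s + 0 ^ 2, 0 * y)) :=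
        (Continuous.tendsto (by fun_prop) 0).mono_left nhdsWithin_le_nhds
      simpa using this
    · filter_upwards [self_mem_nhdsWithin, hlT] with l hl hl2 using hmem hl hl2 hy

theorem integrableOn_test_mul_heatKernel (hT : 0 < T) (hζ : IsTestFunction T ζ ζt ζx ζxx) (s : ℝ) :
    IntegrableOn (fun z => (ζt z + ζxx z) * heatKernel (z.1 - s) z.2) (strip T) := by
  obtain ⟨C, hC0, hC⟩ := hζ.exists_bound hT
  refine Integrable.bdd_mul (c := C) (integrableOn_heatKernel_strip hT.le s).1
    hζ.aestronglyMeasurable_heat ?_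
  filter_upwards [ae_restrict_mem (measurableSet_strip T)] with z hz
  exact (hC z (strip_subset T hz)).2

/-- The heat kernel with pole at `(s,0)` solves the weak equation with flux `δ_s`. -/
theorem integral_test_mul_heatKernel (hT : 0 < T) (hζ : IsTestFunction T ζ ζt ζx ζxx) {s : ℝ}
    (hs : s ∈ Ico 0 T) :
    ∫ z in strip T, (ζt z + ζxx z) * heatKernel (z.1 - s) z.2 = -ζ (s, 0) := by
  obtain ⟨T', R, hT'0, hT'T, hR, hv⟩ := hζ.exists_vanishing hT
  have hint := integrableOn_test_mul_heatKernel hT hζ s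
  rcases le_or_gt T' s with hsT | hsT
  · rw [(hv s hs 0 self_mem_Ici (Or.inl hsT)).1, neg_zero]
    refine setIntegral_eq_zero_of_forall_eq_zero fun z hz => ?_
    rcases le_or_gt z.1 s with h | h
    · rw [heatKernel_of_nonpos (by linarith), mul_zero]
    · obtain ⟨-, h2, -, h4⟩ := hv z.1 (strip_subset T hz).1 z.2 (strip_subset T hz).2
        (Or.inl (hsT.trans h.le))
      change ζt z = 0 at h2
      change ζxx z = 0 at h4
      rw [h2, h4, add_zero, zero_mul]
  -- Cut the strip off at time `s + l²`. Green's identity on what remains leaves only a Gaussian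
  -- average of the test function at time `s + l²`, which tends to its value at the pole.
  have hlim1 : Tendsto (fun l : ℝ => ∫ z in strip T,
      {z : ℝ × ℝ | s + l ^ 2 < z.1}.indicator
        (fun z => (ζt z + ζxx z) * heatKernel (z.1 - s) z.2) z) (𝓝[>] 0)
      (𝓝 (∫ z in strip T, (ζt z + ζxx z) * heatKernel (z.1 - s) z.2)) := by
    refine tendsto_integral_filter_of_dominated_convergence _ (.of_forall fun l => ?_)
      (.of_forall fun l => ?_) hint.norm (.of_forall fun z => ?_)
    · exact hint.1.indicator (measurableSet_lt measurable_const measurable_fst)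
    · exact .of_forall fun z => norm_indicator_le_norm_self _ _
    · rcases le_or_gt z.1 s with h | h
      · have : ∀ l : ℝ, {z : ℝ × ℝ | s + l ^ 2 < z.1}.indicator
            (fun z => (ζt z + ζxx z) * heatKernel (z.1 - s) z.2) z = 0 := fun l =>
          indicator_of_notMem (s := {z : ℝ × ℝ | s + l ^ 2 < z.1})
            (not_lt.2 (h.trans (le_add_of_nonneg_right (sq_nonneg l)))) _
        simp only [this]
        rw [heatKernel_of_nonpos (by linarith), mul_zero]
        exact tendsto_const_nhds
      · refine tendsto_const_nhds.congr' ?_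
        have h1 : Tendsto (fun l : ℝ => s + l ^ 2) (𝓝[>] 0) (𝓝 (s + 0 ^ 2)) :=
          (Continuous.tendsto (by fun_prop) 0).mono_left nhdsWithin_le_nhds
        filter_upwards [h1.eventually_lt_const (by simpa using h)] with l hl
        exact (indicator_of_mem (s := {z : ℝ × ℝ | s + l ^ 2 < z.1}) hl
          fun z => (ζt z + ζxx z) * heatKernel (z.1 - s) z.2).symm
  have hlim2 := (tendsto_integral_heatKernel hT hζ hs).neg
  refine tendsto_nhds_unique (hlim1.congr' ?_) hlim2
  have h1 : Tendsto (fun l : ℝ => s + l ^ 2) (𝓝[>] 0) (𝓝 (s + 0 ^ 2)) :=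
    (Continuous.tendsto (by fun_prop) 0).mono_left nhdsWithin_le_nhds
  filter_upwards [self_mem_nhdsWithin, h1.eventually_lt_const (by simpa using hsT)] with l hl hlT'
  have hl' : 0 < l := hl
  have hG := setIntegral_green hζ hs.1 (a := s + l ^ 2) (by nlinarith) hlT'.le hT'T hR hv
  rw [add_sub_cancel_left] at hG
  have hRR : ∫ x in Ioi 0, ζ (s + l ^ 2, x) * heatKernel (l ^ 2) x
      = ∫ x in Ioc 0 R, ζ (s + l ^ 2, x) * heatKernel (l ^ 2) x := by
    refine setIntegral_eq_of_subset_of_forall_sdiff_eq_zero measurableSet_Ioi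
      (fun x hx => hx.1) fun x hx => ?_
    have hxR : R ≤ x := by
      by_contra! h
      exact hx.2 ⟨hx.1, h.le⟩
    rw [(hv (s + l ^ 2) ⟨by have := hs.1; positivity, hlT'.trans hT'T⟩ x (le_of_lt (mem_Ioi.1 hx.1))
      (Or.inr hxR)).1, zero_mul]
  rw [hRR, ← hG]
  have hmeas : MeasurableSet {z : ℝ × ℝ | s + l ^ 2 < z.1} :=
    measurableSet_lt measurable_const measurable_fst
  rw [setIntegral_indicator hmeas]
  refine setIntegral_eq_of_subset_of_forall_sdiff_eq_zero
    ((measurableSet_strip T).inter hmeas) (fun z hz => ?_) fun z hz => ?_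
  · have := hs.1
    exact ⟨⟨⟨by have := hz.1.1; nlinarith [sq_nonneg l], hz.1.2.trans_lt hT'T⟩, hz.2.1⟩, hz.1.1⟩
  · have hor : T' ≤ z.1 ∨ R ≤ z.2 := by
      by_contra! h
      exact hz.2 ⟨⟨hz.1.2, h.1.le⟩, ⟨hz.1.1.2, h.2.le⟩⟩
    obtain ⟨-, h2, -, h4⟩ := hv z.1 (strip_subset T hz.1.1).1 z.2 (strip_subset T hz.1.1).2 hor
    change ζt z = 0 at h2
    change ζxx z = 0 at h4
    rw [h2, h4, add_zero, zero_mul]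

/-- The heat potential of an integrable flux `h` solves the weak equation with flux `h`. -/
theorem integral_test_mul_heatPotential (hT : 0 < T) (hζ : IsTestFunction T ζ ζt ζx ζxx)
    {h : ℝ → ℝ} (hh : Integrable h) (hh0 : ∀ t ∉ Ioo 0 T, h t = 0) :
    IntegrableOn (fun z => (ζt z + ζxx z) * ∫ s, heatKernel (z.1 - s) z.2 * h s) (strip T) ∧
    ∫ z in strip T, (ζt z + ζxx z) * ∫ s, heatKernel (z.1 - s) z.2 * h s
      = -∫ s in Ioo 0 T, h s * ζ (s, 0) := by
  obtain ⟨C, hC0, hC⟩ := hζ.exists_bound hT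
  have hP := integrable_heatPotential hT.le hh
  have hQ : Integrable (fun q : (ℝ × ℝ) × ℝ => (ζt q.1 + ζxx q.1) *
      (heatKernel (q.1.1 - q.2) q.1.2 * h q.2)) ((volume.restrict (strip T)).prod volume) := by
    refine Integrable.bdd_mul (c := C) hP hζ.aestronglyMeasurable_heat.comp_fst ?_
    have : ∀ᵐ z ∂(volume.restrict (strip T)), ‖ζt z + ζxx z‖ ≤ C := by
      filter_upwards [ae_restrict_mem (measurableSet_strip T)] with z hz
      exact (hC z (strip_subset T hz)).2
    exact Measure.quasiMeasurePreserving_fst.ae this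
  have hin : ∀ z, ∫ s, (ζt z + ζxx z) * (heatKernel (z.1 - s) z.2 * h s)
      = (ζt z + ζxx z) * ∫ s, heatKernel (z.1 - s) z.2 * h s := fun z => integral_const_mul _ _
  constructor
  · simpa only [IntegrableOn, hin] using hQ.integral_prod_left
  · have h1 := integral_integral_swap (f := fun z s => (ζt z + ζxx z) *
      (heatKernel (z.1 - s) z.2 * h s)) hQ
    simp only [hin] at h1
    rw [h1, ← integral_neg]
    symm
    refine (setIntegral_congr_fun measurableSet_Ioo fun s hs => ?_).trans
      (setIntegral_eq_integral_of_forall_compl_eq_zero fun s hs => by simp [hh0 s hs])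
    simp only [← mul_assoc]
    rw [integral_mul_const, integral_test_mul_heatKernel hT hζ ⟨hs.1.le, hs.2⟩]
    ring

end

/-! ### Uniqueness for the linear Neumann problem -/

/-- Even reflection turns the characteristic function into a cosine transform, so injectivity of the
latter reduces to that of the former. -/
theorem charFun_add_map_neg (μ : Measure ℝ) [IsFiniteMeasure μ] (ξ : ℝ) :
    charFun (μ + μ.map (fun x => -x)) ξ = ((2 * ∫ x, Real.cos (ξ * x) ∂μ : ℝ) : ℂ) := by
  have hb : ∀ (ν : Measure ℝ) [IsFiniteMeasure ν] (c : ℝ),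
      Integrable (fun x : ℝ => Complex.exp (c * x * Complex.I)) ν := fun ν _ c => by
    refine (integrable_const (1 : ℝ)).mono' (by fun_prop) (.of_forall fun x => ?_)
    rw [← Complex.ofReal_mul, Complex.norm_exp_ofReal_mul_I]
  rw [charFun_apply_real, integral_add_measure (hb _ ξ) (hb _ ξ),
    integral_map (by fun_prop) (by fun_prop)]
  have h2 : (fun x : ℝ => Complex.exp (ξ * ((-x : ℝ) : ℂ) * Complex.I))
      = fun x : ℝ => Complex.exp (((-ξ : ℝ) : ℂ) * x * Complex.I) := by
    funext x; push_cast; ring_nf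
  rw [h2, ← integral_add (hb μ ξ) (hb μ (-ξ)), ← integral_const_mul, ← integral_complex_ofReal]
  refine integral_congr_ae (.of_forall fun x => ?_)
  simp only
  push_cast
  rw [Complex.two_cos]
  ring_nf

/-- Injectivity of the cosine transform on `L¹(0,∞)`. -/
theorem ae_eq_zero_of_cosine_transform {f : ℝ → ℝ} (hf : IntegrableOn f (Ioi 0))
    (h : ∀ ξ : ℝ, ∫ x in Ioi 0, Real.cos (ξ * x) * f x = 0) :
    ∀ᵐ x ∂(volume.restrict (Ioi 0)), f x = 0 := by
  -- Since `ENNReal.ofReal` truncates at zero, `m f` and `m (-f)` have densities `f⁺` and `f⁻`; the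
  -- hypothesis says that their cosine transforms agree.
  set m : (ℝ → ℝ) → Measure ℝ := fun g =>
    (volume.restrict (Ioi 0)).withDensity fun x => ENNReal.ofReal (g x) with hm
  have hfin : ∀ g : ℝ → ℝ, IntegrableOn g (Ioi 0) → IsFiniteMeasure (m g) := fun g hg =>
    isFiniteMeasure_withDensity_ofReal hg.2
  have hcos : ∀ g : ℝ → ℝ, IntegrableOn g (Ioi 0) → ∀ ξ : ℝ,
      ∫ x, Real.cos (ξ * x) ∂(m g) = ∫ x in Ioi 0, Real.cos (ξ * x) * max (g x) 0 :=
          fun g hg ξ => by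
    rw [hm, integral_withDensity_eq_integral_toReal_smul₀ hg.1.aemeasurable.ennreal_ofReal
      (.of_forall fun x => ENNReal.ofReal_lt_top)]
    simp only [ENNReal.toReal_ofReal', smul_eq_mul, mul_comm]
  have hnf : IntegrableOn (fun x => -f x) (Ioi 0) := hf.neg
  have := hfin f hf
  have := hfin (fun x => -f x) hnf
  have hchar : charFun (m f + (m f).map (fun x => -x))
      = charFun (m (fun x => -f x) + (m fun x => -f x).map (fun x => -x)) := by
    funext ξ
    rw [charFun_add_map_neg, charFun_add_map_neg, hcos f hf, hcos _ hnf]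
    suffices h' : ∫ x in Ioi 0, Real.cos (ξ * x) * max (f x) 0
        = ∫ x in Ioi 0, Real.cos (ξ * x) * max (-f x) 0 by rw [h']
    have hi : ∀ g : ℝ → ℝ, IntegrableOn g (Ioi 0) →
        IntegrableOn (fun x => Real.cos (ξ * x) * max (g x) 0) (Ioi 0) := fun g hg =>
      Integrable.bdd_mul (c := 1) (Integrable.pos_part hg) (Continuous.aestronglyMeasurable
          (by fun_prop))
        (.of_forall fun x => Real.abs_cos_le_one _)
    have h2 := integral_sub (hi f hf) (hi _ hnf)
    rw [← sub_eq_zero, ← h2]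
    refine Eq.trans ?_ (h ξ)
    refine integral_congr_ae (.of_forall fun x => ?_)
    simp only
    rcases le_total 0 (f x) with h1 | h1
    · rw [max_eq_left h1, max_eq_right (by linarith)]; ring
    · rw [max_eq_right h1, max_eq_left (by linarith)]; ring
  have hmeq := Measure.ext_of_charFun hchar
  -- The reflected copy does not charge `(0,∞)`, so restriction undoes the symmetrisation.
  have hres : ∀ g : ℝ → ℝ, (m g + (m g).map (fun x => -x)).restrict (Ioi 0) = m g := fun g => by
    have h1 : (m g).restrict (Ioi 0) = m g := by
      rw [hm, restrict_withDensity measurableSet_Ioi, Measure.restrict_restrict measurableSet_Ioi,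
        inter_self]
    have h2 : ((m g).map (fun x => -x)).restrict (Ioi 0) = 0 := by
      have hempty : (fun x : ℝ => -x) ⁻¹' Ioi 0 ∩ Ioi 0 = ∅ := by
        ext x
        simp only [mem_inter_iff, mem_preimage, mem_Ioi, mem_empty_iff_false, iff_false, not_and]
        intro hx; linarith
      rw [Measure.restrict_eq_zero, Measure.map_apply (by fun_prop) measurableSet_Ioi, ← h1,
        Measure.restrict_apply ((measurable_neg : Measurable fun x : ℝ => -x) measurableSet_Ioi),
        hempty, measure_empty]
    rw [Measure.restrict_add, h1, h2, add_zero]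
  have hmm : m f = m fun x => -f x := by
    rw [← hres f, hmeq, hres]
  have hd := (withDensity_eq_iff hf.1.aemeasurable.ennreal_ofReal
    hf.neg.1.aemeasurable.ennreal_ofReal (hf.lintegral_lt_top).ne).1 hmm
  filter_upwards [hd] with x hx
  simp only [Pi.neg_apply] at hx
  rcases le_total 0 (f x) with h1 | h1
  · rw [ENNReal.ofReal_of_nonpos (by linarith : -f x ≤ 0), ENNReal.ofReal_eq_zero] at hx
    linarith
  · rw [ENNReal.ofReal_of_nonpos h1, eq_comm, ENNReal.ofReal_eq_zero] at hx
    linarith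

theorem bounded_of_continuous_of_eq_zero {f : ℝ → ℝ} (hf : Continuous f) {a b : ℝ}
    (h : ∀ x, x < a ∨ b < x → f x = 0) : ∃ C, 0 ≤ C ∧ ∀ x, |f x| ≤ C := by
  obtain ⟨C, hC⟩ := (isCompact_Icc (a := a) (b := b)).exists_bound_of_continuousOn hf.continuousOn
  refine ⟨max C 0, le_max_right _ _, fun x => ?_⟩
  by_cases hx : x ∈ Icc a b
  · exact (hC x hx).trans (le_max_left _ _)
  · rw [h x, abs_zero]
    · exact le_max_right _ _
    · by_contra! h'
      exact hx ⟨h'.1, h'.2⟩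

/-- A `C²` cut-off function with bounded derivatives. -/
theorem exists_cutoff : ∃ (χ χ' χ'' : ℝ → ℝ) (C : ℝ), 0 ≤ C ∧ (∀ x, HasDerivAt χ (χ' x) x) ∧
    (∀ x, HasDerivAt χ' (χ'' x) x) ∧ Continuous χ'' ∧ (∀ x ≤ 1, χ x = 1) ∧ (∀ x, 2 ≤ x → χ x = 0) ∧
    (∀ x, |χ x| ≤ 1) ∧ (∀ x, |χ' x| ≤ C) ∧ (∀ x, |χ'' x| ≤ C) ∧ χ' 0 = 0 := by
  set χ : ℝ → ℝ := fun x => Real.smoothTransition (2 - x) with hχ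
  have hsm : ContDiff ℝ 2 χ := Real.smoothTransition.contDiff.comp (by fun_prop)
  have hsm1 : ContDiff ℝ 1 (deriv χ) := hsm.deriv' 
  have h1 : ∀ x ≤ 1, χ x = 1 := fun x hx => Real.smoothTransition.one_of_one_le (by linarith)
  have h2 : ∀ x, 2 ≤ x → χ x = 0 := fun x hx => Real.smoothTransition.zero_of_nonpos (by linarith)
  have hd1 : ∀ x, x < 1 ∨ 2 < x → deriv χ x = 0 := fun x hx => by
    rcases hx with hx | hx
    · have : χ =ᶠ[𝓝 x] fun _ => 1 := by
        filter_upwards [Iio_mem_nhds hx] with y hy using h1 y (le_of_lt hy)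
      rw [this.deriv_eq, deriv_const]
    · have : χ =ᶠ[𝓝 x] fun _ => 0 := by
        filter_upwards [Ioi_mem_nhds hx] with y hy using h2 y (le_of_lt hy)
      rw [this.deriv_eq, deriv_const]
  have hd2 : ∀ x, x < 1 ∨ 2 < x → deriv (deriv χ) x = 0 := fun x hx => by
    have : deriv χ =ᶠ[𝓝 x] fun _ => 0 := by
      rcases hx with hx | hx
      · filter_upwards [Iio_mem_nhds hx] with y hy using hd1 y (Or.inl hy)
      · filter_upwards [Ioi_mem_nhds hx] with y hy using hd1 y (Or.inr hy)
    rw [this.deriv_eq, deriv_const]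
  have hc2 : Continuous (deriv (deriv χ)) := hsm1.continuous_deriv le_rfl
  obtain ⟨C₁, hC₁0, hC₁⟩ := bounded_of_continuous_of_eq_zero hsm1.continuous hd1
  obtain ⟨C₂, hC₂0, hC₂⟩ := bounded_of_continuous_of_eq_zero hc2 hd2
  refine ⟨χ, deriv χ, deriv (deriv χ), max C₁ C₂, le_max_of_le_left hC₁0,
    fun x => (hsm.differentiable (by norm_num) x).hasDerivAt,
    fun x => (hsm1.differentiable (by norm_num) x).hasDerivAt, hc2, h1, h2, fun x => ?_,
    fun x => (hC₁ x).trans (le_max_left _ _), fun x => (hC₂ x).trans (le_max_right _ _),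
    hd1 0 (Or.inl one_pos)⟩
  rw [abs_of_nonneg (Real.smoothTransition.nonneg _)]
  exact Real.smoothTransition.le_one _

/-- The test functions `a(t) cos(ξ x) χ(r x)`. -/
theorem isTestFunction_cos {T T₁ ξ r : ℝ} {a a' χ χ' χ'' : ℝ → ℝ} (hT₁ : T₁ < T) (hr : 0 < r)
    (ha : ∀ t, HasDerivAt a (a' t) t) (ha' : Continuous a') (ha0 : ∀ t ∈ Ico 0 T, T₁ < t → a t = 0)
    (hχ : ∀ x, HasDerivAt χ (χ' x) x) (hχ' : ∀ x, HasDerivAt χ' (χ'' x) x) (hχ'' : Continuous χ'')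
    (h2 : ∀ x, 2 ≤ x → χ x = 0) (h0 : χ' 0 = 0) :
    IsTestFunction T (fun z => a z.1 * (Real.cos (ξ * z.2) * χ (r * z.2)))
      (fun z => a' z.1 * (Real.cos (ξ * z.2) * χ (r * z.2)))
      (fun z => a z.1 * (-ξ * Real.sin (ξ * z.2) * χ (r * z.2)
        + r * (Real.cos (ξ * z.2) * χ' (r * z.2))))
      (fun z => a z.1 * (-ξ ^ 2 * Real.cos (ξ * z.2) * χ (r * z.2)
        - 2 * ξ * r * Real.sin (ξ * z.2) * χ' (r * z.2)
        + r ^ 2 * Real.cos (ξ * z.2) * χ'' (r * z.2))) := by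
  have hac : Continuous a := continuous_iff_continuousAt.2 fun t => (ha t).continuousAt
  have hχc : Continuous χ := continuous_iff_continuousAt.2 fun t => (hχ t).continuousAt
  have hχc' : Continuous χ' := continuous_iff_continuousAt.2 fun t => (hχ' t).continuousAt
  have hlin : ∀ (c x : ℝ), HasDerivAt (fun y => c * y) c x := fun c x => by
    simpa using (hasDerivAt_id x).const_mul c
  have hcos : ∀ x, HasDerivAt (fun y => Real.cos (ξ * y)) (-Real.sin (ξ * x) * ξ) x := fun x =>
    (hlin ξ x).cos
  have hsin : ∀ x, HasDerivAt (fun y => Real.sin (ξ * y)) (Real.cos (ξ * x) * ξ) x := fun x =>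
    (hlin ξ x).sin
  have hχr : ∀ x, HasDerivAt (fun y => χ (r * y)) (χ' (r * x) * r) x := fun x =>
    (hχ (r * x)).comp x (hlin r x)
  have hχr' : ∀ x, HasDerivAt (fun y => χ' (r * y)) (χ'' (r * x) * r) x := fun x =>
    (hχ' (r * x)).comp x (hlin r x)
  refine ⟨by fun_prop, by fun_prop, by fun_prop, by fun_prop, fun t _ x _ => ?_, fun t _ x _ => ?_,
    fun t _ x _ => ?_, ?_, fun t _ => by simp [h0]⟩
  · exact ((ha t).mul_const (Real.cos (ξ * x) * χ (r * x))).hasDerivWithinAt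
  · refine ((((hcos x).mul (hχr x)).const_mul (a t)).congr_deriv ?_).hasDerivWithinAt
    simp only; ring
  · refine ((((((hsin x).const_mul (-ξ)).mul (hχr x)).add
      (((hcos x).mul (hχr' x)).const_mul r)).const_mul (a t)).congr_deriv ?_).hasDerivWithinAt
    simp only; ring
  · refine ⟨Icc 0 T₁ ×ˢ Icc 0 (2 / r), isCompact_Icc.prod isCompact_Icc,
      prod_mono (fun t ht => ⟨ht.1, ht.2.trans_lt hT₁⟩) fun x hx => hx.1, fun z hz hzS => ?_⟩
    have : T₁ < z.1 ∨ 2 / r < z.2 := by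
      by_contra! h
      exact hzS ⟨⟨hz.1.1, h.1⟩, ⟨hz.2, h.2⟩⟩
    rcases this with h | h
    · rw [ha0 z.1 hz.1 h, zero_mul]
    · rw [div_lt_iff₀ hr] at h
      rw [h2 (r * z.2) (by linarith), mul_zero, mul_zero]

/-- If `a' = ξ² a + β` with `a(T) = 0`, solved backwards from `T`, then `a(t) cos(ξ x)` satisfies
the Neumann condition and the backward heat operator maps it to `β(t) cos(ξ x)`. It lacks compact
support in `x`; a cut-off at scale `n + 1` repairs this, and the terms with derivatives of the
cut-off are `O(1/n)`. -/
theorem integral_cos_mul_eq_zero {T : ℝ} {w : ℝ × ℝ → ℝ} (hw : IntegrableOn w (strip T))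
    (hweak : ∀ ζ ζt ζx ζxx : ℝ × ℝ → ℝ, IsTestFunction T ζ ζt ζx ζxx →
      ∫ z in strip T, (ζt z + ζxx z) * w z = 0) (ξ : ℝ) {β : ℝ → ℝ} (hβ : Continuous β)
    (hβc : HasCompactSupport β) (hβT : tsupport β ⊆ Ioo 0 T) :
    ∫ z in strip T, β z.1 * (Real.cos (ξ * z.2) * w z) = 0 := by
  obtain ⟨χ, χ', χ'', C, hC0, hχ, hχ', hχ'', h1, h2, hb, hb', hb'', h0⟩ := exists_cutoff
  obtain ⟨T₁, hT₁, hβ0⟩ : ∃ T₁, T₁ < T ∧ ∀ t, T₁ < t → β t = 0 := by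
    rcases (tsupport β).eq_empty_or_nonempty with h | h
    · refine ⟨T - 1, by linarith, fun t _ => ?_⟩
      rw [tsupport_eq_empty_iff] at h
      rw [h]; rfl
    · obtain ⟨t₁, ht₁, hmax⟩ := hβc.isCompact.exists_isMaxOn h continuous_id.continuousOn
      refine ⟨t₁, (hβT ht₁).2, fun t ht => ?_⟩
      by_contra hne
      exact absurd (hmax (subset_tsupport β hne)) (not_le.2 ht)
  set a : ℝ → ℝ := fun t => Real.exp (ξ ^ 2 * t) * ∫ s in T..t,
      Real.exp (-(ξ ^ 2 * s)) * β s with ha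
  have hcβ : Continuous fun s => Real.exp (-(ξ ^ 2 * s)) * β s := by fun_prop
  have had : ∀ t, HasDerivAt a (ξ ^ 2 * a t + β t) t := fun t => by
    have e1 : HasDerivAt (fun t : ℝ => Real.exp (ξ ^ 2 * t)) (Real.exp (ξ ^ 2 * t) * ξ ^ 2) t := by
      simpa using (((hasDerivAt_id t).const_mul (ξ ^ 2)).exp)
    refine (e1.mul (hcβ.integral_hasStrictDerivAt T t).hasDerivAt).congr_deriv ?_
    have : Real.exp (ξ ^ 2 * t) * Real.exp (-(ξ ^ 2 * t)) = 1 := by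
      rw [← Real.exp_add]; simp
    simp only [ha]
    linear_combination β t * this
  have hac : Continuous a := continuous_iff_continuousAt.2 fun t => (had t).continuousAt
  have ha0 : ∀ t ∈ Ico 0 T, T₁ < t → a t = 0 := fun t ht htT => by
    have : ∫ s in T..t, Real.exp (-(ξ ^ 2 * s)) * β s = ∫ s in T..t, (0 : ℝ) := by
      refine intervalIntegral.integral_congr fun s hs => ?_
      rw [uIcc_of_ge ht.2.le] at hs
      simp only [hβ0 s (htT.trans_le hs.1), mul_zero]
    simp [ha, this]
  obtain ⟨A, hA⟩ := (isCompact_Icc (a := 0) (b := T)).exists_bound_of_continuousOn hac.continuousOn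
  obtain ⟨B, hB⟩ := (isCompact_Icc (a := 0) (b := T)).exists_bound_of_continuousOn hβ.continuousOn
  set F : ℕ → ℝ × ℝ → ℝ := fun n z =>
    β z.1 * (Real.cos (ξ * z.2) * χ (((n : ℝ) + 1)⁻¹ * z.2))
      + ((n : ℝ) + 1)⁻¹ * (a z.1 * (-2 * ξ * Real.sin (ξ * z.2) * χ' (((n : ℝ) + 1)⁻¹ * z.2)
        + ((n : ℝ) + 1)⁻¹ * Real.cos (ξ * z.2) * χ'' (((n : ℝ) + 1)⁻¹ * z.2))) with hF
  have hr : ∀ n : ℕ, 0 < ((n : ℝ) + 1)⁻¹ := fun n => by positivity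
  have hr1 : ∀ n : ℕ, ((n : ℝ) + 1)⁻¹ ≤ 1 := fun n => inv_le_one_of_one_le₀ (by
    have : (0 : ℝ) ≤ n := n.cast_nonneg
    linarith)
  have hχc : Continuous χ := continuous_iff_continuousAt.2 fun t => (hχ t).continuousAt
  have hχc' : Continuous χ' := continuous_iff_continuousAt.2 fun t => (hχ' t).continuousAt
  have hF0 : ∀ n, ∫ z in strip T, F n z * w z = 0 := fun n => by
    rw [← hweak _ _ _ _ (isTestFunction_cos (ξ := ξ) hT₁ (hr n) had (by fun_prop) ha0
      hχ hχ' hχ'' h2 h0)]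
    refine integral_congr_ae (.of_forall fun z => ?_)
    simp only [hF]; ring
  have hAB : ∀ n : ℕ, ∀ z ∈ strip T, |a z.1 * (-2 * ξ * Real.sin (ξ * z.2) * χ'
      (((n : ℝ) + 1)⁻¹ * z.2)
        + ((n : ℝ) + 1)⁻¹ * Real.cos (ξ * z.2) * χ'' (((n : ℝ) + 1)⁻¹ * z.2))|
        ≤ A * (2 * |ξ| * C + C) := fun n z hz => by
    have hzT : z.1 ∈ Icc 0 T := ⟨hz.1.1.le, hz.1.2.le⟩
    rw [abs_mul]
    refine mul_le_mul (hA _ hzT) ?_ (abs_nonneg _) ((norm_nonneg _).trans (hA _ hzT))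
    refine (abs_add_le _ _).trans (add_le_add ?_ ?_)
    · rw [abs_mul, abs_mul, abs_mul, abs_neg, abs_two]
      have := Real.abs_sin_le_one (ξ * z.2)
      calc 2 * |ξ| * |Real.sin (ξ * z.2)| * |χ' (((n : ℝ) + 1)⁻¹ * z.2)|
          ≤ 2 * |ξ| * 1 * C := by gcongr; exact hb' _
        _ = _ := by ring
    · rw [abs_mul, abs_mul, abs_of_pos (hr n)]
      have := Real.abs_cos_le_one (ξ * z.2)
      calc ((n : ℝ) + 1)⁻¹ * |Real.cos (ξ * z.2)| * |χ'' (((n : ℝ) + 1)⁻¹ * z.2)|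
          ≤ 1 * 1 * C := by gcongr; exacts [hr1 n, hb'' _]
        _ = _ := by ring
  have hlim : Tendsto (fun n => ∫ z in strip T, F n z * w z) atTop
      (𝓝 (∫ z in strip T, β z.1 * (Real.cos (ξ * z.2) * w z))) := by
    refine tendsto_integral_of_dominated_convergence
      (fun z => (B + A * (2 * |ξ| * C + C)) * ‖w z‖) (fun n => ?_) (hw.norm.const_mul _)
      (fun n => ?_) (.of_forall fun z => ?_)
    · refine AEStronglyMeasurable.mul (Continuous.aestronglyMeasurable ?_) hw.1
      simp only [hF]; fun_prop
    · filter_upwards [ae_restrict_mem (measurableSet_strip T)] with z hz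
      rw [norm_mul]
      refine mul_le_mul_of_nonneg_right ?_ (norm_nonneg _)
      refine (norm_add_le _ _).trans (add_le_add ?_ ?_)
      · have hzT : z.1 ∈ Icc 0 T := ⟨hz.1.1.le, hz.1.2.le⟩
        rw [norm_mul, norm_mul]
        have h3 : ‖Real.cos (ξ * z.2)‖ * ‖χ (((n : ℝ) + 1)⁻¹ * z.2)‖ ≤ 1 :=
          mul_le_one₀ (Real.abs_cos_le_one _) (norm_nonneg _) (hb _)
        calc ‖β z.1‖ * (‖Real.cos (ξ * z.2)‖ * ‖χ (((n : ℝ) + 1)⁻¹ * z.2)‖) ≤ ‖β z.1‖ * 1 := by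
              gcongr
          _ ≤ B := by rw [mul_one]; exact hB _ hzT
      · rw [norm_mul, Real.norm_of_nonneg (hr n).le]
        exact (mul_le_of_le_one_left (norm_nonneg _) (hr1 n)).trans (hAB n z hz)
    · have hr0 : Tendsto (fun n : ℕ => ((n : ℝ) + 1)⁻¹) atTop (𝓝 0) :=
        tendsto_inv_atTop_zero.comp (tendsto_atTop_add_const_right _ _ tendsto_natCast_atTop_atTop)
      have hrz : Tendsto (fun n : ℕ => ((n : ℝ) + 1)⁻¹ * z.2) atTop (𝓝 0) := by
        simpa using hr0.mul_const z.2
      have hx0 := (hχc.tendsto 0).comp hrz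
      have hx1 := (hχc'.tendsto 0).comp hrz
      have hx2 := (hχ''.tendsto 0).comp hrz
      rw [h1 0 zero_le_one] at hx0
      have := ((hx0.const_mul (Real.cos (ξ * z.2))).const_mul (β z.1)).add
        (hr0.mul (((hx1.const_mul (-2 * ξ * Real.sin (ξ * z.2))).add
          ((hr0.mul_const (Real.cos (ξ * z.2))).mul hx2)).const_mul (a z.1)))
      convert! this.mul_const (w z) using 2
      ring
  simp only [hF0] at hlim
  exact tendsto_nhds_unique hlim tendsto_const_nhds

/-- Uniqueness of integrable weak solutions of the homogeneous Neumann problem. -/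
theorem ae_eq_zero_of_weak {T : ℝ} {w : ℝ × ℝ → ℝ} (hw : IntegrableOn w (strip T))
    (hweak : ∀ ζ ζt ζx ζxx : ℝ × ℝ → ℝ, IsTestFunction T ζ ζt ζx ζxx →
      ∫ z in strip T, (ζt z + ζxx z) * w z = 0) :
    ∀ᵐ z ∂(volume.restrict (strip T)), w z = 0 := by
  have hw' := hw
  rw [IntegrableOn, restrict_strip] at hw'
  have hcw : ∀ ξ : ℝ, Integrable (fun z : ℝ × ℝ => Real.cos (ξ * z.2) * w z)
      ((volume.restrict (Ioo 0 T)).prod (volume.restrict (Ioi 0))) := fun ξ =>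
    Integrable.bdd_mul (c := 1) hw' (Continuous.aestronglyMeasurable (by fun_prop))
      (.of_forall fun z => Real.abs_cos_le_one _)
  have hW : ∀ ξ : ℝ, ∀ᵐ t, t ∈ Ioo 0 T → ∫ x in Ioi 0, Real.cos (ξ * x) * w (t, x) = 0 :=
      fun ξ => by
    have hWi : IntegrableOn (fun t => ∫ x in Ioi 0, Real.cos (ξ * x) * w (t, x)) (Ioo 0 T) :=
      (hcw ξ).integral_prod_left
    refine isOpen_Ioo.ae_eq_zero_of_integral_contDiff_smul_eq_zero hWi.locallyIntegrableOn
      fun β hβ hβc hβT => ?_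
    have h1 := integral_cos_mul_eq_zero hw hweak ξ hβ.continuous hβc hβT
    obtain ⟨B, hB⟩ := hβc.exists_bound_of_continuous hβ.continuous
    have hi : Integrable (fun z : ℝ × ℝ => β z.1 * (Real.cos (ξ * z.2) * w z))
        ((volume.restrict (Ioo 0 T)).prod (volume.restrict (Ioi 0))) :=
      Integrable.bdd_mul (c := B) (hcw ξ)
        (hβ.continuous.comp continuous_fst).aestronglyMeasurable (.of_forall fun z => hB _)
    rw [restrict_strip, integral_prod _ hi] at h1
    simp only [integral_const_mul] at h1
    refine Eq.trans ?_ h1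
    refine (setIntegral_eq_integral_of_forall_compl_eq_zero fun t ht => ?_).symm
    rw [image_eq_zero_of_notMem_tsupport fun h => ht (hβT h), zero_smul]
  have hall : ∀ᵐ t ∂(volume.restrict (Ioo 0 T)), ∀ᵐ x ∂(volume.restrict (Ioi 0)), w (t, x) = 0 := by
    -- Rational frequencies give one null set of times for all of them; continuity in `ξ` covers the
    -- remaining frequencies.
    have hQ : ∀ᵐ t, ∀ q : ℚ, t ∈ Ioo 0 T → ∫ x in Ioi 0, Real.cos (q * x) * w (t, x) = 0 :=
      ae_all_iff.2 fun q => hW q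
    filter_upwards [hw'.prod_right_ae, ae_restrict_of_ae hQ, ae_restrict_mem measurableSet_Ioo]
      with t ht1 ht2 htT
    refine ae_eq_zero_of_cosine_transform ht1 fun ξ => ?_
    have hc : Continuous fun ξ : ℝ => ∫ x in Ioi 0, Real.cos (ξ * x) * w (t, x) := by
      refine continuous_of_dominated (bound := fun x => ‖w (t, x)‖) (fun ξ => ?_) (fun ξ => ?_)
        ht1.norm (.of_forall fun x => by fun_prop)
      · exact AEStronglyMeasurable.mul (Continuous.aestronglyMeasurable (by fun_prop)) ht1.1
      · refine .of_forall fun x => ?_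
        rw [norm_mul]
        exact mul_le_of_le_one_left (norm_nonneg _) (Real.abs_cos_le_one _)
    exact congrFun (hc.ext_on Rat.denseRange_cast continuous_const (by
      rintro _ ⟨q, rfl⟩; exact ht2 q htT)) ξ
  have h0 : ∫ z, ‖w z‖ ∂((volume.restrict (Ioo 0 T)).prod (volume.restrict (Ioi 0))) = 0 := by
    rw [integral_prod _ hw'.norm]
    refine integral_eq_zero_of_ae ?_
    filter_upwards [hall] with t ht
    refine integral_eq_zero_of_ae ?_
    filter_upwards [ht] with x hx
    simp [hx]
  rw [restrict_strip]
  have h1 := (integral_eq_zero_iff_of_nonneg (fun z => norm_nonneg (w z)) hw'.norm).1 h0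
  filter_upwards [h1] with z hz
  exact norm_eq_zero.1 hz

/-! ### Representation of weak solutions by their boundary flux -/

/-- The solution of the heat equation with zero initial data and flux `c δ₀ - h`. -/
noncomputable def fluxSolution (c : ℝ) (h : ℝ → ℝ) (z : ℝ × ℝ) : ℝ :=
  c * heatKernel z.1 z.2 - ∫ s, heatKernel (z.1 - s) z.2 * h s

/-- The exponent `1/4` is a convenient choice: it bounds the kernel difference by `√x t^(-3/4)`,
which is integrable in time near `0` and vanishes with `x`. -/
theorem one_sub_exp_neg_le {y : ℝ} (hy : 0 ≤ y) : 1 - Real.exp (-y) ≤ y ^ (1 / 4 : ℝ) := by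
  rcases le_total y 1 with h | h
  · have h1 := Real.add_one_le_exp (-y)
    have h2 : y ^ (1 : ℝ) ≤ y ^ (1 / 4 : ℝ) :=
      Real.rpow_le_rpow_of_exponent_ge_of_imp hy h (by norm_num) (fun _ => by norm_num)
    rw [Real.rpow_one] at h2
    linarith
  · have h1 := Real.one_le_rpow h (by norm_num : (0 : ℝ) ≤ 1 / 4)
    linarith [Real.exp_pos (-y)]

theorem heatKernel_sub_le {t x : ℝ} (ht : 0 < t) (hx : 0 ≤ x) :
    heatKernel t 0 - heatKernel t x ≤ √x * t ^ (-(3 / 4) : ℝ) := by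
  have hk : heatKernel t x = Real.exp (-(x ^ 2 / (4 * t))) * heatKernel t 0 := by
    rw [heatKernel_at_zero, heatKernel]; ring
  have h1 := one_sub_exp_neg_le (show 0 ≤ x ^ 2 / (4 * t) by positivity)
  have h2 : (x ^ 2 / (4 * t)) ^ (1 / 4 : ℝ) ≤ √x * t ^ (-(1 / 4) : ℝ) := by
    calc (x ^ 2 / (4 * t)) ^ (1 / 4 : ℝ) ≤ (x ^ 2 * t⁻¹) ^ (1 / 4 : ℝ) := by
          refine Real.rpow_le_rpow (by positivity) ?_ (by norm_num)
          rw [div_eq_mul_inv, mul_inv]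
          have : 0 ≤ t⁻¹ := by positivity
          exact mul_le_mul_of_nonneg_left (by linarith) (by positivity)
      _ = _ := by
          rw [Real.mul_rpow (by positivity) (by positivity), Real.inv_rpow ht.le,
              Real.rpow_neg ht.le,
            ← Real.rpow_natCast_mul hx, Real.sqrt_eq_rpow]
          norm_num
  have h3 : heatKernel t 0 ≤ t ^ (-(1 / 2) : ℝ) := by
    rw [heatKernel_at_zero_rpow ht.le]
    refine mul_le_of_le_one_left (by positivity) (inv_le_one_of_one_le₀ ?_)
    rw [Real.one_le_sqrt]
    linarith [Real.pi_gt_three]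
  calc heatKernel t 0 - heatKernel t x
      = (1 - Real.exp (-(x ^ 2 / (4 * t)))) * heatKernel t 0 := by rw [hk]; ring
    _ ≤ (√x * t ^ (-(1 / 4) : ℝ)) * t ^ (-(1 / 2) : ℝ) :=
        mul_le_mul (h1.trans h2) h3 (heatKernel_nonneg _ _) (by positivity)
    _ = √x * t ^ (-(3 / 4) : ℝ) := by
        rw [mul_assoc, ← Real.rpow_add ht]; norm_num

theorem integral_heatKernel_sub_le {T x : ℝ} (hT : 0 < T) (hx : 0 ≤ x) :
    ∫ t in Ioo 0 T, (heatKernel t 0 - heatKernel t x)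
      ≤ √x * ∫ t in Ioo 0 T, t ^ (-(3 / 4) : ℝ) := by
  have hi : ∀ y, IntegrableOn (fun t => heatKernel t y) (Ioo 0 T) := fun y =>
    (integrableOn_heatKernel_left T y).mono_set fun t ht => ht.2
  have hr : IntegrableOn (fun t : ℝ => t ^ (-(3 / 4) : ℝ)) (Ioo 0 T) := by
    have := (intervalIntegral.intervalIntegrable_rpow' (a := 0) (b := T)
      (r := -(3 / 4)) (by norm_num))
    rwa [intervalIntegrable_iff_integrableOn_Ioo_of_le hT.le] at this
  rw [← integral_const_mul]
  exact setIntegral_mono_on ((hi 0).sub (hi x)) (hr.const_mul _) measurableSet_Ioo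
    fun t ht => heatKernel_sub_le ht.1 hx

section

variable {T c : ℝ} {h : ℝ → ℝ}

theorem integrableOn_fluxSolution_strip (hT : 0 ≤ T) (hh : Integrable h) :
    IntegrableOn (fluxSolution c h) (strip T) := by
  have h1 := (integrableOn_heatKernel_strip hT 0).1
  simp only [sub_zero] at h1
  exact (h1.const_mul c).sub (integrable_heatPotential hT hh).integral_prod_left

theorem aestronglyMeasurable_heatPotential (hh : Integrable h) (x : ℝ) :
    AEStronglyMeasurable fun t => ∫ s, heatKernel (t - s) x * h s := by
  have hm : AEStronglyMeasurable (fun q : ℝ × ℝ => heatKernel (q.1 - q.2) x * h q.2)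
      (volume.prod volume) :=
    ((measurable_heatKernel_left x).comp (measurable_fst.sub
        measurable_snd)).aestronglyMeasurable.mul
      hh.1.comp_snd
  exact hm.integral_prod_right'

theorem integrableOn_fluxSolution_boundary (hh : Integrable h) (hh0 : ∀ t ≤ 0, h t = 0) :
    IntegrableOn (fun t => fluxSolution c h (t, 0)) (Ioo 0 T) := by
  have hki : IntegrableOn (fun t => heatKernel t 0) (Ioo 0 T) :=
    (integrableOn_heatKernel_left T 0).mono_set fun t ht => ht.2
  refine (hki.const_mul c).sub ?_
  obtain ⟨h1, h2, -⟩ := integral_causal_conv_le (fun t => heatKernel_nonneg t 0)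
    (measurable_heatKernel_left 0) (fun t ht => heatKernel_of_nonpos ht 0) hki le_rfl hh.norm
    (fun t ht => by simp [hh0 t ht]) fun t => norm_nonneg _
  refine Integrable.mono' h2 (aestronglyMeasurable_heatPotential hh 0).restrict
    (.of_forall fun t => ?_)
  refine (norm_integral_le_integral_norm _).trans_eq (integral_congr_ae (.of_forall fun s => ?_))
  simp only [norm_mul, Real.norm_of_nonneg (heatKernel_nonneg _ _)]

/-- The difference is governed by the nonnegative kernel `k(t,0) - k(t,x)`, whose mass on `(0,T)` is
`O(√x)`; Young's inequality transfers this bound to the heat potential. -/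
theorem integral_abs_fluxSolution_sub_le (hT : 0 < T) (hc : 0 ≤ c) (hh : Integrable h)
    (hh0 : ∀ t ≤ 0, h t = 0) {x : ℝ} (hx : 0 ≤ x) :
    ∫ t in Ioo 0 T, |fluxSolution c h (t, x) - fluxSolution c h (t, 0)|
      ≤ (√x * ∫ t in Ioo 0 T, t ^ (-(3 / 4) : ℝ)) * (c + ∫ s, |h s|) := by
  set A := √x * ∫ t in Ioo 0 T, t ^ (-(3 / 4) : ℝ) with hA
  have hki : ∀ y, IntegrableOn (fun t => heatKernel t y) (Ioo 0 T) := fun y =>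
    (integrableOn_heatKernel_left T y).mono_set fun t ht => ht.2
  have hdn : ∀ t, 0 ≤ heatKernel t 0 - heatKernel t x := fun t => sub_nonneg.2 (heatKernel_le t x)
  have hdi : IntegrableOn (fun t => heatKernel t 0 - heatKernel t x) (Ioo 0 T) :=
      (hki 0).sub (hki x)
  have hint := integral_heatKernel_sub_le hT hx
  obtain ⟨h1, h2, h3⟩ := integral_causal_conv_le hdn
    ((measurable_heatKernel_left 0).sub (measurable_heatKernel_left x))
    (fun t ht => by rw [heatKernel_of_nonpos ht, heatKernel_of_nonpos ht, sub_zero])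
    hdi hint hh.norm (fun t ht => by simp [hh0 t ht]) fun t => norm_nonneg _
  have hk := fun y => ae_integrable_causal_conv (T := T) (fun t => heatKernel_nonneg t y)
    (measurable_heatKernel_left y) (fun t ht => heatKernel_of_nonpos ht y) (hki y) hh hh0
  have hpt : ∀ᵐ t, t ∈ Ioo 0 T → |fluxSolution c h (t, x) - fluxSolution c h (t, 0)| ≤
      c * (heatKernel t 0 - heatKernel t x)
        + ∫ s, (heatKernel (t - s) 0 - heatKernel (t - s) x) * ‖h s‖ := by
    filter_upwards [hk 0, hk x] with t ht0 htx htT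
    have e : fluxSolution c h (t, x) - fluxSolution c h (t, 0) =
        -(c * (heatKernel t 0 - heatKernel t x))
        + ∫ s, (heatKernel (t - s) 0 - heatKernel (t - s) x) * h s := by
      simp only [sub_mul]
      rw [integral_sub (ht0 htT) (htx htT)]
      simp only [fluxSolution]; ring
    rw [e]
    refine (abs_add_le _ _).trans (add_le_add ?_ ?_)
    · rw [abs_neg, abs_of_nonneg (mul_nonneg hc (hdn t))]
    · rw [← Real.norm_eq_abs]
      refine (norm_integral_le_integral_norm _).trans_eq
        (integral_congr_ae (.of_forall fun s => ?_))
      simp only [norm_mul, Real.norm_of_nonneg (hdn _)]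
  calc ∫ t in Ioo 0 T, |fluxSolution c h (t, x) - fluxSolution c h (t, 0)|
      ≤ ∫ t in Ioo 0 T, (c * (heatKernel t 0 - heatKernel t x)
        + ∫ s, (heatKernel (t - s) 0 - heatKernel (t - s) x) * ‖h s‖) :=
        integral_mono_of_nonneg (.of_forall fun t => abs_nonneg _) ((hdi.const_mul c).add h2)
          ((ae_restrict_iff' measurableSet_Ioo).2 hpt)
    _ = c * (∫ t in Ioo 0 T, (heatKernel t 0 - heatKernel t x))
        + ∫ t in Ioo 0 T, ∫ s, (heatKernel (t - s) 0 - heatKernel (t - s) x) * ‖h s‖ := by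
        rw [integral_add (hdi.const_mul c) h2, integral_const_mul]
    _ ≤ c * A + A * ∫ s, ‖h s‖ := add_le_add (mul_le_mul_of_nonneg_left hint hc) h3
    _ = _ := by simp only [Real.norm_eq_abs]; ring

theorem restrict_Ioo_prod (T ε : ℝ) : (volume : Measure (ℝ × ℝ)).restrict (Ioo 0 T ×ˢ Ioo 0 ε)
    = (volume.restrict (Ioo 0 T)).prod (volume.restrict (Ioo 0 ε)) := by
  rw [Measure.volume_eq_prod, Measure.prod_restrict]

theorem integrableOn_sub_trace {u : ℝ × ℝ → ℝ} (hu : IntegrableOn u (strip T))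
    (hub : IntegrableOn (fun t => u (t, 0)) (Ioo 0 T)) (ε : ℝ) :
    IntegrableOn (fun z => u z - u (z.1, 0)) (Ioo 0 T ×ˢ Ioo 0 ε) := by
  refine Integrable.sub (IntegrableOn.mono_set hu (prod_mono_right fun x hx => hx.1)) ?_
  have hone : Integrable (fun _ : ℝ => (1 : ℝ)) (volume.restrict (Ioo 0 ε)) := by simp
  have := Integrable.mul_prod (μ := volume.restrict (Ioo 0 T)) (ν := volume.restrict (Ioo 0 ε))
    hub hone
  rw [restrict_Ioo_prod]
  simpa using this

theorem tendsto_fluxSolution_trace (hT : 0 < T) (hc : 0 ≤ c) (hh : Integrable h)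
    (hh0 : ∀ t ≤ 0, h t = 0) :
    Tendsto (fun ε : ℝ => ε⁻¹ * ∫ z in Ioo 0 T ×ˢ Ioo 0 ε,
      |fluxSolution c h z - fluxSolution c h (z.1, 0)|) (𝓝[>] 0) (𝓝 0) := by
  set A := (∫ t in Ioo 0 T, t ^ (-(3 / 4) : ℝ)) * (c + ∫ s, |h s|) with hA
  have hA0 : 0 ≤ A := mul_nonneg
    (setIntegral_nonneg measurableSet_Ioo fun t ht => Real.rpow_nonneg ht.1.le _)
    (add_nonneg hc (integral_nonneg fun s => abs_nonneg _))
  have hlim : Tendsto (fun ε : ℝ => √ε * A) (𝓝[>] 0) (𝓝 0) := by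
    have : Tendsto (fun ε : ℝ => √ε * A) (𝓝[>] 0) (𝓝 (√0 * A)) :=
      (Continuous.tendsto (by fun_prop) 0).mono_left nhdsWithin_le_nhds
    simpa using this
  refine squeeze_zero' ?_ ?_ hlim
  · filter_upwards [self_mem_nhdsWithin] with ε hε
    exact mul_nonneg (inv_nonneg.2 (le_of_lt hε)) (integral_nonneg fun z => abs_nonneg _)
  · filter_upwards [self_mem_nhdsWithin] with ε hε
    have hε' : 0 < ε := hε
    rw [inv_mul_le_iff₀ hε']
    have hi := (integrableOn_sub_trace (integrableOn_fluxSolution_strip (c := c) hT.le hh)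
      (integrableOn_fluxSolution_boundary hh hh0) ε).norm
    rw [restrict_Ioo_prod] at hi ⊢
    simp only [Real.norm_eq_abs] at hi
    rw [integral_prod_symm _ hi]
    calc ∫ x in Ioo 0 ε, ∫ t in Ioo 0 T, |fluxSolution c h (t, x) - fluxSolution c h (t, 0)|
        ≤ ∫ x in Ioo 0 ε, √ε * A := by
          refine setIntegral_mono_on hi.integral_prod_right (integrable_const _) measurableSet_Ioo
            fun x hx => ?_
          refine (integral_abs_fluxSolution_sub_le hT hc hh hh0 hx.1.le).trans ?_
          rw [mul_assoc]
          exact mul_le_mul_of_nonneg_right (Real.sqrt_le_sqrt hx.2.le) hA0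
      _ = ε * (√ε * A) := by simp [hε'.le]

theorem fluxSolution_weak_eq (hT : 0 < T) (hh : Integrable h) (hh0 : ∀ t ∉ Ioo 0 T, h t = 0)
    {ζ ζt ζx ζxx : ℝ × ℝ → ℝ} (hζ : IsTestFunction T ζ ζt ζx ζxx) :
    IntegrableOn (fun z => (ζt z + ζxx z) * fluxSolution c h z) (strip T) ∧
    ∫ z in strip T, (ζt z + ζxx z) * fluxSolution c h z
      = -(c * ζ (0, 0)) + ∫ s in Ioo 0 T, h s * ζ (s, 0) := by
  obtain ⟨h1, h2⟩ := integral_test_mul_heatPotential hT hζ hh hh0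
  have h3 := integrableOn_test_mul_heatKernel hT hζ 0
  have h4 := integral_test_mul_heatKernel hT hζ (s := 0) ⟨le_rfl, hT⟩
  simp only [sub_zero] at h3 h4
  have e : (fun z => (ζt z + ζxx z) * fluxSolution c h z) = fun z =>
      c * ((ζt z + ζxx z) * heatKernel z.1 z.2)
      - (ζt z + ζxx z) * ∫ s, heatKernel (z.1 - s) z.2 * h s := by
    funext z; simp only [fluxSolution]; ring
  rw [e]
  refine ⟨(h3.const_mul c).sub h1, ?_⟩
  rw [integral_sub (h3.const_mul c) h1, integral_const_mul, h4, h2]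
  ring

/-- The half-open interval contains `0`, so the full Dirac mass is counted. -/
theorem integral_Ico_dirac (hT : 0 < T) (hc : 0 ≤ c) (f : ℝ → ℝ) :
    ∫ t in Ico 0 T, f t ∂(ENNReal.ofReal c • Measure.dirac 0) = c * f 0 := by
  have hmem : (0 : ℝ) ∈ Ico 0 T := ⟨le_rfl, hT⟩
  rw [Measure.restrict_smul, Measure.restrict_eq_self_of_ae_mem, integral_smul_measure,
    integral_dirac, ENNReal.toReal_ofReal hc, smul_eq_mul]
  exact (ae_dirac_iff (p := fun x => x ∈ Ico 0 T) measurableSet_Ico).2 hmem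

end

/-- Functions given by their boundary flux are weak solutions. -/
theorem isWeakSolution_of_fluxSolution {g : ℝ → ℝ} {T c : ℝ} (hT : 0 < T) (hc : 0 ≤ c)
    {u : ℝ × ℝ → ℝ} {h : ℝ → ℝ} (hh : Integrable h) (hh0 : ∀ t ∉ Ioo 0 T, h t = 0)
    (hhg : ∀ t ∈ Ioo 0 T, h t = g (u (t, 0)))
    (hu : ∀ t ∈ Ioo 0 T, ∀ x, 0 ≤ x → u (t, x) = fluxSolution c h (t, x)) :
    IsWeakSolution g 0 (ENNReal.ofReal c • Measure.dirac 0) T u := by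
  have hh0' : ∀ t ≤ 0, h t = 0 := fun t ht => hh0 t fun h' => absurd h'.1 (not_lt.2 ht)
  have hus : EqOn (fluxSolution c h) u (strip T) := fun z hz =>
    (hu z.1 hz.1 z.2 (le_of_lt hz.2)).symm
  refine ⟨?_, ?_, ?_, ?_, fun ζ ζt ζx ζxx hζ => ?_⟩
  · exact (integrableOn_fluxSolution_strip hT.le hh).congr_fun hus (measurableSet_strip T)
  · exact (integrableOn_fluxSolution_boundary hh hh0').congr_fun
      (fun t ht => (hu t ht 0 le_rfl).symm) measurableSet_Ioo
  · exact hh.integrableOn.congr_fun hhg measurableSet_Ioo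
  · refine (tendsto_fluxSolution_trace hT hc hh hh0').congr fun ε => ?_
    congr 1
    refine setIntegral_congr_fun (measurableSet_Ioo.prod measurableSet_Ioo) fun z hz => ?_
    rw [← hu z.1 hz.1 0 le_rfl, ← hu z.1 hz.1 z.2 hz.2.1.le]
  · have h1 := (fluxSolution_weak_eq (c := c) hT hh hh0 hζ).2
    have h2 : ∫ z in strip T, (ζt z + ζxx z) * u z
        = ∫ z in strip T, (ζt z + ζxx z) * fluxSolution c h z :=
      setIntegral_congr_fun (measurableSet_strip T) fun z hz => by simp only [hus hz]
    have h3 : ∫ t in Ioo 0 T, g (u (t, 0)) * ζ (t, 0) = ∫ s in Ioo 0 T, h s * ζ (s, 0) :=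
      setIntegral_congr_fun measurableSet_Ioo fun t ht => by simp only [hhg t ht]
    rw [h2, h1, h3, integral_Ico_dirac hT hc]
    simp

/-- Weak solutions are given by their boundary flux. -/
theorem IsWeakSolution.ae_eq_fluxSolution {g : ℝ → ℝ} {T c : ℝ} (hT : 0 < T) (hc : 0 ≤ c)
    {v : ℝ × ℝ → ℝ} (hv : IsWeakSolution g 0 (ENNReal.ofReal c • Measure.dirac 0) T v) {h : ℝ → ℝ}
    (hh0 : ∀ t ∉ Ioo 0 T, h t = 0) (hhg : ∀ t ∈ Ioo 0 T, h t = g (v (t, 0))) :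
    Integrable h ∧ (∀ᵐ z ∂(volume.restrict (strip T)), v z = fluxSolution c h z) ∧
      ∀ᵐ t ∂(volume.restrict (Ioo 0 T)), v (t, 0) = fluxSolution c h (t, 0) := by
  have hh : Integrable h := by
    rw [← integrableOn_iff_integrable_of_support_subset (s := Ioo 0 T)]
    · exact hv.integrable_flux.congr_fun (fun t ht => (hhg t ht).symm) measurableSet_Ioo
    · intro t ht
      by_contra h'
      exact ht (hh0 t h')
  have hh0' : ∀ t ≤ 0, h t = 0 := fun t ht => hh0 t fun h' => absurd h'.1 (not_lt.2 ht)
  have hfi := integrableOn_fluxSolution_strip (c := c) hT.le hh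
  have hfb := integrableOn_fluxSolution_boundary (c := c) (T := T) hh hh0'
  have hae : ∀ᵐ z ∂(volume.restrict (strip T)), v z = fluxSolution c h z := by
    -- Both functions carry the same flux, so their difference is a weak solution of the homogeneous
    -- Neumann problem.
    have := ae_eq_zero_of_weak (w := fun z => v z - fluxSolution c h z) (hv.integrable.sub hfi)
      fun ζ ζt ζx ζxx hζ => by
        obtain ⟨h1, h2⟩ := fluxSolution_weak_eq (c := c) hT hh hh0 hζ
        have h3 := hv.weak_eq ζ ζt ζx ζxx hζ
        obtain ⟨C, hC0, hC⟩ := hζ.exists_bound hT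
        have h4 : IntegrableOn (fun z => (ζt z + ζxx z) * v z) (strip T) := by
          refine Integrable.bdd_mul (c := C) hv.integrable hζ.aestronglyMeasurable_heat ?_
          filter_upwards [ae_restrict_mem (measurableSet_strip T)] with z hz
          exact (hC z (strip_subset T hz)).2
        have h5 : ∫ t in Ioo 0 T, g (v (t, 0)) * ζ (t, 0) = ∫ s in Ioo 0 T, h s * ζ (s, 0) :=
          setIntegral_congr_fun measurableSet_Ioo fun t ht => by simp only [hhg t ht]
        simp only [mul_sub]
        rw [integral_sub h4 h1, h2]
        rw [h5, integral_Ico_dirac hT hc, Measure.restrict_zero, integral_zero_measure] at h3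
        linarith
    filter_upwards [this] with z hz
    linarith
  refine ⟨hh, hae, ?_⟩
  -- Equality almost everywhere inside says nothing directly about the boundary values. Averaging
  -- over `0 < x < ε` and inserting the common interior values bounds `D` by the two trace errors,
  -- which tend to zero.
  set D := ∫ t in Ioo 0 T, |v (t, 0) - fluxSolution c h (t, 0)| with hD
  have hDi : IntegrableOn (fun t => v (t, 0) - fluxSolution c h (t, 0)) (Ioo 0 T) :=
    hv.integrable_boundary.sub hfb
  have hle : ∀ᶠ ε : ℝ in 𝓝[>] 0, D ≤ (ε⁻¹ * ∫ z in Ioo 0 T ×ˢ Ioo 0 ε, |v z - v (z.1, 0)|)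
      + ε⁻¹ * ∫ z in Ioo 0 T ×ˢ Ioo 0 ε, |fluxSolution c h z - fluxSolution c h (z.1, 0)| := by
    filter_upwards [self_mem_nhdsWithin] with ε hε
    have hε' : 0 < ε := hε
    have hi1 := (integrableOn_sub_trace hv.integrable hv.integrable_boundary ε).norm
    have hi2 := (integrableOn_sub_trace hfi hfb ε).norm
    simp only [Real.norm_eq_abs] at hi1 hi2
    have hone : Integrable (fun _ : ℝ => (1 : ℝ)) (volume.restrict (Ioo 0 ε)) := by simp
    have h6 : ∫ z in Ioo 0 T ×ˢ Ioo 0 ε, |v (z.1, 0) - fluxSolution c h (z.1, 0)| = ε * D := by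
      have := integral_prod_mul (μ := volume.restrict (Ioo 0 T)) (ν := volume.restrict (Ioo 0 ε))
        (fun t => |v (t, 0) - fluxSolution c h (t, 0)|) fun _ => (1 : ℝ)
      rw [restrict_Ioo_prod]
      simp only [mul_one] at this
      rw [this]
      simp [hε'.le, mul_comm, hD]
    have hi3 : IntegrableOn (fun z : ℝ × ℝ => |v (z.1, 0) - fluxSolution c h (z.1, 0)|)
        (Ioo 0 T ×ˢ Ioo 0 ε) := by
      have := Integrable.mul_prod (μ := volume.restrict (Ioo 0 T)) (ν := volume.restrict (Ioo 0 ε))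
        hDi.norm hone
      rw [IntegrableOn, restrict_Ioo_prod]
      simpa using this
    rw [← mul_add, le_inv_mul_iff₀ hε', ← h6, ← integral_add hi1 hi2]
    refine integral_mono_ae hi3 (hi1.add hi2) ?_
    have hae' := ae_restrict_of_ae_restrict_of_subset
      (prod_mono_right (fun x hx => hx.1) : Ioo 0 T ×ˢ Ioo 0 ε ⊆ strip T) hae
    filter_upwards [hae'] with z hz
    rw [hz]
    calc |v (z.1, 0) - fluxSolution c h (z.1, 0)|
        = |-(fluxSolution c h z - v (z.1, 0))
            + (fluxSolution c h z - fluxSolution c h (z.1, 0))| := by congr 1; ring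
      _ ≤ _ := by rw [← abs_neg (fluxSolution c h z - v (z.1, 0))]; exact abs_add_le _ _
  have hD0 : D ≤ 0 := by
    have := hv.trace.add (tendsto_fluxSolution_trace hT hc hh hh0')
    rw [add_zero] at this
    exact ge_of_tendsto this hle
  have hD1 : D = 0 := le_antisymm hD0 (integral_nonneg fun t => abs_nonneg _)
  have := (integral_eq_zero_iff_of_nonneg (fun t => norm_nonneg _) hDi.norm).1 hD1
  filter_upwards [this] with t ht
  have := norm_eq_zero.1 ht
  linarith

/-! ### Solutions of the boundary equation: order and scaling -/

/-- `v` is the boundary value of a solution with boundary flux `c δ₀ - g(v)`. -/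
structure IsBoundarySolution (p c : ℝ) (v : ℝ → ℝ) : Prop where
  continuousOn : ContinuousOn v (Ioi 0)
  nonneg : ∀ t, 0 ≤ v t
  le : ∀ t, v t ≤ c * heatKernel t 0
  eq : ∀ t, v t = c * heatKernel t 0 - ∫ s, heatKernel (t - s) 0 * powerFlux p (v s)

theorem powerFlux_nonneg (p : ℝ) {r : ℝ} (hr : 0 ≤ r) : 0 ≤ powerFlux p r :=
  mul_nonneg (Real.rpow_nonneg (abs_nonneg _) _) hr

namespace IsBoundarySolution

variable {p c c' : ℝ} {v v' : ℝ → ℝ}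

theorem of_nonpos (hv : IsBoundarySolution p c v) {t : ℝ} (ht : t ≤ 0) : v t = 0 :=
  le_antisymm ((hv.le t).trans_eq (by rw [heatKernel_of_nonpos ht, mul_zero])) (hv.nonneg t)

theorem flux_of_nonpos (hv : IsBoundarySolution p c v) {t : ℝ} (ht : t ≤ 0) :
    powerFlux p (v t) = 0 := by rw [hv.of_nonpos ht, powerFlux_zero]

theorem flux_nonneg (hv : IsBoundarySolution p c v) (t : ℝ) : 0 ≤ powerFlux p (v t) :=
  powerFlux_nonneg p (hv.nonneg t)

theorem flux_eq (hp : 1 < p) (hv : IsBoundarySolution p c v) (t : ℝ) :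
    powerFlux p (v t) = v t ^ p := powerFlux_of_nonneg (by linarith) (hv.nonneg t)

theorem continuousOn_flux (hp : 1 < p) (hv : IsBoundarySolution p c v) :
    ContinuousOn (fun t => powerFlux p (v t)) (Ioi 0) :=
  (continuous_powerFlux hp.le).comp_continuousOn hv.continuousOn

theorem le_rpow (hv : IsBoundarySolution p c v) {t : ℝ} (ht : 0 < t) :
    v t ≤ c * (√Real.pi)⁻¹ * t ^ (-(1 / 2) : ℝ) := by
  rw [mul_assoc, ← heatKernel_at_zero_rpow ht.le]; exact hv.le t

theorem const_nonneg (hv : IsBoundarySolution p c v) : 0 ≤ c :=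
  nonneg_of_mul_nonneg_left ((hv.nonneg 1).trans (hv.le 1)) (heatKernel_pos one_pos 0)

theorem abs_flux_le (hp : 1 < p) (hv : IsBoundarySolution p c v) {t : ℝ} (ht : 0 < t) :
    |powerFlux p (v t)| ≤ (c * (√Real.pi)⁻¹) ^ p * t ^ (-(p / 2)) := by
  have hc := hv.const_nonneg
  rw [abs_of_nonneg (hv.flux_nonneg t), hv.flux_eq hp]
  refine (Real.rpow_le_rpow (hv.nonneg t) (hv.le_rpow ht) (by linarith)).trans_eq ?_
  rw [Real.mul_rpow (by positivity) (by positivity), ← Real.rpow_mul ht.le]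
  congr 2; ring

theorem aestronglyMeasurable_flux (hp : 1 < p) (hv : IsBoundarySolution p c v) :
    AEStronglyMeasurable (fun t => powerFlux p (v t)) :=
  aestronglyMeasurable_of_causal (hv.continuousOn_flux hp) fun _ ht => hv.flux_of_nonpos ht

theorem integrable_heatKernel_mul_flux (hp1 : 1 < p) (hp2 : p < 2)
    (hv : IsBoundarySolution p c v) (t x : ℝ) :
    Integrable fun s => heatKernel (t - s) x * powerFlux p (v s) :=
  integrable_heatKernel_mul (by linarith) (hv.aestronglyMeasurable_flux hp1)
    (fun _ ht => hv.flux_of_nonpos ht) (fun _ hs => hv.abs_flux_le hp1 hs) x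

theorem integrableOn_flux (hp1 : 1 < p) (hp2 : p < 2)
    (hv : IsBoundarySolution p c v) (T : ℝ) :
    IntegrableOn (fun s => powerFlux p (v s)) (Ioo 0 T) := by
  rcases le_or_gt T 0 with hT | hT
  · simp [Ioo_eq_empty (not_lt.2 hT)]
  have hr : IntegrableOn (fun t : ℝ => t ^ (-(p / 2) : ℝ)) (Ioo 0 T) := by
    have := (intervalIntegral.intervalIntegrable_rpow' (a := 0) (b := T)
      (r := -(p / 2)) (by linarith))
    rwa [intervalIntegrable_iff_integrableOn_Ioo_of_le hT.le] at this
  refine Integrable.mono' (hr.const_mul ((c * (√Real.pi)⁻¹) ^ p))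
    (hv.aestronglyMeasurable_flux hp1).restrict ?_
  filter_upwards [ae_restrict_mem measurableSet_Ioo] with t ht
  exact hv.abs_flux_le hp1 ht.1

theorem aestronglyMeasurable (hv : IsBoundarySolution p c v) : AEStronglyMeasurable v :=
  aestronglyMeasurable_of_causal hv.continuousOn fun _ ht => hv.of_nonpos ht

theorem integrableOn (hv : IsBoundarySolution p c v) (T : ℝ) : IntegrableOn v (Ioo 0 T) := by
  have hki : IntegrableOn (fun t => heatKernel t 0) (Ioo 0 T) :=
    (integrableOn_heatKernel_left T 0).mono_set fun t ht => ht.2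
  refine Integrable.mono' (hki.const_mul c) hv.aestronglyMeasurable.restrict
    (.of_forall fun t => ?_)
  rw [Real.norm_of_nonneg (hv.nonneg t)]; exact hv.le t

/-- Truncating the flux at time `T` does not change the potential before time `T`. -/
theorem integral_indicator_Ioo {h : ℝ → ℝ} (h0 : ∀ t ≤ 0, h t = 0) {T t : ℝ} (ht : t < T) (x : ℝ) :
    ∫ s, heatKernel (t - s) x * (Ioo 0 T).indicator h s = ∫ s, heatKernel (t - s) x * h s := by
  refine integral_congr_ae (.of_forall fun s => ?_)
  by_cases hs : s ∈ Ioo 0 T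
  · simp only [indicator_of_mem hs]
  · simp only [indicator_of_notMem hs]
    rcases le_or_gt s 0 with h | h
    · rw [h0 s h]
    · rw [heatKernel_of_nonpos (by by_contra h'; exact hs ⟨h, by linarith⟩), zero_mul, zero_mul]

/-- The difference `v - v'` solves an Abel equation with source `-(c' - c) k` and a flux difference
of its own sign. The comparison principle gives the order almost everywhere, and continuity gives it
everywhere. -/
theorem mono (hp1 : 1 < p) (hp2 : p < 2) (hv : IsBoundarySolution p c v)
    (hv' : IsBoundarySolution p c' v') (hc : c ≤ c') (t : ℝ) : v t ≤ v' t := by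
  rcases le_or_gt t 0 with ht | ht
  · rw [hv.of_nonpos ht, hv'.of_nonpos ht]
  set T := t + 1 with hT
  have hm : ∀ s, v s - v' s = -((c' - c) * heatKernel s 0)
      - ∫ r, heatKernel (s - r) 0 * (powerFlux p (v r) - powerFlux p (v' r)) := fun s => by
    simp only [mul_sub]
    rw [integral_sub (hv.integrable_heatKernel_mul_flux hp1 hp2 s 0)
      (hv'.integrable_heatKernel_mul_flux hp1 hp2 s 0), hv.eq s, hv'.eq s]
    ring
  set w := (Ioo 0 T).indicator fun s => v s - v' s with hw
  set h := (Ioo 0 T).indicator fun s => powerFlux p (v s) - powerFlux p (v' s) with hh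
  have hg := strictMono_powerFlux (p := p) (by linarith)
  have key := comparison (T := T) (c := c' - c) (w := w) (h := h) (by linarith) (by linarith)
    (((hv.integrableOn_flux hp1 hp2 T).sub (hv'.integrableOn_flux hp1 hp2 T)).integrable_indicator
      measurableSet_Ioo)
    (((hv.integrableOn T).sub (hv'.integrableOn T)).integrable_indicator measurableSet_Ioo)
    (fun s hs => indicator_of_notMem hs _)
    (.of_forall fun s hs => by
      rw [hw, indicator_of_mem hs, hm s, hh, integral_indicator_Ioo (fun r hr => by
        rw [hv.flux_of_nonpos hr, hv'.flux_of_nonpos hr, sub_zero]) hs.2])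
    (fun s hs => by
      by_cases hsT : s ∈ Ioo 0 T
      · rw [hw, indicator_of_mem hsT] at hs
        rw [hh, indicator_of_mem hsT]
        exact sub_nonneg.2 (hg.monotone (by linarith))
      · rw [hh, indicator_of_notMem hsT])
    (fun s hs => by
      by_cases hsT : s ∈ Ioo 0 T
      · rw [hw, indicator_of_mem hsT] at hs
        rw [hh, indicator_of_mem hsT]
        exact sub_nonpos.2 (hg.monotone (by linarith))
      · rw [hh, indicator_of_notMem hsT])
    (fun s hs => by
      by_cases hsT : s ∈ Ioo 0 T
      · rw [hw, indicator_of_mem hsT] at hs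
        rw [hh, indicator_of_mem hsT, sub_eq_zero.1 hs, sub_self]
      · rw [hh, indicator_of_notMem hsT])
  have := nonneg_of_ae_nonneg (U := Ioo 0 T) (v := fun s => v' s - v s) isOpen_Ioo
    ((hv'.continuousOn.sub hv.continuousOn).mono fun s hs => hs.1) (by
      filter_upwards [key] with s hs hsT
      rw [hh, indicator_of_mem hsT, sub_nonpos, hg.le_iff_le] at hs
      linarith) t ⟨ht, by linarith⟩
  linarith

theorem unique (hp1 : 1 < p) (hp2 : p < 2) (hv : IsBoundarySolution p c v)
    (hv' : IsBoundarySolution p c v') : v = v' :=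
  funext fun t => le_antisymm (hv.mono hp1 hp2 hv' le_rfl t) (hv'.mono hp1 hp2 hv le_rfl t)

/-- The substitution `s ↦ l² s` and the kernel scaling `l⁻¹` leave a factor `l` in the convolution.
The amplitude `l^(1/(p-1))` is the one for which the nonlinearity absorbs it. -/
theorem scale (hp1 : 1 < p) (hv : IsBoundarySolution p c v) {l : ℝ} (hl : 0 < l) :
    IsBoundarySolution p (l ^ (1 / (p - 1) - 1) * c) fun t => l ^ (1 / (p - 1)) * v
        (l ^ 2 * t) := by
  have hp0 : p - 1 ≠ 0 := by linarith
  have e1 : l ^ (1 / (p - 1) - 1) = l ^ (1 / (p - 1)) * l⁻¹ := by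
    rw [Real.rpow_sub hl, Real.rpow_one, div_eq_mul_inv]
  have hk : ∀ t : ℝ, heatKernel (l ^ 2 * t) 0 = l⁻¹ * heatKernel t 0 := fun t => by
    have := heatKernel_scale hl t 0
    rwa [mul_zero] at this
  refine ⟨?_, fun t => mul_nonneg (by positivity) (hv.nonneg _), fun t => ?_, fun t => ?_⟩
  · refine continuousOn_const.mul (hv.continuousOn.comp (by fun_prop) fun t ht => ?_)
    exact mul_pos (by positivity) (mem_Ioi.1 ht)
  · refine (mul_le_mul_of_nonneg_left (hv.le (l ^ 2 * t)) (by positivity)).trans_eq ?_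
    rw [hk t, e1]; ring
  · have hflux : ∀ s, powerFlux p (l ^ (1 / (p - 1)) * v s)
        = l ^ (1 / (p - 1)) * l * powerFlux p (v s) := fun s => by
      rw [powerFlux, powerFlux, abs_mul, abs_of_nonneg (by positivity : 0 ≤ l ^ (1 / (p - 1))),
        Real.mul_rpow (by positivity) (abs_nonneg _), ← Real.rpow_mul hl.le, one_div_mul_cancel hp0,
        Real.rpow_one]
      ring
    have hsub : ∫ s, heatKernel (l ^ 2 * t - s) 0 * powerFlux p (v s)
        = l * ∫ s, heatKernel (t - s) 0 * powerFlux p (v (l ^ 2 * s)) := by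
      have := Measure.integral_comp_mul_left
        (fun s => heatKernel (l ^ 2 * t - s) 0 * powerFlux p (v s)) (l ^ 2)
      rw [abs_of_pos (by positivity), smul_eq_mul, eq_inv_mul_iff_mul_eq₀ (by positivity)] at this
      rw [← this, ← integral_const_mul, ← integral_const_mul]
      refine integral_congr_ae (.of_forall fun s => ?_)
      simp only
      rw [← mul_sub, hk _]
      field_simp
    simp only [hflux]
    rw [hv.eq (l ^ 2 * t), hk t, hsub, e1]
    simp only [mul_left_comm _ (l ^ (1 / (p - 1)) * l)]
    rw [integral_const_mul]
    ring

end IsBoundarySolution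

/-- Rescales the unit solution. As `p < 2`, the exponent `1/(p-1) - 1` is positive, so every
positive mass is attained. -/
theorem exists_isBoundarySolution {p c : ℝ} (hp1 : 1 < p) (hp2 : p < 2) (hc : 0 ≤ c) :
    ∃ v, IsBoundarySolution p c v := by
  rcases hc.eq_or_lt with rfl | hc
  · refine ⟨0, continuousOn_const, fun _ => le_rfl, fun t => by simp, fun t => ?_⟩
    simp [powerFlux_zero]
  · obtain ⟨v, h1, h2, h3, h4⟩ := exists_boundary_solution hp1 hp2
    have hv : IsBoundarySolution p 1 v := ⟨h1, h2, fun t => by simpa using h3 t,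
      fun t => by simpa using h4 t⟩
    have hp0 : p - 1 ≠ 0 := by linarith
    have hq : 1 / (p - 1) - 1 ≠ 0 := by
      have : 1 < 1 / (p - 1) := by rw [lt_div_iff₀ (by linarith)]; linarith
      linarith
    have := hv.scale hp1 (Real.rpow_pos_of_pos hc (1 / (p - 1) - 1)⁻¹)
    rw [← Real.rpow_mul hc.le, inv_mul_cancel₀ hq, Real.rpow_one, mul_one] at this
    exact ⟨_, this⟩

/-! ### Uniqueness for the nonlinear problem -/

/-- Weak solutions with the same Dirac flux coincide. -/
theorem IsWeakSolution.unique {g : ℝ → ℝ} (hg : StrictMono g) {T c : ℝ} (hT : 0 < T)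
    (hc : 0 ≤ c) {u v : ℝ × ℝ → ℝ}
    (hu : IsWeakSolution g 0 (ENNReal.ofReal c • Measure.dirac 0) T u)
    (hv : IsWeakSolution g 0 (ENNReal.ofReal c • Measure.dirac 0) T v) :
    (∀ᵐ z ∂(volume.restrict (strip T)), v z = u z) ∧
      ∀ᵐ t ∂(volume.restrict (Ioo 0 T)), v (t, 0) = u (t, 0) := by
  set h : (ℝ × ℝ → ℝ) → ℝ → ℝ := fun f => (Ioo 0 T).indicator fun t => g (f (t, 0)) with hh
  have h0 : ∀ f, ∀ t ∉ Ioo 0 T, h f t = 0 := fun f t ht => indicator_of_notMem ht _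
  have h0' : ∀ f, ∀ t ≤ 0, h f t = 0 := fun f t ht => h0 f t fun h' => absurd h'.1 (not_lt.2 ht)
  have h1 : ∀ f, ∀ t ∈ Ioo 0 T, h f t = g (f (t, 0)) := fun f t ht => indicator_of_mem ht _
  have hki : IntegrableOn (fun t => heatKernel t 0) (Ioo 0 T) :=
    (integrableOn_heatKernel_left T 0).mono_set fun t ht => ht.2
  -- The traces of two weak solutions satisfy an Abel equation with `c = 0`. Comparison in both
  -- directions equates the fluxes, and strict monotonicity of `g` then equates the traces.
  have key : ∀ f₁ f₂, IsWeakSolution g 0 (ENNReal.ofReal c • Measure.dirac 0) T f₁ →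
      IsWeakSolution g 0 (ENNReal.ofReal c • Measure.dirac 0) T f₂ →
      ∀ᵐ t, h f₁ t - h f₂ t ≤ 0 := fun f₁ f₂ hf₁ hf₂ => by
    obtain ⟨i₁, -, b₁⟩ := hf₁.ae_eq_fluxSolution hT hc (h0 f₁) (h1 f₁)
    obtain ⟨i₂, -, b₂⟩ := hf₂.ae_eq_fluxSolution hT hc (h0 f₂) (h1 f₂)
    have hk := fun f (i : Integrable (h f)) => ae_integrable_causal_conv (T := T)
      (fun t => heatKernel_nonneg t 0) (measurable_heatKernel_left 0)
      (fun t ht => heatKernel_of_nonpos ht 0) hki i (h0' f)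
    refine comparison (T := T) (c := 0) (w := (Ioo 0 T).indicator fun t => f₁ (t, 0) - f₂ (t, 0)) hT
      le_rfl (i₁.sub i₂)
      ((hf₁.integrable_boundary.sub hf₂.integrable_boundary).integrable_indicator measurableSet_Ioo)
      (fun s hs => indicator_of_notMem hs _) ?_ ?_ ?_ ?_
    · filter_upwards [hk f₁ i₁, hk f₂ i₂, (ae_restrict_iff' measurableSet_Ioo).1 b₁,
        (ae_restrict_iff' measurableSet_Ioo).1 b₂] with t k₁ k₂ e₁ e₂ ht
      rw [indicator_of_mem ht, e₁ ht, e₂ ht]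
      simp only [mul_sub, fluxSolution]
      rw [integral_sub (k₁ ht) (k₂ ht)]
      ring
    all_goals
      intro t ht
      by_cases htT : t ∈ Ioo 0 T
      · rw [indicator_of_mem htT] at ht
        rw [h1 f₁ t htT, h1 f₂ t htT]
        first
          | exact sub_nonneg.2 (hg.monotone (by linarith))
          | exact sub_nonpos.2 (hg.monotone (by linarith))
          | rw [sub_eq_zero.1 ht, sub_self]
      · rw [h0 f₁ t htT, h0 f₂ t htT, sub_self]
  have heq : h v =ᵐ[volume] h u := by
    filter_upwards [key u v hu hv, key v u hv hu] with t ha hb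
    linarith
  obtain ⟨-, au, -⟩ := hu.ae_eq_fluxSolution hT hc (h0 u) (h1 u)
  obtain ⟨-, av, -⟩ := hv.ae_eq_fluxSolution hT hc (h0 v) (h1 v)
  have hflux : fluxSolution c (h v) = fluxSolution c (h u) := by
    funext z
    simp only [fluxSolution]
    congr 1
    refine integral_congr_ae ?_
    filter_upwards [heq] with s hs
    rw [hs]
  refine ⟨?_, ?_⟩
  · filter_upwards [au, av] with z hzu hzv
    rw [hzu, hzv, hflux]
  · rw [ae_restrict_iff' measurableSet_Ioo]
    filter_upwards [heq] with t ht htT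
    rw [h1 v t htT, h1 u t htT] at ht
    exact hg.injective ht

theorem IsDiracFluxSolution.unique {p ℓ : ℝ} (hp : 1 < p) (hℓ : 0 ≤ ℓ) {u v : ℝ × ℝ → ℝ}
    (hu : IsDiracFluxSolution p ℓ u) (hv : IsDiracFluxSolution p ℓ v) :
    (∀ᵐ z ∂(volume.restrict (Ioi (0 : ℝ) ×ˢ Ioi (0 : ℝ))), v z = u z) ∧
      ∀ᵐ t ∂(volume.restrict (Ioi (0 : ℝ))), v (t, 0) = u (t, 0) := by
  have key := fun n : ℕ => (hu (n + 1) n.cast_add_one_pos).unique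
    (strictMono_powerFlux (by linarith)) n.cast_add_one_pos hℓ
    (hv (n + 1) n.cast_add_one_pos)
  have e : Ioi (0 : ℝ) = ⋃ n : ℕ, Ioo (0 : ℝ) (n + 1) := by
    ext t
    simp only [mem_Ioi, mem_iUnion, mem_Ioo]
    refine ⟨fun h => ?_, fun ⟨n, h⟩ => h.1⟩
    obtain ⟨n, hn⟩ := exists_nat_gt t
    exact ⟨n, h, by linarith⟩
  have e' : Ioi (0 : ℝ) ×ˢ Ioi (0 : ℝ) = ⋃ n : ℕ, strip (n + 1) := by
    simp only [strip, ← iUnion_prod_const, ← e]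
  rw [e', ae_restrict_iUnion_iff, e, ae_restrict_iUnion_iff]
  exact ⟨fun n => (key n).1, fun n => (key n).2⟩

/-! ### From the boundary to the interior -/

namespace IsBoundarySolution

variable {p c c' : ℝ} {v v' : ℝ → ℝ}

theorem continuousOn_fluxSolution (hp1 : 1 < p) (hp2 : p < 2) (hv : IsBoundarySolution p c v) :
    ContinuousOn (fluxSolution c fun s => powerFlux p (v s)) (Ioi 0 ×ˢ univ) :=
  (continuousOn_const.mul continuousOn_heatKernel).sub
    (continuousOn_heatPotential (by linarith) (hv.continuousOn_flux hp1)
      (fun _ ht => hv.flux_of_nonpos ht) fun _ hs => hv.abs_flux_le hp1 hs)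

theorem fluxSolution_zero (hv : IsBoundarySolution p c v) (t : ℝ) :
    fluxSolution c (fun s => powerFlux p (v s)) (t, 0) = v t := (hv.eq t).symm

/-- Applying the Poisson kernel to the boundary equation moves every heat kernel in it from `0` to
`x`. Since the Poisson kernel is nonnegative, order and limits on the boundary carry over to the
interior. -/
theorem fluxSolution_eq_integral (hp1 : 1 < p) (hp2 : p < 2) (hv : IsBoundarySolution p c v) (t : ℝ)
    {x : ℝ} (hx : 0 < x) : (Integrable fun s => poissonKernel x (t - s) * v s) ∧
      fluxSolution c (fun s => powerFlux p (v s)) (t, x) = ∫ s, poissonKernel x (t - s) * v s := by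
  have h0 : ∀ t, Integrable (fun s => poissonKernel x (t - s) * heatKernel s 0) ∧
      ∫ s, poissonKernel x (t - s) * heatKernel s 0 = heatKernel t x := fun t => by
    have := poissonKernel_conv_heatKernel hx le_rfl t
    rwa [add_zero] at this
  obtain ⟨h1, h2⟩ := conv_assoc (poissonKernel_nonneg hx.le) (fun t => heatKernel_nonneg t 0)
    (measurable_poissonKernel_right x) (measurable_heatKernel_left 0) h0
    (hv.aestronglyMeasurable_flux hp1) (hv.integrable_heatKernel_mul_flux hp1 hp2 t x)
  have e : (fun s => poissonKernel x (t - s) * v s) = fun s =>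
      c * (poissonKernel x (t - s) * heatKernel s 0)
      - poissonKernel x (t - s) * ∫ r, heatKernel (s - r) 0 * powerFlux p (v r) := by
    funext s; rw [hv.eq s]; ring
  rw [e]
  refine ⟨((h0 t).1.const_mul c).sub h1, ?_⟩
  rw [integral_sub ((h0 t).1.const_mul c) h1, integral_const_mul, (h0 t).2, h2, fluxSolution]

theorem fluxSolution_mono (hp1 : 1 < p) (hp2 : p < 2) (hv : IsBoundarySolution p c v)
    (hv' : IsBoundarySolution p c' v') (hc : c ≤ c') (t : ℝ) {x : ℝ} (hx : 0 ≤ x) :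
    fluxSolution c (fun s => powerFlux p (v s)) (t, x) ≤
      fluxSolution c' (fun s => powerFlux p (v' s)) (t, x) := by
  rcases hx.eq_or_lt with rfl | hx
  · rw [hv.fluxSolution_zero, hv'.fluxSolution_zero]
    exact hv.mono hp1 hp2 hv' hc t
  · obtain ⟨h1, e1⟩ := hv.fluxSolution_eq_integral hp1 hp2 t hx
    obtain ⟨h2, e2⟩ := hv'.fluxSolution_eq_integral hp1 hp2 t hx
    rw [e1, e2]
    exact integral_mono h1 h2 fun s =>
      mul_le_mul_of_nonneg_left (hv.mono hp1 hp2 hv' hc s) (poissonKernel_nonneg hx.le _)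

theorem isDiracFluxSolution (hp1 : 1 < p) (hp2 : p < 2) (hv : IsBoundarySolution p c v) :
    IsDiracFluxSolution p c (fluxSolution c fun s => powerFlux p (v s)) := fun T hT => by
  refine isWeakSolution_of_fluxSolution (h := (Ioo 0 T).indicator fun s => powerFlux p (v s)) hT
    hv.const_nonneg ((hv.integrableOn_flux hp1 hp2 T).integrable_indicator measurableSet_Ioo)
    (fun t ht => indicator_of_notMem ht _) (fun t ht => ?_) fun t ht x _ => ?_
  · rw [indicator_of_mem ht, hv.fluxSolution_zero]
  · simp only [fluxSolution]
    rw [integral_indicator_Ioo (fun _ hs => hv.flux_of_nonpos hs) ht.2]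

end IsBoundarySolution

/-! ### Self-similarity and conservation of mass -/

namespace IsBoundarySolution

variable {p c c' : ℝ} {v v' : ℝ → ℝ}

/-- Self-similarity reduces the values at all times to those at time `1`. -/
theorem eq_rpow_mul_one (hp1 : 1 < p) (hp2 : p < 2) (hv : IsBoundarySolution p c v) {t : ℝ}
    (ht : 0 < t) (hv' : IsBoundarySolution p (t ^ (1 / (2 * (p - 1)) - 1 / 2) * c) v') :
    v t = t ^ (-(1 / (2 * (p - 1)))) * v' 1 := by
  have hp0 : p - 1 ≠ 0 := by linarith
  -- Scaling by `√t` moves time `t` to time `1`; uniqueness identifies the rescaled function with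
  -- `v'`.
  have hs := hv.scale hp1 (Real.sqrt_pos.2 ht)
  have e : ∀ r : ℝ, √t ^ r = t ^ (r / 2) := fun r => by
    rw [Real.sqrt_eq_rpow, ← Real.rpow_mul ht.le]; congr 1; ring
  simp only [e, Real.sq_sqrt ht.le] at hs
  have e1 : (1 / (p - 1) - 1) / 2 = 1 / (2 * (p - 1)) - 1 / 2 := by field_simp
  have e2 : 1 / (p - 1) / 2 = 1 / (2 * (p - 1)) := by field_simp
  rw [e1, e2] at hs
  have := congrFun (hs.unique hp1 hp2 hv') 1
  rw [mul_one] at this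
  rw [← this, ← mul_assoc, ← Real.rpow_add ht]
  simp

/-- With `m = 1/(2(p-1))`, the quantity `t^m v(t)` is the value at time `1` for the mass `t^(m-1/2)
c`. Since `m ≥ 1/2` this mass grows with `t`, and values at time `1` are monotone in the mass. -/
theorem rpow_mul_le (hp1 : 1 < p) (hp2 : p < 2) (hv : IsBoundarySolution p c v) {s t : ℝ}
    (hs : 0 < s) (hst : s ≤ t) :
    s ^ (1 / (2 * (p - 1))) * v s ≤ t ^ (1 / (2 * (p - 1))) * v t := by
  have ht : 0 < t := hs.trans_le hst
  have hm : 0 ≤ 1 / (2 * (p - 1)) - 1 / 2 := by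
    have : 1 / 2 ≤ 1 / (2 * (p - 1)) := one_div_le_one_div_of_le (by linarith) (by linarith)
    linarith
  have hc := hv.const_nonneg
  obtain ⟨v₁, h₁⟩ := exists_isBoundarySolution hp1 hp2
    (show 0 ≤ s ^ (1 / (2 * (p - 1)) - 1 / 2) * c by positivity)
  obtain ⟨v₂, h₂⟩ := exists_isBoundarySolution hp1 hp2
    (show 0 ≤ t ^ (1 / (2 * (p - 1)) - 1 / 2) * c by positivity)
  rw [hv.eq_rpow_mul_one hp1 hp2 hs h₁, hv.eq_rpow_mul_one hp1 hp2 ht h₂, ← mul_assoc, ← mul_assoc,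
    ← Real.rpow_add hs, ← Real.rpow_add ht]
  simp only [add_neg_cancel, Real.rpow_zero, one_mul]
  exact h₁.mono hp1 hp2 h₂ (mul_le_mul_of_nonneg_right (Real.rpow_le_rpow hs.le hst hm) hc) 1

/-- A zero at time `t` forces `v = 0` on all earlier times by `rpow_mul_le`. The integral term then
vanishes and the equation at `t` contradicts `c k(t) > 0`. -/
theorem pos (hp1 : 1 < p) (hp2 : p < 2) (hv : IsBoundarySolution p c v) (hc : 0 < c) {t : ℝ}
    (ht : 0 < t) : 0 < v t := by
  refine (hv.nonneg t).lt_of_ne' fun h => ?_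
  have h0 : ∀ s ≤ t, v s = 0 := fun s hst => by
    rcases le_or_gt s 0 with hs | hs
    · exact hv.of_nonpos hs
    · have := hv.rpow_mul_le hp1 hp2 hs hst
      rw [h, mul_zero] at this
      exact le_antisymm (nonpos_of_mul_nonpos_right this (by positivity)) (hv.nonneg s)
  have h1 : ∫ s, heatKernel (t - s) 0 * powerFlux p (v s) = 0 := by
    refine Eq.trans (integral_congr_ae (.of_forall fun s => ?_)) (integral_zero ℝ ℝ)
    rcases le_or_gt s t with hs | hs
    · simp only [h0 s hs, powerFlux_zero, mul_zero]
    · simp only [heatKernel_of_nonpos (show t - s ≤ 0 by linarith), zero_mul]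
  have h2 := hv.eq t
  rw [h1, h, sub_zero] at h2
  exact (mul_pos hc (heatKernel_pos ht 0)).ne h2

theorem integrable_heatKernel_mul (hv : IsBoundarySolution p c v) (t x : ℝ) :
    Integrable fun s => heatKernel (t - s) x * v s :=
  HalfLineHeat.integrable_heatKernel_mul (b := 1 / 2) (C := c * (√Real.pi)⁻¹) (by norm_num)
    hv.aestronglyMeasurable (fun _ ht => hv.of_nonpos ht)
    (fun s hs => by rw [abs_of_nonneg (hv.nonneg s)]; exact hv.le_rpow hs) x

/-- Conservation of mass, in integrated form. -/
theorem integral_heatKernel_mul (hp1 : 1 < p) (hp2 : p < 2) (hv : IsBoundarySolution p c v) {t : ℝ}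
    (ht : 0 < t) : ∫ s, heatKernel (t - s) 0 * v s = c - ∫ s in 0..t, powerFlux p (v s) := by
  have e : (fun s => (Ioi (0 : ℝ)).indicator 1 (t - s) * powerFlux p (v s))
      = (Ioo 0 t).indicator fun s => powerFlux p (v s) := by
    funext s
    by_cases hs : s ∈ Ioo 0 t
    · rw [indicator_of_mem hs, indicator_of_mem (show t - s ∈ Ioi (0 : ℝ) from sub_pos.2 hs.2),
        Pi.one_apply, one_mul]
    · rw [indicator_of_notMem hs]
      rcases le_or_gt s 0 with h | h
      · rw [hv.flux_of_nonpos h, mul_zero]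
      · rw [indicator_of_notMem fun h' => hs ⟨h, sub_pos.1 (mem_Ioi.1 h')⟩, zero_mul]
  -- Because `k * k` is the indicator of `(0,∞)`, the double convolution of the flux is its
  -- primitive.
  obtain ⟨h1, h2⟩ := conv_assoc (fun t => heatKernel_nonneg t 0) (fun t => heatKernel_nonneg t 0)
    (measurable_heatKernel_left 0) (measurable_heatKernel_left 0) heatKernel_conv_heatKernel
    (hv.aestronglyMeasurable_flux hp1) (t := t)
    (by rw [e]; exact (hv.integrableOn_flux hp1 hp2 t).integrable_indicator measurableSet_Ioo)
  rw [e, integral_indicator measurableSet_Ioo] at h2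
  have hk := heatKernel_conv_heatKernel t
  have e2 : (fun s => heatKernel (t - s) 0 * v s) = fun s =>
      c * (heatKernel (t - s) 0 * heatKernel s 0)
      - heatKernel (t - s) 0 * ∫ r, heatKernel (s - r) 0 * powerFlux p (v r) := by
    funext s; rw [hv.eq s]; ring
  rw [e2, integral_sub (hk.1.const_mul c) h1, integral_const_mul, hk.2, h2,
    indicator_of_mem (mem_Ioi.2 ht), intervalIntegral.integral_of_le ht.le,
        integral_Ioc_eq_integral_Ioo]
  simp

theorem intervalIntegrable_flux (hp1 : 1 < p) (hp2 : p < 2) (hv : IsBoundarySolution p c v) {t : ℝ}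
    (ht : 0 ≤ t) : IntervalIntegrable (fun s => powerFlux p (v s)) volume 0 t := by
  rw [intervalIntegrable_iff_integrableOn_Ioo_of_le ht]
  exact hv.integrableOn_flux hp1 hp2 t

theorem integral_flux (hp1 : 1 < p) (hp2 : p < 2) (hv : IsBoundarySolution p c v) :
    ∫ s in (1 : ℝ)..2, powerFlux p (v s)
      = (∫ s, heatKernel (1 - s) 0 * v s) - ∫ s, heatKernel (2 - s) 0 * v s := by
  rw [hv.integral_heatKernel_mul hp1 hp2 one_pos, hv.integral_heatKernel_mul hp1 hp2 two_pos,
    ← intervalIntegral.integral_interval_sub_left (hv.intervalIntegrable_flux hp1 hp2 zero_le_two)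
      (hv.intervalIntegrable_flux hp1 hp2 zero_le_one)]
  ring

end IsBoundarySolution

/-! ### The threshold `p = 3/2`: boundedness of the values at time `1` -/

/-- The half-order integral of a power. -/
theorem heatKernel_conv_rpow {m t : ℝ} (hm : m < 1) (ht : 0 < t) :
    IntegrableOn (fun s => heatKernel (t - s) 0 * s ^ (-m)) (Ioo 0 t) ∧
      ∫ s in Ioo 0 t, heatKernel (t - s) 0 * s ^ (-m)
        = (√Real.pi)⁻¹ * ProbabilityTheory.beta (1 - m) (1 / 2) * t ^ (1 / 2 - m) := by
  obtain ⟨h1, h2⟩ := integrableOn_beta_scaled (a := 1 - m) (b :=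
      1 / 2) (by linarith) (by norm_num) ht
  have e : EqOn (fun s => (√Real.pi)⁻¹ * (s ^ (1 - m - 1) * (t - s) ^ ((1 / 2 : ℝ) - 1)))
      (fun s => heatKernel (t - s) 0 * s ^ (-m)) (Ioo 0 t) := fun s hs => by
    simp only
    rw [heatKernel_at_zero_rpow (sub_nonneg.2 hs.2.le), show (1 / 2 : ℝ) - 1 = -(1 / 2) by norm_num,
      show 1 - m - 1 = -m by ring]
    ring
  refine ⟨(IntegrableOn.congr_fun (h1.const_mul _) e measurableSet_Ioo), ?_⟩
  rw [← setIntegral_congr_fun measurableSet_Ioo e, integral_const_mul, h2,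
    show 1 - m + 1 / 2 - 1 = 1 / 2 - m by ring]
  ring

theorem integral_heatKernel_mul_eq {v : ℝ → ℝ} (h0 : ∀ s ≤ 0, v s = 0) (t : ℝ) :
    ∫ s, heatKernel (t - s) 0 * v s = ∫ s in Ioo 0 t, heatKernel (t - s) 0 * v s :=
  (integral_causal (fun s hs => by rw [h0 s hs, mul_zero])
    fun s hs => by rw [heatKernel_of_nonpos (by linarith), zero_mul]).2

namespace IsBoundarySolution

variable {p c c' : ℝ} {v v' : ℝ → ℝ}

theorem le_of_le_at_one (hp1 : 1 < p) (hp2 : p < 2) {B : ℝ}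
    (hB : ∀ c v, IsBoundarySolution p c v → v 1 ≤ B) (hv : IsBoundarySolution p c v) {t : ℝ}
    (ht : 0 < t) : v t ≤ B * t ^ (-(1 / (2 * (p - 1)))) := by
  have hc := hv.const_nonneg
  obtain ⟨v₁, h₁⟩ := exists_isBoundarySolution hp1 hp2
    (show 0 ≤ t ^ (1 / (2 * (p - 1)) - 1 / 2) * c by positivity)
  rw [hv.eq_rpow_mul_one hp1 hp2 ht h₁, mul_comm]
  exact mul_le_mul_of_nonneg_right (hB _ _ h₁) (by positivity)

/-- Balance of mass on `[1,2]`. With `y = v 1`, monotonicity of `s^m v(s)` gives `v ≥ 2^(-m) y`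
there, so the outflow is at least `(2^(-m) y)^p`. It also gives `v(s) ≤ y s^(-m)` on `(0,1)`, so `(k
* v)(1) ≤ B y`, where `B` is finite because `m < 1`. Hence `y^(p-1) ≤ 2^(m p) B`, independently of
`c`. -/
theorem exists_le_at_one (hp : 3 / 2 < p) (hp2 : p < 2) :
    ∃ B, ∀ c v, IsBoundarySolution p c v → v 1 ≤ B := by
  have hp1 : 1 < p := by linarith
  have hm1 : 1 / (2 * (p - 1)) < 1 := by rw [div_lt_one (by linarith)]; linarith
  set m := 1 / (2 * (p - 1)) with hm
  set B := (√Real.pi)⁻¹ * ProbabilityTheory.beta (1 - m) (1 / 2) with hB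
  have hB0 : 0 ≤ B := by
    have := ProbabilityTheory.beta_pos (α := 1 - m) (β := 1 / 2) (by linarith) (by norm_num)
    positivity
  have hm0 : 0 ≤ m := by rw [hm]; have : 0 < p - 1 := by linarith
                         positivity
  refine ⟨(2 ^ (m * p) * B) ^ (p - 1)⁻¹, fun c v hv => ?_⟩
  set y := v 1 with hy
  have hy0 : 0 ≤ y := hv.nonneg 1
  rcases hy0.eq_or_lt with h0 | h0
  · rw [← h0]; positivity
  have hlow : (2 ^ (-m) * y) ^ p ≤ ∫ s in (1 : ℝ)..2, powerFlux p (v s) := by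
    have hi : IntervalIntegrable (fun s => powerFlux p (v s)) volume 1 2 :=
      (hv.intervalIntegrable_flux hp1 hp2 zero_le_two).mono_set (by
        rw [uIcc_of_le one_le_two, uIcc_of_le zero_le_two]; exact Icc_subset_Icc_left zero_le_one)
    have := intervalIntegral.integral_mono_on (f := fun _ => (2 ^ (-m) * y) ^ p) one_le_two
      intervalIntegrable_const hi fun s hs => by
        rw [hv.flux_eq hp1]
        refine Real.rpow_le_rpow (by positivity) ?_ (by linarith)
        have h1 := hv.rpow_mul_le hp1 hp2 one_pos hs.1
        rw [Real.one_rpow, one_mul] at h1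
        rw [Real.rpow_neg zero_le_two, inv_mul_le_iff₀ (by positivity)]
        exact h1.trans (mul_le_mul_of_nonneg_right
          (Real.rpow_le_rpow (by linarith [hs.1]) hs.2 hm0) (hv.nonneg s))
    refine Eq.trans_le ?_ this
    rw [intervalIntegral.integral_const]; norm_num
  have hup : ∫ s in (1 : ℝ)..2, powerFlux p (v s) ≤ B * y := by
    rw [hv.integral_flux hp1 hp2]
    have h2 : 0 ≤ ∫ s, heatKernel (2 - s) 0 * v s :=
      integral_nonneg fun s => mul_nonneg (heatKernel_nonneg _ _) (hv.nonneg s)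
    obtain ⟨i1, e1⟩ := heatKernel_conv_rpow hm1 one_pos
    have h3 : ∫ s, heatKernel (1 - s) 0 * v s ≤ B * y := by
      rw [integral_heatKernel_mul_eq fun s hs => hv.of_nonpos hs]
      rw [Real.one_rpow, mul_one] at e1
      rw [hB, ← e1, ← integral_mul_const]
      refine setIntegral_mono_on (hv.integrable_heatKernel_mul 1 0).integrableOn (i1.mul_const _)
        measurableSet_Ioo fun s hs => ?_
      have h4 := hv.rpow_mul_le hp1 hp2 hs.1 hs.2.le
      rw [Real.one_rpow, one_mul] at h4
      rw [mul_assoc]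
      refine mul_le_mul_of_nonneg_left ?_ (heatKernel_nonneg _ _)
      rwa [Real.rpow_neg hs.1.le, le_inv_mul_iff₀ (Real.rpow_pos_of_pos hs.1 _)]
    linarith
  have h := hlow.trans hup
  rw [Real.mul_rpow (by positivity) hy0, ← Real.rpow_mul zero_le_two, neg_mul,
    Real.rpow_neg zero_le_two, inv_mul_le_iff₀ (by positivity)] at h
  rw [Real.le_rpow_inv_iff_of_pos hy0 (by positivity) (by linarith), Real.rpow_sub h0,
      Real.rpow_one,
    div_le_iff₀ h0]
  linarith

/-- Since `2 - s ≥ 2 (1 - s)`, the kernel at `2 - s` is at most `2^(-1/2)` times the one at `1 - s`.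
This makes the balance between times `1` and `2` control `∫₀¹ v` from above. -/
theorem heatKernel_sub_ge {s : ℝ} (hs : s ∈ Ioo (0 : ℝ) 1) :
    (1 - 2 ^ (-(1 / 2) : ℝ)) * heatKernel 1 0 ≤ heatKernel (1 - s) 0 - heatKernel (2 - s) 0 := by
  have h1 : 0 < 1 - s := sub_pos.2 hs.2
  have h2 : heatKernel (2 * (1 - s)) 0 = 2 ^ (-(1 / 2) : ℝ) * heatKernel (1 - s) 0 := by
    rw [heatKernel_at_zero_rpow (by linarith), heatKernel_at_zero_rpow h1.le,
      Real.mul_rpow zero_le_two h1.le]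
    ring
  have h3 := heatKernel_antitone (show 0 < 2 * (1 - s) by linarith)
    (show 2 * (1 - s) ≤ 2 - s by linarith [hs.1])
  have h4 := heatKernel_antitone h1 (show 1 - s ≤ 1 by linarith [hs.1])
  have h5 : (2 : ℝ) ^ (-(1 / 2) : ℝ) ≤ 1 :=
    Real.rpow_le_one_of_one_le_of_nonpos one_le_two (by norm_num)
  have h6 := mul_le_mul_of_nonneg_left h4 (sub_nonneg.2 h5)
  linarith

/-- A bound `B` at time `1` gives `v ≤ B` on `[1,2]`, so the balance of mass bounds `∫₀¹ v`
uniformly in `c`. But `m ≥ 1`, and for large `c` self-similarity yields `v(s) ≥ v₁(1) s^(-m) ≥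
v₁(1)/s` on `(a,1)`, where `v₁` has mass one. The integral is then at least `v₁(1) log(1/a)`, which
is unbounded as `a → 0`. -/
theorem not_exists_le_at_one (hp1 : 1 < p) (hp : p ≤ 3 / 2) :
    ¬ ∃ B, ∀ c v, IsBoundarySolution p c v → v 1 ≤ B := by
  rintro ⟨B, hB⟩
  have hp2 : p < 2 := by linarith
  have hm1 : 1 ≤ 1 / (2 * (p - 1)) := by rw [le_div_iff₀ (by linarith)]; linarith
  set m := 1 / (2 * (p - 1)) with hm
  have h2 : (2 : ℝ) ^ (-(1 / 2) : ℝ) < 1 :=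
    Real.rpow_lt_one_of_one_lt_of_neg one_lt_two (by norm_num)
  set θ := (1 - 2 ^ (-(1 / 2) : ℝ)) * heatKernel 1 0 with hθ
  have hθ0 : 0 < θ := mul_pos (sub_pos.2 h2) (heatKernel_pos one_pos 0)
  set D := ∫ s in Ico (1 : ℝ) 2, heatKernel (2 - s) 0 with hD
  have hDi : IntegrableOn (fun s => heatKernel (2 - s) 0) (Ico (1 : ℝ) 2) := by
    have := (heatKernel_conv_rpow (m := 0) one_pos two_pos).1
    simp only [neg_zero, Real.rpow_zero, mul_one] at this
    rw [integrableOn_Ico_iff_integrableOn_Ioo]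
    exact this.mono_set (Ioo_subset_Ioo_left zero_le_one)
  have key : ∀ c v, IsBoundarySolution p c v → θ * (∫ s in Ioo (0 : ℝ) 1, v s) ≤ B ^ p + B * D := by
    intro c v hv
    have hB0 : 0 ≤ B := (hv.nonneg 1).trans (hB c v hv)
    have hvB : ∀ s, 1 ≤ s → v s ≤ B := fun s hs =>
      (hv.le_of_le_at_one hp1 hp2 hB (by linarith)).trans
        (mul_le_of_le_one_right hB0 (Real.rpow_le_one_of_one_le_of_nonpos hs (by linarith)))
    have i1 := hv.integrable_heatKernel_mul 1 0
    have i2 := hv.integrable_heatKernel_mul 2 0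
    have hflux : ∫ s in (1 : ℝ)..2, powerFlux p (v s) ≤ B ^ p := by
      have hi : IntervalIntegrable (fun s => powerFlux p (v s)) volume 1 2 :=
        (hv.intervalIntegrable_flux hp1 hp2 zero_le_two).mono_set (by
          rw [uIcc_of_le one_le_two, uIcc_of_le zero_le_two]; exact Icc_subset_Icc_left zero_le_one)
      have := intervalIntegral.integral_mono_on (g := fun _ => B ^ p) one_le_two hi
        intervalIntegrable_const fun s hs => by
          rw [hv.flux_eq hp1]
          exact Real.rpow_le_rpow (hv.nonneg s) (hvB s hs.1) (by linarith)
      refine this.trans_eq ?_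
      rw [intervalIntegral.integral_const]; norm_num
    have iv : IntegrableOn (fun s => θ * v s) (Ioo 0 1) := (hv.integrableOn 1).const_mul θ
    have iD : IntegrableOn (fun s => B * heatKernel (2 - s) 0) (Ico 1 2) := hDi.const_mul B
    have i12 : Integrable fun s => heatKernel (1 - s) 0 * v s - heatKernel (2 - s) 0 * v s :=
      i1.sub i2
    -- On `[1,2)` only the kernel with pole at time `2` survives, with a negative sign; the second
    -- indicator compensates for it using `v ≤ B`.
    have hmono : ∫ s, (Ioo (0 : ℝ) 1).indicator (fun s => θ * v s) s ≤
        ∫ s, ((heatKernel (1 - s) 0 * v s - heatKernel (2 - s) 0 * v s)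
          + (Ico (1 : ℝ) 2).indicator (fun s => B * heatKernel (2 - s) 0) s) := by
      refine integral_mono (iv.integrable_indicator measurableSet_Ioo)
        (i12.add (iD.integrable_indicator measurableSet_Ico)) fun s => ?_
      simp only
      rcases le_or_gt s 0 with h | h
      · rw [hv.of_nonpos h, indicator_of_notMem (fun h' => absurd h'.1 (not_lt.2 h)),
          indicator_of_notMem (fun h' => absurd h'.1 (by linarith))]
        simp
      rcases lt_or_ge s 1 with h1 | h1
      · rw [indicator_of_mem (show s ∈ Ioo 0 1 from ⟨h, h1⟩),
            indicator_of_notMem (fun h' => absurd h'.1 (by linarith)),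
          add_zero, ← sub_mul]
        exact mul_le_mul_of_nonneg_right (heatKernel_sub_ge ⟨h, h1⟩) (hv.nonneg s)
      rw [indicator_of_notMem (fun h' => absurd h'.2 (by linarith)),
        heatKernel_of_nonpos (show 1 - s ≤ 0 by linarith)]
      rcases lt_or_ge s 2 with h3 | h3
      · rw [indicator_of_mem (show s ∈ Ico 1 2 from ⟨h1, h3⟩)]
        have := mul_le_mul_of_nonneg_left (hvB s h1) (heatKernel_nonneg (2 - s) 0)
        linarith
      · rw [indicator_of_notMem (fun h' => absurd h'.2 (by linarith)),
          heatKernel_of_nonpos (show 2 - s ≤ 0 by linarith)]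
        simp
    rw [integral_indicator measurableSet_Ioo, integral_const_mul,
      integral_add i12 (iD.integrable_indicator measurableSet_Ico),
      integral_sub i1 i2, integral_indicator measurableSet_Ico, integral_const_mul,
      ← hv.integral_flux hp1 hp2] at hmono
    linarith
  obtain ⟨v₁, h₁⟩ := exists_isBoundarySolution hp1 hp2 zero_le_one
  have hF := h₁.pos hp1 hp2 one_pos one_pos
  have hlog : ∀ N : ℝ, 0 ≤ N → θ * (v₁ 1 * N) ≤ B ^ p + B * D := fun N hN => by
    set a := Real.exp (-N) with ha
    have ha0 : 0 < a := Real.exp_pos _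
    have ha1 : a ≤ 1 := Real.exp_le_one_iff.2 (by linarith)
    -- With this mass the rescaled mass `s^(m-1/2) c` is at least one for every `s` in `(a,1)`.
    obtain ⟨v, hv⟩ := exists_isBoundarySolution hp1 hp2
      (show 0 ≤ a ^ (-(m - 1 / 2)) by positivity)
    refine le_trans (mul_le_mul_of_nonneg_left ?_ hθ0.le) (key _ v hv)
    have hinv : ∫ s in Ioo a 1, s⁻¹ = N := by
      rw [← integral_Ioc_eq_integral_Ioo, ← intervalIntegral.integral_of_le ha1,
        integral_inv_of_pos ha0 one_pos, one_div, Real.log_inv, ha, Real.log_exp, neg_neg]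
    have hinvi : IntegrableOn (fun s : ℝ => s⁻¹) (Ioo a 1) := by
      rw [← intervalIntegrable_iff_integrableOn_Ioo_of_le ha1]
      exact intervalIntegral.intervalIntegrable_inv (fun s hs => by
        rw [uIcc_of_le ha1] at hs; exact (ha0.trans_le hs.1).ne') continuousOn_id
    calc v₁ 1 * N = ∫ s in Ioo a 1, v₁ 1 * s⁻¹ := by rw [integral_const_mul, hinv]
      _ ≤ ∫ s in Ioo a 1, v s := by
        refine setIntegral_mono_on (hinvi.const_mul _)
          ((hv.integrableOn 1).mono_set (Ioo_subset_Ioo_left ha0.le)) measurableSet_Ioo fun s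
              hs => ?_
        have hs0 : 0 < s := ha0.trans hs.1
        obtain ⟨v', h'⟩ := exists_isBoundarySolution hp1 hp2
          (show 0 ≤ s ^ (m - 1 / 2) * a ^ (-(m - 1 / 2)) by positivity)
        have h1 : 1 ≤ s ^ (m - 1 / 2) * a ^ (-(m - 1 / 2)) := by
          rw [Real.rpow_neg ha0.le, ← div_eq_mul_inv, le_div_iff₀ (by positivity), one_mul]
          exact Real.rpow_le_rpow ha0.le hs.1.le (by linarith)
        rw [hv.eq_rpow_mul_one hp1 hp2 hs0 h', mul_comm]
        refine mul_le_mul ?_ (h₁.mono hp1 hp2 h' h1 1) (h₁.nonneg 1) (by positivity)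
        rw [← Real.rpow_neg_one]
        exact Real.rpow_le_rpow_of_exponent_ge hs0 hs.2.le (by linarith)
      _ ≤ ∫ s in Ioo 0 1, v s :=
        setIntegral_mono_set (hv.integrableOn 1) (.of_forall fun s => hv.nonneg s)
          (Ioo_subset_Ioo_left ha0.le).eventuallyLE
  have hc := hlog ((|B ^ p + B * D| + 1) / (θ * v₁ 1)) (by positivity)
  have e : θ * (v₁ 1 * ((|B ^ p + B * D| + 1) / (θ * v₁ 1))) = |B ^ p + B * D| + 1 := by
    field_simp
  rw [e] at hc
  linarith [le_abs_self (B ^ p + B * D)]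

end IsBoundarySolution

/-! ### The monotone family of solutions and its limit -/

/-- The solutions of the boundary equation with Dirac flux `c⁺ δ₀`. -/
def IsBoundaryFamily (p : ℝ) (V : ℝ → ℝ → ℝ) : Prop :=
  ∀ c, IsBoundarySolution p (max c 0) (V c)

/-- The solution of the boundary value problem with Dirac flux `c⁺ δ₀`. -/
noncomputable def familySolution (p : ℝ) (V : ℝ → ℝ → ℝ) (c : ℝ) : ℝ × ℝ → ℝ :=
  fluxSolution (max c 0) fun s => powerFlux p (V c s)

theorem exists_isBoundaryFamily {p : ℝ} (hp1 : 1 < p) (hp2 : p < 2) :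
    ∃ V, IsBoundaryFamily p V := by
  choose V hV using fun c : ℝ => exists_isBoundarySolution hp1 hp2 (le_max_right c 0)
  exact ⟨V, hV⟩

namespace IsBoundaryFamily

variable {p : ℝ} {V : ℝ → ℝ → ℝ}

/-- The positive part in the mass makes the family monotone over all real `c`, so limits at infinity
are suprema without restriction on `c`. -/
theorem mono (hV : IsBoundaryFamily p V) (hp1 : 1 < p) (hp2 : p < 2) (t : ℝ) :
    Monotone fun c => V c t := fun c c' h =>
  (hV c).mono hp1 hp2 (hV c') (max_le_max_right 0 h) t

theorem eq_rpow_mul_one (hV : IsBoundaryFamily p V) (hp1 : 1 < p) (hp2 : p < 2) (c : ℝ) {t : ℝ}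
    (ht : 0 < t) :
    V c t = t ^ (-(1 / (2 * (p - 1)))) * V (t ^ (1 / (2 * (p - 1)) - 1 / 2) * c) 1 := by
  refine (hV c).eq_rpow_mul_one hp1 hp2 ht ?_
  have := hV (t ^ (1 / (2 * (p - 1)) - 1 / 2) * c)
  rwa [mul_max_of_nonneg _ _ (by positivity), mul_zero]

theorem apply_mono (hV : IsBoundaryFamily p V) (hp1 : 1 < p) (hp2 : p < 2) (t : ℝ) {x : ℝ}
    (hx : 0 ≤ x) : Monotone fun c => familySolution p V c (t, x) := fun c c' h =>
  (hV c).fluxSolution_mono hp1 hp2 (hV c') (max_le_max_right 0 h) t hx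

theorem apply_zero (hV : IsBoundaryFamily p V) (c t : ℝ) :
    familySolution p V c (t, 0) = V c t := (hV c).fluxSolution_zero t

theorem continuousOn (hV : IsBoundaryFamily p V) (hp1 : 1 < p) (hp2 : p < 2) (c : ℝ) :
    ContinuousOn (familySolution p V c) (Ioi 0 ×ˢ Ici 0) :=
  ((hV c).continuousOn_fluxSolution hp1 hp2).mono (prod_mono_right (subset_univ _))

theorem tendsto_atTop_boundary (hV : IsBoundaryFamily p V) (hp1 : 1 < p) (hp : p ≤ 3 / 2) {t : ℝ}
    (ht : 0 < t) : Tendsto (fun c => V c t) atTop atTop := by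
  have hp2 : p < 2 := by linarith
  have h1 : Tendsto (fun c => V c 1) atTop atTop := by
    refine tendsto_atTop_atTop_of_monotone (hV.mono hp1 hp2 1) fun M => ?_
    by_contra! h
    refine IsBoundarySolution.not_exists_le_at_one hp1 hp ⟨M, fun c v hv => ?_⟩
    exact (hv.mono hp1 hp2 (hV c) (le_max_left c 0) 1).trans (h c).le
  have h2 : Tendsto (fun c => V (t ^ (1 / (2 * (p - 1)) - 1 / 2) * c) 1) atTop atTop :=
    h1.comp (tendsto_id.const_mul_atTop (by positivity))
  simp only [fun c => hV.eq_rpow_mul_one hp1 hp2 c ht]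
  exact h2.const_mul_atTop (by positivity)

/-- On `(t/2,t)` the monotonicity of `s^m v(s)` bounds `V c s` below by a constant times `V c
(t/2)`, while `V 1 s` is at most the kernel at `t/2`. Hence `V c ≥ R c * V 1` there, and the Poisson
integral is at least `R c * J` with `J > 0` independent of `c`. -/
theorem tendsto_atTop (hV : IsBoundaryFamily p V) (hp1 : 1 < p) (hp : p ≤ 3 / 2) {t x : ℝ}
    (ht : 0 < t) (hx : 0 ≤ x) : Tendsto (fun c => familySolution p V c (t, x)) atTop atTop := by
  have hp2 : p < 2 := by linarith
  rcases hx.eq_or_lt with rfl | hx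
  · simp only [hV.apply_zero]
    exact hV.tendsto_atTop_boundary hp1 hp ht
  have hm0 : 0 ≤ 1 / (2 * (p - 1)) := by
    have : 0 < p - 1 := by linarith
    positivity
  have ht2 : 0 < t / 2 := half_pos ht
  obtain ⟨i1, -⟩ := (hV 1).fluxSolution_eq_integral hp1 hp2 t hx
  set J := ∫ s in Ioo (t / 2) t, poissonKernel x (t - s) * V 1 s with hJ
  have hJ0 : 0 < J := by
    rw [hJ, ← integral_Ioc_eq_integral_Ioo, ← intervalIntegral.integral_of_le (by linarith)]
    refine intervalIntegral.intervalIntegral_pos_of_pos_on i1.intervalIntegrable (fun s hs => ?_)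
      (by linarith)
    exact mul_pos (poissonKernel_pos hx (sub_pos.2 hs.2))
      ((hV 1).pos hp1 hp2 (by simp) (ht2.trans hs.1))
  set R : ℝ → ℝ := fun c => (2 ^ (1 / (2 * (p - 1))) * heatKernel (t / 2) 0)⁻¹ * V c (t / 2) with hR
  have hk0 := heatKernel_pos ht2 0
  have hRlim : Tendsto (fun c => R c * J) atTop atTop :=
    ((hV.tendsto_atTop_boundary hp1 hp ht2).const_mul_atTop (by positivity)).atTop_mul_const hJ0
  refine tendsto_atTop_mono (fun c => ?_) hRlim
  obtain ⟨ic, ec⟩ := (hV c).fluxSolution_eq_integral hp1 hp2 t hx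
  have hnn : ∀ s, 0 ≤ poissonKernel x (t - s) * V c s := fun s =>
    mul_nonneg (poissonKernel_nonneg hx.le _) ((hV c).nonneg s)
  rw [familySolution, ec]
  refine le_trans ?_ (setIntegral_le_integral (s := Ioo (t / 2) t) ic (.of_forall hnn))
  rw [hJ, ← integral_const_mul]
  refine setIntegral_mono_on (i1.integrableOn.const_mul _) ic.integrableOn measurableSet_Ioo
    fun s hs => ?_
  have hs0 : 0 < s := ht2.trans hs.1
  rw [mul_left_comm]
  refine mul_le_mul_of_nonneg_left ?_ (poissonKernel_nonneg hx.le _)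
  have h1 := (hV c).rpow_mul_le hp1 hp2 ht2 hs.1.le
  have h2 : s ^ (1 / (2 * (p - 1))) ≤ (2 * (t / 2)) ^ (1 / (2 * (p - 1))) :=
    Real.rpow_le_rpow hs0.le (by linarith [hs.2]) hm0
  rw [Real.mul_rpow zero_le_two ht2.le] at h2
  have h3 : V c (t / 2) ≤ 2 ^ (1 / (2 * (p - 1))) * V c s := by
    have := h1.trans (mul_le_mul_of_nonneg_right h2 ((hV c).nonneg s))
    rw [mul_comm (2 ^ _), mul_assoc] at this
    exact le_of_mul_le_mul_left this (by positivity)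
  have h4 : V 1 s ≤ heatKernel (t / 2) 0 := by
    have := (hV 1).le s
    rw [max_eq_left zero_le_one, one_mul] at this
    exact this.trans (heatKernel_antitone ht2 hs.1.le)
  rw [hR]
  simp only
  rw [mul_assoc, inv_mul_le_iff₀ (by positivity), mul_comm]
  calc V 1 s * V c (t / 2) ≤ heatKernel (t / 2) 0 * (2 ^ (1 / (2 * (p - 1))) * V c s) :=
        mul_le_mul h4 h3 ((hV c).nonneg _) hk0.le
    _ = _ := by ring

/-- A Dini argument for divergence to infinity: near each point some single `c` exceeds `M` by
continuity, monotonicity keeps this for larger `c`, and compactness makes the choice uniform. -/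
theorem eventually_le (hV : IsBoundaryFamily p V) (hp1 : 1 < p) (hp : p ≤ 3 / 2)
    {S : Set (ℝ × ℝ)} (hS : IsCompact S) (hSU : S ⊆ Ioi 0 ×ˢ Ici 0) (M : ℝ) :
    ∀ᶠ c in atTop, ∀ z ∈ S, M ≤ familySolution p V c z := by
  have hp2 : p < 2 := by linarith
  refine hS.induction_on (p := fun S' => ∀ᶠ c in atTop, ∀ z ∈ S' ∩ S, M ≤ familySolution p V c z)
    (by simp) (fun s t hst h => h.mono fun c hc z hz => hc z ⟨hst hz.1, hz.2⟩)
    (fun s t hs ht => ?_) (fun z hz => ?_) |>.mono fun c hc z hz => hc z ⟨hz, hz⟩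
  · filter_upwards [hs, ht] with c h1 h2 z hz
    exact hz.1.elim (fun h => h1 z ⟨h, hz.2⟩) fun h => h2 z ⟨h, hz.2⟩
  · obtain ⟨c, hc⟩ := ((hV.tendsto_atTop hp1 hp (hSU hz).1 (hSU hz).2).eventually_gt_atTop M).exists
    refine ⟨{w | M < familySolution p V c w},
      (hV.continuousOn hp1 hp2 c).mono hSU z hz (Ioi_mem_nhds hc), ?_⟩
    filter_upwards [eventually_ge_atTop c] with c' hc' w hw
    exact hw.1.le.trans (hV.apply_mono hp1 hp2 w.1 (hSU hw.2).2 hc')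

end IsBoundaryFamily

namespace IsBoundaryFamily

variable {p : ℝ} {V : ℝ → ℝ → ℝ}

theorem exists_tendsto_at_one (hV : IsBoundaryFamily p V) (hp : 3 / 2 < p) (hp2 : p < 2) :
    ∃ L, 0 < L ∧ Tendsto (fun c => V c 1) atTop (𝓝 L) ∧ ∀ c, V c 1 ≤ L := by
  have hp1 : 1 < p := by linarith
  obtain ⟨B, hB⟩ := IsBoundarySolution.exists_le_at_one hp hp2
  have hbdd : BddAbove (range fun c => V c 1) := ⟨B, by rintro _ ⟨c, rfl⟩; exact hB _ _ (hV c)⟩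
  refine ⟨⨆ c, V c 1, ?_, tendsto_atTop_ciSup (hV.mono hp1 hp2 1) hbdd, fun c => le_ciSup hbdd c⟩
  exact ((hV 1).pos hp1 hp2 (by simp) one_pos).trans_le (le_ciSup hbdd 1)

theorem le_rpow (hV : IsBoundaryFamily p V) (hp1 : 1 < p) (hp2 : p < 2) {L : ℝ}
    (hL : ∀ c, V c 1 ≤ L) (c : ℝ) {t : ℝ} (ht : 0 < t) :
    V c t ≤ L * t ^ (-(1 / (2 * (p - 1)))) := by
  rw [hV.eq_rpow_mul_one hp1 hp2 c ht, mul_comm]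
  exact mul_le_mul_of_nonneg_right (hL _) (by positivity)

theorem tendsto_boundary (hV : IsBoundaryFamily p V) (hp1 : 1 < p) (hp2 : p < 2) {L : ℝ}
    (hL : Tendsto (fun c => V c 1) atTop (𝓝 L)) {t : ℝ} (ht : 0 < t) :
    Tendsto (fun c => V c t) atTop (𝓝 (L * t ^ (-(1 / (2 * (p - 1)))))) := by
  simp only [fun c => hV.eq_rpow_mul_one hp1 hp2 c ht]
  rw [mul_comm L]
  have h : Tendsto (fun c => V (t ^ (1 / (2 * (p - 1)) - 1 / 2) * c) 1) atTop (𝓝 L) :=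
    hL.comp (tendsto_id.const_mul_atTop (by positivity))
  exact h.const_mul _

theorem tendsto_integral_mul (hV : IsBoundaryFamily p V) (hp1 : 1 < p) (hp2 : p < 2) {L : ℝ}
    (hL : Tendsto (fun c => V c 1) atTop (𝓝 L)) (hL' : ∀ c, V c 1 ≤ L) {a : ℝ → ℝ}
    (ha : ∀ s, 0 ≤ a s) (hm : Measurable a) {t : ℝ}
    (hi : IntegrableOn (fun s => a s * (L * s ^ (-(1 / (2 * (p - 1)))))) (Ioo 0 t)) :
    Tendsto (fun c => ∫ s in Ioo 0 t, a s * V c s) atTop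
      (𝓝 (∫ s in Ioo 0 t, a s * (L * s ^ (-(1 / (2 * (p - 1))))))) := by
  refine tendsto_integral_filter_of_dominated_convergence _
    (.of_forall fun c => (hm.aestronglyMeasurable.mul (hV c).aestronglyMeasurable).restrict)
    (.of_forall fun c => ?_) hi ?_
  · filter_upwards [ae_restrict_mem measurableSet_Ioo] with s hs
    rw [Real.norm_of_nonneg (mul_nonneg (ha s) ((hV c).nonneg s))]
    exact mul_le_mul_of_nonneg_left (hV.le_rpow hp1 hp2 hL' c hs.1) (ha s)
  · filter_upwards [ae_restrict_mem measurableSet_Ioo] with s hs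
    exact (hV.tendsto_boundary hp1 hp2 hL hs.1).const_mul _

/-- The limit of the boundary values is determined by conservation of mass. -/
theorem limit_rpow_eq (hV : IsBoundaryFamily p V) (hp : 3 / 2 < p) (hp2 : p < 2) {L : ℝ}
    (hL0 : 0 < L) (hL : Tendsto (fun c => V c 1) atTop (𝓝 L)) (hL' : ∀ c, V c 1 ≤ L) :
    L ^ (p - 1) = (1 / (2 * (p - 1)) - 1 / 2) *
      ((√Real.pi)⁻¹ * ProbabilityTheory.beta (1 - 1 / (2 * (p - 1))) (1 / 2)) := by
  have hp1 : 1 < p := by linarith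
  have hm1 : 1 / (2 * (p - 1)) < 1 := by rw [div_lt_one (by linarith)]; linarith
  have hm2 : 1 / 2 < 1 / (2 * (p - 1)) := one_div_lt_one_div_of_lt (by linarith) (by linarith)
  have hmp : 1 / (2 * (p - 1)) * p = 1 / (2 * (p - 1)) + 1 / 2 := by
    have : p - 1 ≠ 0 := by linarith
    field_simp; ring
  set m := 1 / (2 * (p - 1)) with hm
  set B := (√Real.pi)⁻¹ * ProbabilityTheory.beta (1 - m) (1 / 2) with hB
  -- Dominated convergence is available because `m < 1` makes the limiting power integrable at `0`.
  have hk : ∀ t : ℝ, 0 < t → Tendsto (fun c => ∫ s, heatKernel (t - s) 0 * V c s) atTop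
      (𝓝 (L * (B * t ^ (1 / 2 - m)))) := fun t ht => by
    obtain ⟨i1, e1⟩ := heatKernel_conv_rpow hm1 ht
    have := hV.tendsto_integral_mul hp1 hp2 hL hL' (a := fun s => heatKernel (t - s) 0) (t := t)
      (fun s => heatKernel_nonneg _ _)
      ((measurable_heatKernel_left 0).comp (measurable_const.sub measurable_id)) (by
        have := i1.const_mul L
        refine this.congr (.of_forall fun s => ?_)
        simp only [← hm]; ring)
    have e : ∫ s in Ioo 0 t, heatKernel (t - s) 0 * (L * s ^ (-m)) = L * (B * t ^ (1 / 2 - m)) := by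
      rw [hB, ← e1, ← integral_const_mul]
      simp only [mul_left_comm]
    rw [← hm, e] at this
    refine this.congr fun c => ?_
    rw [integral_heatKernel_mul_eq fun s hs => (hV c).of_nonpos hs]
  have hflux : Tendsto (fun c => ∫ s in (1 : ℝ)..2, powerFlux p (V c s)) atTop
      (𝓝 (∫ s in (1 : ℝ)..2, L ^ p * s ^ (-(m + 1 / 2)))) := by
    have hpow : ∀ s : ℝ, 0 < s → (L * s ^ (-m)) ^ p = L ^ p * s ^ (-(m + 1 / 2)) := fun s hs => by
      rw [Real.mul_rpow hL0.le (by positivity), ← Real.rpow_mul hs.le, neg_mul, hmp]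
    have h12 : ∀ s ∈ uIoc (1 : ℝ) 2, 0 < s := fun s hs => by
      rw [uIoc_of_le one_le_two] at hs; linarith [hs.1]
    refine intervalIntegral.tendsto_integral_filter_of_dominated_convergence
      (fun s => L ^ p * s ^ (-(m + 1 / 2)))
      (.of_forall fun c => ((hV c).aestronglyMeasurable_flux hp1).restrict)
      (.of_forall fun c => .of_forall fun s hs => ?_) ?_ (.of_forall fun s hs => ?_)
    · rw [Real.norm_of_nonneg ((hV c).flux_nonneg s), (hV c).flux_eq hp1, ← hpow s (h12 s hs)]
      exact Real.rpow_le_rpow ((hV c).nonneg s) (hV.le_rpow hp1 hp2 hL' c (h12 s hs)) (by linarith)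
    · refine (intervalIntegral.intervalIntegrable_rpow (.inr ?_)).const_mul _
      rw [uIcc_of_le one_le_two]; exact fun h => by linarith [h.1]
    · rw [← hpow s (h12 s hs)]
      simp only [(hV _).flux_eq hp1]
      exact (hV.tendsto_boundary hp1 hp2 hL (h12 s hs)).rpow_const (.inr (by linarith))
  -- The balance on `[1,2]` in the limit: `L^p ∫₁² s^(-(m+1/2)) ds = L B (1 - 2^(1/2-m))`, with `m p
  -- = m + 1/2`. The factor `2^(1/2-m) - 1` is nonzero and cancels.
  have h := tendsto_nhds_unique hflux
    (((hk 1 one_pos).sub (hk 2 two_pos)).congr fun c => ((hV c).integral_flux hp1 hp2).symm)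
  rw [intervalIntegral.integral_const_mul, integral_rpow (.inr ⟨by linarith, by
    rw [uIcc_of_le one_le_two]; exact fun h => by linarith [h.1]⟩), Real.one_rpow, Real.one_rpow,
    show -(m + 1 / 2) + 1 = 1 / 2 - m by ring] at h
  have hne : (2 : ℝ) ^ (1 / 2 - m) - 1 ≠ 0 := by
    have := Real.rpow_lt_one_of_one_lt_of_neg one_lt_two (show 1 / 2 - m < 0 by linarith)
    exact (by linarith : (2 : ℝ) ^ (1 / 2 - m) - 1 < 0).ne
  have hne2 : 1 / 2 - m ≠ 0 := by linarith
  rw [Real.rpow_sub hL0, Real.rpow_one, div_eq_iff hL0.ne']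
  rw [mul_div_assoc', div_eq_iff hne2] at h
  refine mul_right_cancel₀ hne (h.trans ?_)
  ring

theorem tendsto_interior (hV : IsBoundaryFamily p V) (hp1 : 1 < p) (hp2 : p < 2) {L : ℝ}
    (hL : Tendsto (fun c => V c 1) atTop (𝓝 L)) (hL' : ∀ c, V c 1 ≤ L) {t x : ℝ} (hx : 0 < x)
    (hi : IntegrableOn (fun s => poissonKernel x (t - s) * (L * s ^ (-(1 / (2 * (p - 1))))))
      (Ioo 0 t)) :
    Tendsto (fun c => familySolution p V c (t, x)) atTop
      (𝓝 (∫ s in Ioo 0 t, poissonKernel x (t - s) * (L * s ^ (-(1 / (2 * (p - 1))))))) := by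
  refine (hV.tendsto_integral_mul hp1 hp2 hL hL' (a := fun s => poissonKernel x (t - s))
    (fun s => poissonKernel_nonneg hx.le _)
    ((measurable_poissonKernel_right x).comp (measurable_const.sub measurable_id)) hi).congr
    fun c => ?_
  rw [familySolution, ((hV c).fluxSolution_eq_integral hp1 hp2 t hx).2]
  refine (integral_causal (fun s hs => ?_) fun s hs => ?_).2.symm
  · rw [(hV c).of_nonpos hs, mul_zero]
  · rw [poissonKernel_of_nonpos (by linarith), zero_mul]

end IsBoundaryFamily

/-! ### The explicit profile -/

/-- The weight `exp(-y²-yη)` of the integral representation of the profile. -/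
noncomputable def profileKernel (η y : ℝ) : ℝ := Real.exp (-(y ^ 2 + y * η))

/-- The moments of the profile kernel. -/
noncomputable def profileMoment (a η : ℝ) : ℝ := ∫ y in Ioi 0, profileKernel η y * y ^ a

/-- The ground state `f` of the profile equation; the profile is a multiple of `exp(-η²/4) f(η)`. -/
noncomputable def profileFun (ν η : ℝ) : ℝ := ∫ y in Ioi 0, (1 - profileKernel η y) * y ^ (-ν - 1)

theorem profileKernel_pos (η y : ℝ) : 0 < profileKernel η y := Real.exp_pos _

theorem continuous_profileKernel (η : ℝ) : Continuous (profileKernel η) := by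
  unfold profileKernel; fun_prop

theorem profileKernel_le_one {η y : ℝ} (hη : 0 ≤ η) (hy : 0 ≤ y) : profileKernel η y ≤ 1 :=
  Real.exp_le_one_iff.2 (neg_nonpos.2 (by positivity))

theorem one_sub_profileKernel_le (η y : ℝ) : 1 - profileKernel η y ≤ y ^ 2 + y * η := by
  have := Real.add_one_le_exp (-(y ^ 2 + y * η))
  rw [profileKernel]; linarith

theorem hasDerivAt_profileKernel_left (η y : ℝ) :
    HasDerivAt (fun η => profileKernel η y) (-(profileKernel η y * y)) η := by
  have h := (((hasDerivAt_id η).const_mul y).const_add (y ^ 2)).neg.exp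
  exact h.congr_deriv (by simp [profileKernel])

theorem hasDerivAt_profileKernel_right (η y : ℝ) :
    HasDerivAt (profileKernel η) (-(profileKernel η y * (2 * y + η))) y := by
  have h := (((hasDerivAt_pow 2 y).add ((hasDerivAt_id y).mul_const η))).neg.exp
  exact h.congr_deriv (by simp [profileKernel]; ring)

theorem profileKernel_le {η η₀ y : ℝ} (hy : 0 ≤ y) (h : -η₀ ≤ η) :
    profileKernel η y ≤ profileKernel (-η₀) y :=
  Real.exp_le_exp.2 (neg_le_neg (by have := mul_le_mul_of_nonneg_left h hy; linarith))

theorem integrableOn_profileKernel_mul {a : ℝ} (ha : -1 < a) (η : ℝ) :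
    IntegrableOn (fun y => profileKernel η y * y ^ a) (Ioi 0) := by
  have h := (integrableOn_rpow_mul_exp_neg_mul_sq (b := 1 / 2) (by norm_num) ha).const_mul
    (Real.exp (η ^ 2 / 2))
  refine Integrable.mono' h ?_ ?_
  · exact ((continuous_profileKernel η).measurable.mul
      (measurable_id.pow_const a)).aestronglyMeasurable
  · filter_upwards [ae_restrict_mem measurableSet_Ioi] with y hy
    have hy0 : 0 ≤ y := le_of_lt hy
    rw [Real.norm_of_nonneg (mul_nonneg (profileKernel_pos η y).le (by positivity)),
      mul_left_comm, ← Real.exp_add, mul_comm]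
    refine mul_le_mul_of_nonneg_left (Real.exp_le_exp.2 ?_) (by positivity)
    nlinarith [sq_nonneg (y + η)]

theorem hasDerivAt_profileMoment {a : ℝ} (ha : -1 < a) (η : ℝ) :
    HasDerivAt (profileMoment a) (-profileMoment (a + 1) η) η := by
  have h := hasDerivAt_integral_of_dominated_loc_of_deriv_le (μ := volume.restrict (Ioi (0 : ℝ)))
    (F := fun η y => profileKernel η y * y ^ a)
    (F' := fun η y => -(profileKernel η y * y) * y ^ a) (x₀ := η) (s := Metric.ball η 1)
    (bound := fun y => profileKernel (-(|η| + 1)) y * y ^ (a + 1)) (Metric.ball_mem_nhds _ one_pos)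
    (.of_forall fun η => ((continuous_profileKernel η).measurable.mul
      (measurable_id.pow_const a)).aestronglyMeasurable)
    (integrableOn_profileKernel_mul ha η)
    ((((continuous_profileKernel η).measurable.mul measurable_id).neg.mul
      (measurable_id.pow_const a)).aestronglyMeasurable) ?_
    (integrableOn_profileKernel_mul (by linarith) _)
    (.of_forall fun y η _ => (hasDerivAt_profileKernel_left η y).mul_const _)
  · refine h.2.congr_deriv ?_
    rw [profileMoment, ← integral_neg]
    refine setIntegral_congr_fun measurableSet_Ioi fun y hy => ?_
    rw [Real.rpow_add hy, Real.rpow_one]; ring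
  · filter_upwards [ae_restrict_mem measurableSet_Ioi] with y hy η' hη'
    have hy0 : 0 ≤ y := le_of_lt hy
    rw [neg_mul, norm_neg, mul_assoc, Real.rpow_add hy, Real.rpow_one, mul_comm (y ^ a),
      Real.norm_of_nonneg (mul_nonneg (profileKernel_pos _ y).le (by positivity))]
    refine mul_le_mul_of_nonneg_right (profileKernel_le hy0 ?_) (by positivity)
    rw [Metric.mem_ball, Real.dist_eq, abs_lt] at hη'
    linarith [neg_abs_le η, hη'.1]

/-- Near `0` the first factor is `O(y)`, which needs `ν < 1`; at infinity the power alone is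
integrable, which needs `ν > 0`. -/
theorem integrableOn_profileFun {ν η : ℝ} (hν0 : 0 < ν) (hν1 : ν < 1) (hη : 0 ≤ η) :
    IntegrableOn (fun y => (1 - profileKernel η y) * y ^ (-ν - 1)) (Ioi 0) := by
  have hm : Measurable fun y => (1 - profileKernel η y) * y ^ (-ν - 1) :=
    (measurable_const.sub (continuous_profileKernel η).measurable).mul
      (measurable_id.pow_const _)
  rw [← Ioc_union_Ioi_eq_Ioi zero_le_one]
  refine IntegrableOn.union ?_ ?_
  · have hr : IntegrableOn (fun y : ℝ => y ^ (-ν)) (Ioc 0 1) := by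
      rw [← intervalIntegrable_iff_integrableOn_Ioc_of_le zero_le_one]
      exact intervalIntegral.intervalIntegrable_rpow' (by linarith)
    refine Integrable.mono' (hr.const_mul (1 + η)) hm.aestronglyMeasurable ?_
    filter_upwards [ae_restrict_mem measurableSet_Ioc] with y hy
    have hy0 : 0 ≤ y := hy.1.le
    have h1 := sub_nonneg.2 (profileKernel_le_one hη hy0)
    rw [Real.norm_of_nonneg (mul_nonneg h1 (by positivity)), Real.rpow_sub hy.1, Real.rpow_one,
      mul_div_assoc', div_le_iff₀ hy.1]
    have h2 : 1 - profileKernel η y ≤ (1 + η) * y := by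
      refine (one_sub_profileKernel_le η y).trans ?_
      nlinarith [hy.2]
    calc (1 - profileKernel η y) * y ^ (-ν) ≤ ((1 + η) * y) * y ^ (-ν) :=
          mul_le_mul_of_nonneg_right h2 (by positivity)
      _ = _ := by ring
  · refine Integrable.mono' (integrableOn_Ioi_rpow_of_lt (show -ν - 1 < -1 by linarith) one_pos)
      hm.aestronglyMeasurable ?_
    filter_upwards [ae_restrict_mem measurableSet_Ioi] with y hy
    have hy0 : 0 ≤ y := zero_le_one.trans (le_of_lt hy)
    have h1 := sub_nonneg.2 (profileKernel_le_one hη hy0)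
    rw [Real.norm_of_nonneg (mul_nonneg h1 (by positivity))]
    exact mul_le_of_le_one_left (by positivity) (by linarith [profileKernel_pos η y])

theorem hasDerivAt_profileFun {ν η : ℝ} (hν0 : 0 < ν) (hν1 : ν < 1) (hη : 0 ≤ η) :
    HasDerivAt (profileFun ν) (profileMoment (-ν) η) η := by
  have h := hasDerivAt_integral_of_dominated_loc_of_deriv_le (μ := volume.restrict (Ioi (0 : ℝ)))
    (F := fun η y => (1 - profileKernel η y) * y ^ (-ν - 1))
    (F' := fun η y => (profileKernel η y * y) * y ^ (-ν - 1)) (x₀ := η) (s := Metric.ball η 1)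
    (bound := fun y => profileKernel (-(|η| + 1)) y * y ^ (-ν)) (Metric.ball_mem_nhds _ one_pos)
    (.of_forall fun η => ((measurable_const.sub (continuous_profileKernel η).measurable).mul
      (measurable_id.pow_const _)).aestronglyMeasurable)
    (integrableOn_profileFun hν0 hν1 hη)
    ((((continuous_profileKernel η).measurable.mul measurable_id).mul
      (measurable_id.pow_const _)).aestronglyMeasurable) ?_
    (integrableOn_profileKernel_mul (by linarith) _)
    (.of_forall fun y η _ => by
      have := ((hasDerivAt_profileKernel_left η y).const_sub 1).mul_const (y ^ (-ν - 1))
      rwa [neg_neg] at this)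
  · refine h.2.congr_deriv ?_
    rw [profileMoment]
    refine setIntegral_congr_fun measurableSet_Ioi fun y hy => ?_
    rw [Real.rpow_sub hy, Real.rpow_one]
    have : y ≠ 0 := ne_of_gt hy
    field_simp
  · filter_upwards [ae_restrict_mem measurableSet_Ioi] with y hy η' hη'
    have hy0 : 0 ≤ y := le_of_lt hy
    have hy1 : y ≠ 0 := ne_of_gt hy
    have e : y * y ^ (-ν - 1) = y ^ (-ν) := by
      rw [Real.rpow_sub hy, Real.rpow_one]; field_simp
    rw [mul_assoc, e, Real.norm_of_nonneg (mul_nonneg (profileKernel_pos _ y).le (by positivity))]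
    refine mul_le_mul_of_nonneg_right (profileKernel_le hy0 ?_) (by positivity)
    rw [Metric.mem_ball, Real.dist_eq, abs_lt] at hη'
    linarith [neg_abs_le η, hη'.1]

/-- The second-order equation `f'' - (η/2) f' + (ν/2) f = 0`. -/
theorem profileFun_ode {ν η : ℝ} (hν0 : 0 < ν) (hν1 : ν < 1) (hη : 0 ≤ η) :
    -profileMoment (-ν + 1) η - η / 2 * profileMoment (-ν) η + ν / 2 * profileFun ν η = 0 := by
  have i1 := integrableOn_profileKernel_mul (a := -ν + 1) (by linarith) η
  have i2 := integrableOn_profileKernel_mul (a := -ν) (by linarith) η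
  have i3 := integrableOn_profileFun hν0 hν1 hη
  have i1' : IntegrableOn (fun y => -(profileKernel η y * y ^ (-ν + 1))) (Ioi 0) := i1.neg
  have i4 : IntegrableOn (fun y => -(profileKernel η y * y ^ (-ν + 1))
      - η / 2 * (profileKernel η y * y ^ (-ν))) (Ioi 0) := i1'.sub (i2.const_mul _)
  have i5 : IntegrableOn (fun y => -(profileKernel η y * y ^ (-ν + 1))
      - η / 2 * (profileKernel η y * y ^ (-ν))
      + ν / 2 * ((1 - profileKernel η y) * y ^ (-ν - 1))) (Ioi 0) := i4.add (i3.const_mul _)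
  have hF0 : ∀ y, 0 ≤ y → |-(1 / 2) * ((1 - profileKernel η y) * y ^ (-ν))| ≤
      (1 - profileKernel η y) * y ^ (-ν) := fun y hy => by
    have : 0 ≤ (1 - profileKernel η y) * y ^ (-ν) :=
      mul_nonneg (sub_nonneg.2 (profileKernel_le_one hη hy)) (by positivity)
    rw [abs_mul, abs_of_nonneg this]; norm_num; linarith
  -- The combination of integrands in the equation is the exact derivative of `-(1/2) (1 -
  -- profileKernel η y) y^(-ν)`, which vanishes at both ends.
  have key := integral_Ioi_of_hasDerivAt_of_tendsto (a := (0 : ℝ)) (m := (0 : ℝ))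
    (f := fun y => -(1 / 2) * ((1 - profileKernel η y) * y ^ (-ν)))
    (f' := fun y => -(profileKernel η y * y ^ (-ν + 1))
      - η / 2 * (profileKernel η y * y ^ (-ν))
      + ν / 2 * ((1 - profileKernel η y) * y ^ (-ν - 1))) ?_ ?_ i5 ?_
  · rw [integral_add i4 (i3.const_mul _), integral_sub i1' (i2.const_mul _), integral_neg,
      integral_const_mul, integral_const_mul] at key
    rw [profileMoment, profileMoment, profileFun, key]
    simp [profileKernel]
  · rw [ContinuousWithinAt]
    have h0 : -(1 / 2) * ((1 - profileKernel η 0) * (0 : ℝ) ^ (-ν)) = 0 := by simp [profileKernel]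
    rw [h0]
    have hlim : Tendsto (fun y : ℝ => y * y ^ (1 - ν) + η * y ^ (1 - ν)) (𝓝[≥] 0) (𝓝 0) := by
      have hc : Continuous fun y : ℝ => y * y ^ (1 - ν) + η * y ^ (1 - ν) := by
        have := Real.continuous_rpow_const (q := 1 - ν) (by linarith)
        fun_prop
      have := hc.tendsto 0
      rw [Real.zero_rpow (by linarith)] at this
      simp only [mul_zero, add_zero] at this
      exact this.mono_left nhdsWithin_le_nhds
    refine squeeze_zero_norm' ?_ hlim
    filter_upwards [self_mem_nhdsWithin] with y hy
    have hy0 : 0 ≤ y := hy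
    rw [Real.norm_eq_abs]
    refine (hF0 y hy0).trans ?_
    rcases hy0.eq_or_lt with rfl | hy1
    · simp [profileKernel]; rw [Real.zero_rpow (by linarith)]; simp
    · refine (mul_le_mul_of_nonneg_right (one_sub_profileKernel_le η y) (by positivity)).trans_eq ?_
      rw [sub_eq_add_neg 1 ν, Real.rpow_add hy1, Real.rpow_one]; ring
  · intro y hy
    have hy1 : y ≠ 0 := ne_of_gt hy
    have h := (((hasDerivAt_profileKernel_right η y).const_sub 1).mul
      (Real.hasDerivAt_rpow_const (p := -ν) (.inl hy1))).const_mul (-(1 / 2))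
    refine h.congr_deriv ?_
    rw [Real.rpow_add hy, Real.rpow_one]; ring
  · refine squeeze_zero_norm' ?_ (tendsto_rpow_neg_atTop hν0)
    filter_upwards [eventually_ge_atTop 0] with y hy
    rw [Real.norm_eq_abs]
    exact (hF0 y hy).trans (mul_le_of_le_one_left (by positivity)
      (by linarith [profileKernel_pos η y]))

theorem profileMoment_zero {a : ℝ} (ha : -1 < a) :
    profileMoment a 0 = 1 / 2 * Real.Gamma ((a + 1) / 2) := by
  rw [← integral_rpow_mul_exp_neg_rpow two_pos ha, profileMoment]
  refine setIntegral_congr_fun measurableSet_Ioi fun y _ => ?_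
  simp [profileKernel, mul_comm]

theorem profileMoment_pos {a : ℝ} (ha : -1 < a) : 0 < profileMoment a 0 := by
  rw [profileMoment_zero ha]
  have := Real.Gamma_pos_of_pos (show 0 < (a + 1) / 2 by linarith)
  positivity

/-- At `η = 0` the differential equation has no first-order term and expresses `f(0)` through a
Gaussian moment. -/
theorem mul_profileFun_zero {ν : ℝ} (hν0 : 0 < ν) (hν1 : ν < 1) :
    ν * profileFun ν 0 = Real.Gamma (1 - ν / 2) := by
  have h := profileFun_ode hν0 hν1 le_rfl
  rw [profileMoment_zero (show -1 < -ν + 1 by linarith),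
    show (-ν + 1 + 1) / 2 = 1 - ν / 2 by ring] at h
  linarith

theorem profileFun_zero_pos {ν : ℝ} (hν0 : 0 < ν) (hν1 : ν < 1) : 0 < profileFun ν 0 := by
  have h := mul_profileFun_zero hν0 hν1
  have := Real.Gamma_pos_of_pos (show 0 < 1 - ν / 2 by linarith)
  exact pos_of_mul_pos_right (h ▸ this) hν0.le

/-- The left side is `f'(0)`, so this is `f'(0)/f(0)` written with the constant of `limit_rpow_eq`.
It links the limiting mass balance to the boundary condition of the profile. -/
theorem profileMoment_eq_mul_profileFun {ν : ℝ} (hν0 : 0 < ν) (hν1 : ν < 1) :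
    profileMoment (-ν) 0
      = ν / 2 * ((√Real.pi)⁻¹ * ProbabilityTheory.beta ((1 - ν) / 2) (1 / 2)) * profileFun ν 0 := by
  have h := mul_profileFun_zero hν0 hν1
  have hG := Real.Gamma_pos_of_pos (show 0 < 1 - ν / 2 by linarith)
  have hpi : √Real.pi ≠ 0 := (Real.sqrt_pos.2 Real.pi_pos).ne'
  rw [profileMoment_zero (by linarith), ProbabilityTheory.beta, Real.Gamma_one_half_eq,
    show (1 - ν) / 2 + 1 / 2 = 1 - ν / 2 by ring, show (-ν + 1) / 2 = (1 - ν) / 2 by ring,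
    ← h]
  have hf := (profileFun_zero_pos hν0 hν1).ne'
  field_simp

theorem profileKernel_antitone {η η' y : ℝ} (hy : 0 ≤ y) (h : η ≤ η') :
    profileKernel η' y ≤ profileKernel η y := by
  have := profileKernel_le (η := η') (η₀ := -η) hy (by linarith)
  rwa [neg_neg] at this

theorem profileFun_mono {ν η : ℝ} (hν0 : 0 < ν) (hν1 : ν < 1) (hη : 0 ≤ η) :
    profileFun ν 0 ≤ profileFun ν η :=
  setIntegral_mono_on (integrableOn_profileFun hν0 hν1 le_rfl) (integrableOn_profileFun hν0 hν1 hη)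
    measurableSet_Ioi fun _ hy => mul_le_mul_of_nonneg_right
      (sub_le_sub_left (profileKernel_antitone (le_of_lt hy) hη) 1) (Real.rpow_nonneg
          (le_of_lt hy) _)

theorem profileFun_pos {ν η : ℝ} (hν0 : 0 < ν) (hν1 : ν < 1) (hη : 0 ≤ η) : 0 < profileFun ν η :=
  (profileFun_zero_pos hν0 hν1).trans_le (profileFun_mono hν0 hν1 hη)

theorem profileMoment_nonneg (a η : ℝ) : 0 ≤ profileMoment a η :=
  setIntegral_nonneg measurableSet_Ioi fun y hy =>
    mul_nonneg (profileKernel_pos η y).le (Real.rpow_nonneg (le_of_lt hy) _)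

theorem profileMoment_le {a η : ℝ} (ha : -1 < a) (hη : 0 ≤ η) :
    profileMoment a η ≤ profileMoment a 0 :=
  setIntegral_mono_on (integrableOn_profileKernel_mul ha η) (integrableOn_profileKernel_mul ha 0)
    measurableSet_Ioi fun _ hy => mul_le_mul_of_nonneg_right
      (profileKernel_antitone (le_of_lt hy) hη) (Real.rpow_nonneg (le_of_lt hy) _)

theorem continuousOn_profileFun {ν : ℝ} (hν0 : 0 < ν) (hν1 : ν < 1) :
    ContinuousOn (profileFun ν) (Ici 0) := fun _ hη =>
  (hasDerivAt_profileFun hν0 hν1 hη).continuousAt.continuousWithinAt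

theorem continuous_profileMoment {a : ℝ} (ha : -1 < a) : Continuous (profileMoment a) :=
  continuous_iff_continuousAt.2 fun η => (hasDerivAt_profileMoment ha η).continuousAt

theorem profileFun_le {ν η : ℝ} (hν0 : 0 < ν) (hν1 : ν < 1) (hη : 0 ≤ η) :
    profileFun ν η ≤ profileFun ν 0 + η * profileMoment (-ν) 0 := by
  have hi : IntervalIntegrable (profileMoment (-ν)) volume 0 η :=
    (continuous_profileMoment (by linarith)).intervalIntegrable _ _
  have h := intervalIntegral.integral_eq_sub_of_hasDerivAt (a := 0) (b := η) (f := profileFun ν)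
    (fun s hs => by
      rw [uIcc_of_le hη] at hs
      exact hasDerivAt_profileFun hν0 hν1 hs.1) hi
  have h2 := intervalIntegral.integral_mono_on (g := fun _ => profileMoment (-ν) 0) hη hi
    intervalIntegrable_const fun s hs => profileMoment_le (by linarith) hs.1
  rw [h, intervalIntegral.integral_const, smul_eq_mul, sub_zero] at h2
  linarith

/-- Representation of the self-similar solution as a superposition of heat kernels. -/
theorem integral_heatKernel_sub_mul_rpow {ν t x : ℝ} (hν0 : 0 < ν) (hν1 : ν < 1) (ht : 0 < t)
    (hx : 0 ≤ x) :
    IntegrableOn (fun z => (heatKernel t x - heatKernel t (x + z)) * z ^ (-ν - 1)) (Ioi 0) ∧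
      ∫ z in Ioi 0, (heatKernel t x - heatKernel t (x + z)) * z ^ (-ν - 1)
        = 2 ^ (-ν) * (√Real.pi)⁻¹ *
          (t ^ (-((ν + 1) / 2)) * (Real.exp (-((x / √t) ^ 2 / 4)) * profileFun ν (x / √t))) := by
  set r := 2 * √t with hr
  have hs : 0 < √t := Real.sqrt_pos.2 ht
  have hr0 : 0 < r := by positivity
  have hst : √t ^ 2 = t := Real.sq_sqrt ht.le
  -- The scaling `z = 2 √t y` gives `(x+z)²/(4t) = x²/(4t) + y² + y x/√t`, so the kernel at `x + z`
  -- is the kernel at `x` times `profileKernel (x/√t) y`.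
  set F : ℝ → ℝ := fun z => (heatKernel t x - heatKernel t (x + z)) * z ^ (-ν - 1) with hF
  have e : EqOn (fun y => F (r * y)) (fun y => heatKernel t x * r ^ (-ν - 1) *
      ((1 - profileKernel (x / √t) y) * y ^ (-ν - 1))) (Ioi 0) := fun y hy => by
    have hy0 : 0 ≤ y := le_of_lt hy
    have hk : heatKernel t (x + r * y) = heatKernel t x * profileKernel (x / √t) y := by
      rw [heatKernel, heatKernel, profileKernel, div_mul_eq_mul_div, ← Real.exp_add]
      congr 2
      have hq : ∀ q : ℝ, 0 < q → -((x + 2 * q * y) ^ 2 / (4 * q ^ 2)) =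
          -(x ^ 2 / (4 * q ^ 2)) + -(y ^ 2 + y * (x / q)) := fun q hq => by
        field_simp; ring
      have := hq (√t) hs
      rwa [hst] at this
    simp only [hF]
    rw [hk, Real.mul_rpow hr0.le hy0]
    ring
  have hfi := integrableOn_profileFun hν0 hν1 (show 0 ≤ x / √t by positivity)
  have i1 : IntegrableOn (fun y => F (r * y)) (Ioi 0) :=
    IntegrableOn.congr_fun (hfi.const_mul _) e.symm measurableSet_Ioi
  have i2 := (integrableOn_Ioi_comp_mul_left_iff F 0 hr0).1 i1
  rw [mul_zero] at i2
  refine ⟨i2, ?_⟩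
  have h := integral_comp_mul_left_Ioi F 0 hr0
  rw [mul_zero, setIntegral_congr_fun measurableSet_Ioi e, integral_const_mul, smul_eq_mul,
    eq_inv_mul_iff_mul_eq₀ hr0.ne'] at h
  rw [← h]
  have h1 : heatKernel t x = (√Real.pi)⁻¹ * t ^ (-(1 / 2) : ℝ) * Real.exp
      (-((x / √t) ^ 2 / 4)) := by
    rw [← heatKernel_at_zero_rpow ht.le, heatKernel_at_zero, heatKernel, div_pow, hst, div_div,
      mul_comm t 4]
    ring
  have h2 : r * r ^ (-ν - 1) = 2 ^ (-ν) * t ^ (-(ν / 2)) := by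
    rw [Real.rpow_sub hr0, Real.rpow_one, mul_div_cancel₀ _ hr0.ne', hr,
      Real.mul_rpow zero_le_two hs.le, Real.sqrt_eq_rpow, ← Real.rpow_mul ht.le]
    congr 2; ring
  have h3 : t ^ (-((ν + 1) / 2)) = t ^ (-(1 / 2) : ℝ) * t ^ (-(ν / 2)) := by
    rw [← Real.rpow_add ht]; congr 1; ring
  rw [h1, h3, profileFun]
  linear_combination ((√Real.pi)⁻¹ * t ^ (-(1 / 2) : ℝ) * Real.exp (-((x / √t) ^ 2 / 4)) *
    ∫ y in Ioi 0, (1 - profileKernel (x / √t) y) * y ^ (-ν - 1)) * h2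

/-- The Poisson integral of a power of the time variable. -/
theorem poissonKernel_conv_rpow {ν t x : ℝ} (hν0 : 0 < ν) (hν1 : ν < 1) (ht : 0 < t) (hx : 0 < x) :
    IntegrableOn (fun s => poissonKernel x (t - s) * (profileFun ν 0 * s ^ (-((ν + 1) / 2))))
      (Ioo 0 t) ∧
      ∫ s in Ioo 0 t, poissonKernel x (t - s) * (profileFun ν 0 * s ^ (-((ν + 1) / 2)))
        = t ^ (-((ν + 1) / 2)) * (Real.exp (-((x / √t) ^ 2 / 4)) * profileFun ν (x / √t)) := by
  -- Up to a constant, the power of `s` is the superposition over `z` of `k(s,0) - k(s,z)`. The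
  -- Poisson integral maps each of these to `k(t,x) - k(t,x+z)`; the integrand is nonnegative for `z
  -- ≥ 0`, so Fubini applies.
  set G : ℝ × ℝ → ℝ := fun q => poissonKernel x (t - q.1) *
    ((heatKernel q.1 0 - heatKernel q.1 q.2) * q.2 ^ (-ν - 1)) with hG
  have hGm : Measurable G :=
    ((measurable_poissonKernel_right x).comp (measurable_const.sub measurable_fst)).mul
      ((((measurable_heatKernel_left 0).comp measurable_fst).sub measurable_heatKernel).mul
        (measurable_snd.pow_const _))
  have hin : ∀ z, 0 ≤ z → Integrable (fun s => G (s, z)) ∧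
      ∫ s, G (s, z) = (heatKernel t x - heatKernel t (x + z)) * z ^ (-ν - 1) := fun z hz => by
    obtain ⟨i0, e0⟩ := poissonKernel_conv_heatKernel hx le_rfl t
    obtain ⟨i1, e1⟩ := poissonKernel_conv_heatKernel hx hz t
    have e : (fun s => G (s, z)) = fun s => (poissonKernel x (t - s) * heatKernel s 0
        - poissonKernel x (t - s) * heatKernel s z) * z ^ (-ν - 1) := by
      funext s; simp only [hG]; ring
    rw [e]
    refine ⟨(i0.sub i1).mul_const _, ?_⟩
    rw [integral_mul_const, integral_sub i0 i1, e0, e1, add_zero]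
  have hG0 : ∀ s z, 0 ≤ z → 0 ≤ G (s, z) := fun s z hz =>
    mul_nonneg (poissonKernel_nonneg hx.le _)
      (mul_nonneg (sub_nonneg.2 (heatKernel_le _ _)) (by positivity))
  obtain ⟨iW, eW⟩ := integral_heatKernel_sub_mul_rpow hν0 hν1 ht hx.le
  have hGi : Integrable G (volume.prod (volume.restrict (Ioi 0))) := by
    rw [integrable_prod_iff' hGm.aestronglyMeasurable]
    refine ⟨?_, iW.congr ?_⟩
    · filter_upwards [ae_restrict_mem measurableSet_Ioi] with z hz
      exact (hin z (le_of_lt hz)).1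
    · filter_upwards [ae_restrict_mem measurableSet_Ioi] with z hz
      rw [← (hin z (le_of_lt hz)).2]
      exact integral_congr_ae (.of_forall fun s => (Real.norm_of_nonneg (hG0 s z
          (le_of_lt hz))).symm)
  have h1 := hGi.integral_prod_left
  have h2 : ∫ s, ∫ z in Ioi 0, G (s, z)
      = ∫ z in Ioi 0, (heatKernel t x - heatKernel t (x + z)) * z ^ (-ν - 1) := by
    rw [integral_integral_swap (f := fun s z => G (s, z)) hGi]
    exact setIntegral_congr_fun measurableSet_Ioi fun z hz => (hin z (le_of_lt hz)).2
  set C := 2 ^ (-ν) * (√Real.pi)⁻¹ with hC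
  have hC0 : C ≠ 0 := by
    have := Real.sqrt_pos.2 Real.pi_pos
    positivity
  have h3 : ∀ s, 0 < s → ∫ z in Ioi 0, G (s, z)
      = C * (poissonKernel x (t - s) * (profileFun ν 0 * s ^ (-((ν + 1) / 2)))) := fun s hs => by
    have := (integral_heatKernel_sub_mul_rpow hν0 hν1 hs le_rfl).2
    simp only [zero_add, zero_div] at this
    simp only [hG]
    rw [integral_const_mul, this]
    simp
    ring
  obtain ⟨hc1, hc2⟩ := integral_causal (F := fun s => ∫ z in Ioi 0, G (s, z)) (t := t)
    (fun s hs => by simp [hG, heatKernel_of_nonpos hs])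
    (fun s hs => by simp [hG, poissonKernel_of_nonpos (show t - s ≤ 0 by linarith)])
  have h4 := hc1.1 h1
  rw [hc2, setIntegral_congr_fun measurableSet_Ioo fun s hs => h3 s hs.1, integral_const_mul,
      eW] at h2
  refine ⟨?_, mul_left_cancel₀ hC0 h2⟩
  have h5 := (h4.congr_fun (fun s hs => h3 s hs.1) measurableSet_Ioo).const_mul C⁻¹
  refine h5.congr (.of_forall fun s => ?_)
  simp only
  rw [inv_mul_cancel_left₀ hC0]

/-! ### The weighted space and uniqueness of the profile -/

/-- The product rule for indefinite integrals. -/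
theorem integral_mul_add_mul {f f' g g' : ℝ → ℝ} {R : ℝ} (hR : 0 ≤ R)
    (hfi : IntervalIntegrable f' volume 0 R) (hgi : IntervalIntegrable g' volume 0 R)
    (hf : ∀ x, 0 ≤ x → f x = f 0 + ∫ s in (0 : ℝ)..x, f' s)
    (hg : ∀ x, 0 ≤ x → g x = g 0 + ∫ s in (0 : ℝ)..x, g' s) :
    ∫ x in (0 : ℝ)..R, (f' x * g x + f x * g' x) = f R * g R - f 0 * g 0 := by
  have hac : ∀ (c : ℝ) {h : ℝ → ℝ}, IntervalIntegrable h volume 0 R →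
      AbsolutelyContinuousOnInterval (fun x => c + ∫ s in (0 : ℝ)..x, h s) 0 R := fun c h hh =>
    (LipschitzOnWith.of_dist_le_mul (K := 0) (f :=
        fun _ : ℝ => c) (by simp)).absolutelyContinuousOnInterval.add
      (hh.absolutelyContinuousOnInterval_intervalIntegral left_mem_uIcc)
  have h := (hac (f 0) hfi).integral_deriv_mul_eq_sub (hac (g 0) hgi)
  rw [← hf R hR, ← hg R hR] at h
  simp only [intervalIntegral.integral_same, add_zero] at h
  rw [← h]
  refine intervalIntegral.integral_congr_ae ?_
  filter_upwards [hfi.ae_hasDerivAt_integral, hgi.ae_hasDerivAt_integral] with x h1 h2 hx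
  have hx' := uIoc_subset_uIcc hx
  have hx0 : 0 ≤ x := by rw [uIoc_of_le hR] at hx; exact hx.1.le
  rw [((h1 hx' 0 left_mem_uIcc).const_add (f 0)).deriv,
    ((h2 hx' 0 left_mem_uIcc).const_add (g 0)).deriv, ← hf x hx0, ← hg x hx0]

theorem weight_pos (η : ℝ) : 0 < weight η := Real.exp_pos _

theorem continuous_weight : Continuous weight := by unfold weight; fun_prop

theorem one_le_weight (η : ℝ) : 1 ≤ weight η := Real.one_le_exp (by positivity)

theorem integrable_weightMeasure_iff {h : ℝ → ℝ} :
    Integrable h weightMeasure ↔ IntegrableOn (fun η => h η * weight η) (Ioi 0) := by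
  rw [weightMeasure, integrable_withDensity_iff (continuous_weight.measurable.ennreal_ofReal)
    (.of_forall fun _ => ENNReal.ofReal_lt_top)]
  simp only [ENNReal.toReal_ofReal (weight_pos _).le, IntegrableOn]

theorem restrict_le_weightMeasure : volume.restrict (Ioi 0) ≤ weightMeasure := by
  rw [weightMeasure]
  conv_lhs => rw [← withDensity_one (μ := volume.restrict (Ioi (0 : ℝ)))]
  refine withDensity_mono (.of_forall fun η => ?_)
  rw [Pi.one_apply, ENNReal.one_le_ofReal]
  exact one_le_weight η

theorem integrableOn_mul_mul_weight {φ ψ : ℝ → ℝ} (hφ : MemLp φ 2 weightMeasure)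
    (hψ : MemLp ψ 2 weightMeasure) : IntegrableOn (fun η => φ η * ψ η * weight η) (Ioi 0) :=
  integrable_weightMeasure_iff.1 (hφ.integrable_mul hψ)

theorem intervalIntegrable_of_memLp {φ : ℝ → ℝ} (hφ : MemLp φ 2 weightMeasure) {R : ℝ}
    (hR : 0 ≤ R) : IntervalIntegrable φ volume 0 R := by
  rw [intervalIntegrable_iff_integrableOn_Ioc_of_le hR]
  have h1 : MemLp φ 2 (volume.restrict (Ioc 0 R)) :=
    (hφ.mono_measure restrict_le_weightMeasure).mono_measure
      (Measure.restrict_mono_set _ Ioc_subset_Ioi_self)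
  exact h1.integrable one_le_two

/-- The square of `exp(-η²/4)` beats the weight by a Gaussian, which absorbs polynomial growth. -/
theorem memLp_exp_mul {g : ℝ → ℝ} {C : ℝ} (hg : ContinuousOn g (Ici 0))
    (hb : ∀ η, 0 ≤ η → |g η| ≤ C * (1 + η ^ 2)) :
    MemLp (fun η => Real.exp (-(η ^ 2 / 4)) * g η) 2 weightMeasure := by
  have hc : ContinuousOn (fun η => Real.exp (-(η ^ 2 / 4)) * g η) (Ioi 0) :=
    (Continuous.continuousOn (by fun_prop)).mul (hg.mono Ioi_subset_Ici_self)
  have hm : AEStronglyMeasurable (fun η => Real.exp (-(η ^ 2 / 4)) * g η) weightMeasure :=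
    (hc.aestronglyMeasurable measurableSet_Ioi).mono_ac (withDensity_absolutelyContinuous _ _)
  rw [memLp_two_iff_integrable_sq hm, integrable_weightMeasure_iff]
  have hgauss : IntegrableOn (fun η : ℝ => (16 * C) ^ 2 * Real.exp (-(1 / 8) * η ^ 2)) (Ioi 0) :=
    ((integrable_exp_neg_mul_sq (by norm_num : (0 : ℝ) < 1 / 8)).const_mul _).integrableOn
  refine Integrable.mono' hgauss
    (((hc.pow 2).mul continuous_weight.continuousOn).aestronglyMeasurable measurableSet_Ioi) ?_
  filter_upwards [ae_restrict_mem measurableSet_Ioi] with η hη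
  have hη0 : 0 ≤ η := le_of_lt hη
  have hC : 0 ≤ C := by
    have := (abs_nonneg _).trans (hb 0 le_rfl)
    simpa using this
  have h1 : 1 + η ^ 2 ≤ 16 * Real.exp (η ^ 2 / 16) := by
    have := Real.add_one_le_exp (η ^ 2 / 16)
    linarith
  have h2 : |g η| ≤ 16 * C * Real.exp (η ^ 2 / 16) :=
    (hb η hη0).trans ((mul_le_mul_of_nonneg_left h1 hC).trans_eq (by ring))
  have h3 : g η ^ 2 ≤ (16 * C) ^ 2 * Real.exp (η ^ 2 / 8) := by
    rw [← sq_abs]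
    refine (pow_le_pow_left₀ (abs_nonneg _) h2 2).trans_eq ?_
    rw [mul_pow _ (Real.exp _), ← Real.exp_nat_mul]
    congr 2; push_cast; ring
  have e : (Real.exp (-(η ^ 2 / 4)) * g η) ^ 2 * weight η = g η ^ 2 * Real.exp (-(η ^ 2 / 4)) := by
    have : Real.exp (-(η ^ 2 / 4)) * weight η = 1 := by rw [weight, ← Real.exp_add]; simp
    linear_combination g η ^ 2 * Real.exp (-(η ^ 2 / 4)) * this
  rw [e, Real.norm_of_nonneg (by positivity)]
  refine (mul_le_mul_of_nonneg_right h3 (Real.exp_pos _).le).trans_eq ?_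
  rw [mul_assoc, ← Real.exp_add]
  congr 2; ring

theorem integrableOn_weak {φ φ' ζ ζ' : ℝ → ℝ} (hφ : MemH1K φ φ') (hζ : MemH1K ζ ζ') (m : ℝ) :
    IntegrableOn (fun η => (φ' η * ζ' η - m * φ η * ζ η) * weight η) (Ioi 0) := by
  have i1 := integrableOn_mul_mul_weight hφ.memLp_deriv hζ.memLp_deriv
  have i2 := (integrableOn_mul_mul_weight hφ.memLp hζ.memLp).const_mul m
  exact (i1.sub i2).congr (.of_forall fun η => by simp only [Pi.sub_apply]; ring)

/-- The strong form of the profile equation implies the weak form. -/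
theorem integral_weak_of_flux {φ φ' ζ ζ' q q' : ℝ → ℝ} {m : ℝ} (hφ : MemH1K φ φ')
    (hζ : MemH1K ζ ζ') (hqi : ∀ R, 0 ≤ R → IntervalIntegrable q' volume 0 R)
    (hq : ∀ η, 0 ≤ η → q η = q 0 + ∫ s in (0 : ℝ)..η, q' s)
    (hφq : ∀ η, 0 ≤ η → φ' η * weight η = q η)
    (hφq' : ∀ η, 0 ≤ η → -(m * φ η * weight η) = q' η) :
    ∫ η in Ioi 0, (φ' η * ζ' η - m * φ η * ζ η) * weight η = -(q 0 * ζ 0) := by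
  have i1 := integrableOn_mul_mul_weight hφ.memLp_deriv hζ.memLp
  have hi := integrableOn_weak hφ hζ m
  have hlim := intervalIntegral_tendsto_integral_Ioi 0 hi tendsto_id
  have hval : ∀ R, 0 ≤ R → ∫ η in (0 : ℝ)..R, (φ' η * ζ' η - m * φ η * ζ η) * weight η
      = q R * ζ R - q 0 * ζ 0 := fun R hR => by
    rw [← integral_mul_add_mul hR (hqi R hR) (intervalIntegrable_of_memLp hζ.memLp_deriv hR) hq
      hζ.eq_integral]
    refine intervalIntegral.integral_congr fun η hη => ?_
    rw [uIcc_of_le hR] at hη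
    rw [← hφq η hη.1, ← hφq' η hη.1]; ring
  set I := ∫ η in Ioi 0, (φ' η * ζ' η - m * φ η * ζ η) * weight η with hI
  have hlim2 : Tendsto (fun R => φ' R * ζ R * weight R) atTop (𝓝 (I + q 0 * ζ 0)) := by
    refine (hlim.add_const (q 0 * ζ 0)).congr' ?_
    filter_upwards [eventually_ge_atTop 0] with R hR
    rw [id, hval R hR, ← hφq R hR]; ring
  -- The boundary term at `R` has a limit and is integrable on `(0,∞)`, as a product of two
  -- functions in the weighted `L²`. Hence its limit is zero.
  have h0 := IntegrableAtFilter.eq_zero_of_tendsto (l := atTop) (μ := volume)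
    ⟨Ioi 0, Ioi_mem_atTop 0, i1⟩ (fun s hs => by
      obtain ⟨a, ha⟩ := mem_atTop_sets.1 hs
      exact measure_mono_top (show Ici a ⊆ s from ha) Real.volume_Ici) hlim2
  linarith

theorem MemH1K.continuousOn {φ φ' : ℝ → ℝ} (h : MemH1K φ φ') : ContinuousOn φ (Ici 0) := by
  intro x hx
  have hx0 : 0 ≤ x := hx
  have hi := (intervalIntegrable_iff_integrableOn_Icc_of_le (by linarith)).1
    (intervalIntegrable_of_memLp h.memLp_deriv (show 0 ≤ x + 1 by linarith))
  rw [← uIcc_of_le (by linarith)] at hi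
  have hc : ContinuousOn φ (Icc 0 (x + 1)) := by
    rw [← uIcc_of_le (by linarith)]
    refine (continuousOn_const (c := φ 0) |>.add
      (intervalIntegral.continuousOn_primitive_interval hi)).congr fun y hy => ?_
    rw [uIcc_of_le (by linarith)] at hy
    exact h.eq_integral y hy.1
  refine (hc x ⟨hx0, by linarith⟩).mono_of_mem_nhdsWithin ?_
  exact mem_nhdsWithin.2 ⟨Iio (x + 1), isOpen_Iio, by simp, fun y hy => ⟨hy.2, le_of_lt hy.1⟩⟩

theorem MemH1K.sub {φ φ' ψ ψ' : ℝ → ℝ} (h : MemH1K φ φ') (k : MemH1K ψ ψ') :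
    MemH1K (fun η => φ η - ψ η) fun η => φ' η - ψ' η := by
  refine ⟨h.memLp.sub k.memLp, h.memLp_deriv.sub k.memLp_deriv, fun η hη => ?_⟩
  rw [intervalIntegral.integral_sub (intervalIntegrable_of_memLp h.memLp_deriv hη)
    (intervalIntegrable_of_memLp k.memLp_deriv hη), h.eq_integral η hη, k.eq_integral η hη]
  ring

theorem memH1K_zero : MemH1K (fun _ => 0) fun _ => 0 :=
  ⟨MemLp.zero, MemLp.zero, fun _ _ => by simp⟩

theorem memLp_indicator_Icc {h : ℝ → ℝ} (hh : Continuous h) (b : ℝ) :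
    MemLp ((Icc 0 b).indicator h) 2 weightMeasure := by
  have hm : AEStronglyMeasurable ((Icc 0 b).indicator h) weightMeasure :=
    (hh.measurable.indicator measurableSet_Icc).aestronglyMeasurable
  rw [memLp_two_iff_integrable_sq hm, integrable_weightMeasure_iff]
  have e : (fun η => (Icc 0 b).indicator h η ^ 2 * weight η)
      = (Icc 0 b).indicator fun η => h η ^ 2 * weight η := by
    funext η
    by_cases hη : η ∈ Icc 0 b <;> simp [hη]
  rw [e]
  exact ((((hh.pow 2).mul continuous_weight).integrableOn_Icc).integrable_indicator
    measurableSet_Icc).integrableOn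

/-- A family of test functions that turns the weak form into a Volterra equation. -/
theorem exists_test {b : ℝ} (hb : 0 ≤ b) : ∃ E : ℝ → ℝ, Continuous E ∧ E 0 = 0 ∧
    (∀ η ∈ Icc 0 b, |E η - E b| ≤ b) ∧
    MemH1K ((Icc 0 b).indicator fun η => E η - E b)
      ((Icc 0 b).indicator fun η => (weight η)⁻¹) := by
  have hw : Continuous fun η => (weight η)⁻¹ := continuous_weight.inv₀ fun η => (weight_pos η).ne'
  -- The primitive of `1/K`: the derivative of the test function cancels the weight, and subtracting
  -- `E b` makes it reach zero at `b`.
  set E : ℝ → ℝ := fun η => ∫ s in (0 : ℝ)..η, (weight s)⁻¹ with hE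
  have hEc : Continuous E :=
    intervalIntegral.continuous_primitive (fun a b => hw.intervalIntegrable a b) 0
  have hE0 : E 0 = 0 := by simp [hE]
  refine ⟨E, hEc, hE0, fun η hη => ?_, memLp_indicator_Icc (hEc.sub continuous_const) b,
    memLp_indicator_Icc hw b, fun η hη => ?_⟩
  · have h1 : E η - E b = ∫ s in b..η, (weight s)⁻¹ :=
      intervalIntegral.integral_interval_sub_left (hw.intervalIntegrable _ _)
        (hw.intervalIntegrable _ _)
    rw [h1, ← Real.norm_eq_abs]
    refine (intervalIntegral.norm_integral_le_of_norm_le_const (C := 1) fun s _ => ?_).trans ?_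
    · rw [Real.norm_of_nonneg (inv_nonneg.2 (weight_pos s).le)]
      exact inv_le_one_of_one_le₀ (one_le_weight s)
    · rw [one_mul, abs_of_nonpos (by linarith [hη.2])]
      linarith [hη.1]
  · have h1 : ∫ s in (0 : ℝ)..η, (Icc 0 b).indicator (fun η => (weight η)⁻¹) s = E (min η b) := by
      rw [intervalIntegral.integral_of_le hη, setIntegral_indicator measurableSet_Icc,
        show E (min η b) = ∫ s in (0 : ℝ)..min η b, (weight s)⁻¹ from rfl,
        intervalIntegral.integral_of_le (le_min hη hb)]
      congr 2
      ext s
      simp only [mem_inter_iff, mem_Ioc, mem_Icc, le_min_iff]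
      exact ⟨fun h => ⟨h.1.1, h.1.2, h.2.2⟩, fun h => ⟨⟨h.1, h.2.1⟩, h.1.le, h.2.2⟩⟩
    rw [h1, indicator_of_mem (show (0 : ℝ) ∈ Icc 0 b from ⟨le_rfl, hb⟩), hE0]
    rcases le_or_gt η b with h | h
    · rw [indicator_of_mem (show η ∈ Icc 0 b from ⟨hη, h⟩), min_eq_left h]; ring
    · rw [indicator_of_notMem (fun h' => absurd h'.2 (not_le.2 h)), min_eq_right h.le]; ring

/-- Uniqueness for the Cauchy problem: the natural boundary condition provides zero slope and `h0`
zero value. Testing with `ζ' = 1/K` on `[0,b]` isolates `d b` and gives `|d b| ≤ C ∫₀ᵇ |d|` for `b ≤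
R`; Gronwall's inequality finishes. -/
theorem eq_zero_of_weak {d d' : ℝ → ℝ} {m : ℝ} (hd : MemH1K d d') (h0 : d 0 = 0)
    (hweak : ∀ ζ ζ' : ℝ → ℝ, MemH1K ζ ζ' →
      ∫ η in Ioi 0, (d' η * ζ' η - m * d η * ζ η) * weight η = 0) :
    ∀ η, 0 ≤ η → d η = 0 := by
  intro R hR
  -- Extended constantly to negative arguments, so that its primitive is differentiable on all of
  -- `ℝ`.
  set g : ℝ → ℝ := fun s => |d (max s 0)| with hg
  have hgc : Continuous g :=
    (hd.continuousOn.comp_continuous (by fun_prop) fun s => le_max_right s 0).abs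
  have hgd : ∀ s, 0 ≤ s → g s = |d s| := fun s hs => by rw [hg]; simp only [max_eq_left hs]
  set C := |m| * (R * weight R) with hC
  have hbound : ∀ b ∈ Icc 0 R, |d b| ≤ C * ∫ s in (0 : ℝ)..b, g s := by
    intro b hb
    obtain ⟨E, hEc, hE0, hEb, hζ⟩ := exists_test hb.1
    have hw := hweak _ _ hζ
    have e : (fun η => (d' η * (Icc 0 b).indicator (fun η => (weight η)⁻¹) η
        - m * d η * (Icc 0 b).indicator (fun η => E η - E b) η) * weight η)
        = (Icc 0 b).indicator fun η => d' η - m * d η * (E η - E b) * weight η := by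
      funext η
      by_cases hη : η ∈ Icc 0 b
      · simp only [indicator_of_mem hη]
        have := (weight_pos η).ne'
        field_simp
      · simp only [indicator_of_notMem hη]; ring
    have hset : Ioi 0 ∩ Icc 0 b = Ioc 0 b := by
      ext s; simp only [mem_inter_iff, mem_Ioi, mem_Icc, mem_Ioc]
      exact ⟨fun h => ⟨h.1, h.2.2⟩, fun h => ⟨h.1, h.1.le, h.2⟩⟩
    rw [e, setIntegral_indicator measurableSet_Icc, hset,
        ← intervalIntegral.integral_of_le hb.1] at hw
    have hdc : ContinuousOn (fun η => m * d η * (E η - E b) * weight η) (uIcc 0 b) := by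
      rw [uIcc_of_le hb.1]
      exact (((continuousOn_const.mul (hd.continuousOn.mono fun s hs => hs.1)).mul
        (hEc.sub continuous_const).continuousOn).mul continuous_weight.continuousOn)
    rw [intervalIntegral.integral_sub (intervalIntegrable_of_memLp hd.memLp_deriv hb.1)
      hdc.intervalIntegrable] at hw
    have h1 := hd.eq_integral b hb.1
    rw [h0, zero_add] at h1
    rw [h1, sub_eq_zero.1 hw, ← Real.norm_eq_abs, ← intervalIntegral.integral_const_mul]
    refine intervalIntegral.norm_integral_le_of_norm_le hb.1 (.of_forall fun s hs => ?_)
      ((hgc.intervalIntegrable _ _).const_mul _)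
    rw [hgd s hs.1.le, norm_mul, norm_mul, norm_mul, Real.norm_eq_abs, Real.norm_eq_abs,
      Real.norm_eq_abs, Real.norm_of_nonneg (weight_pos s).le]
    have hw1 : weight s ≤ weight R := by
      refine Real.exp_le_exp.2 (div_le_div_of_nonneg_right ?_ (by norm_num))
      exact pow_le_pow_left₀ hs.1.le (hs.2.trans hb.2) 2
    have h2 : |E s - E b| * weight s ≤ R * weight R :=
      mul_le_mul ((hEb s ⟨hs.1.le, hs.2⟩).trans hb.2) hw1 (weight_pos s).le hR
    calc |m| * |d s| * |E s - E b| * weight s = |m| * |d s| * (|E s - E b| * weight s) := by ring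
      _ ≤ |m| * |d s| * (R * weight R) := mul_le_mul_of_nonneg_left h2 (by positivity)
      _ = C * |d s| := by rw [hC]; ring
  have hder : ∀ x, HasDerivAt (fun b => ∫ s in (0 : ℝ)..b, g s) (g x) x := fun x =>
    (hgc.integral_hasStrictDerivAt 0 x).hasDerivAt
  have hD := eq_zero_of_abs_deriv_le_mul_abs_self_of_eq_zero_right
    (f := fun b => ∫ s in (0 : ℝ)..b, g s) (f' := g) (K := C) (a := 0) (b := R)
    (fun x _ => (hder x).continuousAt.continuousWithinAt) (fun x _ => (hder x).hasDerivWithinAt)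
    (by simp) (fun x hx => by
      have hn : 0 ≤ ∫ s in (0 : ℝ)..x, g s :=
        intervalIntegral.integral_nonneg hx.1 fun s _ => abs_nonneg _
      rw [hgd x hx.1, Real.norm_eq_abs, abs_abs, Real.norm_of_nonneg hn]
      exact hbound x ⟨hx.1, hx.2.le⟩) R ⟨hR, le_rfl⟩
  have h := hbound R ⟨hR, le_rfl⟩
  rw [hD, mul_zero] at h
  exact abs_nonpos_iff.1 h

/-- Equal values at `0` give equal boundary terms, so the nonlinearity drops out of the difference,
which solves the linear equation with zero Cauchy data. -/
theorem IsWeakProfile.eqOn {p : ℝ} {ω₁ ω₂ : ℝ → ℝ} (h₁ : IsWeakProfile p ω₁)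
    (h₂ : IsWeakProfile p ω₂) (h0 : ω₁ 0 = ω₂ 0) : EqOn ω₁ ω₂ (Ici 0) := by
  obtain ⟨ω₁', m₁, w₁⟩ := h₁
  obtain ⟨ω₂', m₂, w₂⟩ := h₂
  intro η hη
  refine sub_eq_zero.1 (eq_zero_of_weak (m := 1 / (2 * (p - 1))) (m₁.sub m₂) (sub_eq_zero.2 h0)
    (fun ζ ζ' hζ => ?_) η hη)
  have e1 := w₁ ζ ζ' hζ
  have e2 := w₂ ζ ζ' hζ
  rw [h0] at e1
  have i1 := integrableOn_weak m₁ hζ (1 / (2 * (p - 1)))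
  have i2 := integrableOn_weak m₂ hζ (1 / (2 * (p - 1)))
  have : ∀ η, ((ω₁' η - ω₂' η) * ζ' η - 1 / (2 * (p - 1)) * (ω₁ η - ω₂ η) * ζ η) * weight η
      = (ω₁' η * ζ' η - 1 / (2 * (p - 1)) * ω₁ η * ζ η) * weight η
        - (ω₂' η * ζ' η - 1 / (2 * (p - 1)) * ω₂ η * ζ η) * weight η := fun η => by ring
  simp only [this]
  rw [integral_sub i1 i2]
  linarith

theorem isWeakProfile_zero (p : ℝ) : IsWeakProfile p fun _ => 0 :=
  ⟨fun _ => 0, memH1K_zero, fun ζ ζ' _ => by simp⟩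

/-- Positivity is assumed only on the open half line. A profile vanishing at `0` would coincide with
the zero profile. -/
theorem IsPositiveProfile.zero_pos {p : ℝ} {ω : ℝ → ℝ} (h : IsPositiveProfile p ω) : 0 < ω 0 := by
  obtain ⟨ω', m, -⟩ := h.1
  have hnn : 0 ≤ ω 0 := by
    have hc := (m.continuousOn 0 self_mem_Ici).mono Ioi_subset_Ici_self
    refine ge_of_tendsto hc ?_
    filter_upwards [self_mem_nhdsWithin] with η hη using (h.2 η hη).le
  refine hnn.lt_of_ne fun h0 => ?_
  have := h.1.eqOn (isWeakProfile_zero p) h0.symm (mem_Ici.2 zero_le_one)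
  exact (h.2 1 one_pos).ne' this

/-- Uniqueness of the positive profile. -/
theorem IsPositiveProfile.eqOn {p : ℝ} (hp : 1 < p) {ω₁ ω₂ : ℝ → ℝ} (h₁ : IsPositiveProfile p ω₁)
    (h₂ : IsPositiveProfile p ω₂) : EqOn ω₁ ω₂ (Ici 0) := by
  refine h₁.1.eqOn h₂.1 ?_
  have p₁ := h₁.zero_pos
  have p₂ := h₂.zero_pos
  obtain ⟨ω₁', m₁, w₁⟩ := h₁.1
  obtain ⟨ω₂', m₂, w₂⟩ := h₂.1
  -- Each profile tests the other's equation. The bilinear form is symmetric, so the boundary terms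
  -- are equal, and positivity at `0` allows cancelling `ω₁ 0 * ω₂ 0`.
  have e1 := w₁ ω₂ ω₂' m₂
  have e2 := w₂ ω₁ ω₁' m₁
  have e3 : ∫ η in Ioi 0, (ω₂' η * ω₁' η - 1 / (2 * (p - 1)) * ω₂ η * ω₁ η) * weight η
      = ∫ η in Ioi 0, (ω₁' η * ω₂' η - 1 / (2 * (p - 1)) * ω₁ η * ω₂ η) * weight η := by
    congr 1; funext η; ring
  rw [e3] at e2
  rw [abs_of_pos p₁] at e1
  rw [abs_of_pos p₂] at e2
  have e4 : ω₁ 0 ^ (p - 1) * (ω₁ 0 * ω₂ 0) = ω₂ 0 ^ (p - 1) * (ω₁ 0 * ω₂ 0) := by linarith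
  exact (Real.rpow_left_inj p₁.le p₂.le (by linarith)).1
    (mul_right_cancel₀ (mul_pos p₁ p₂).ne' e4)

/-! ### The explicit profile as the limit -/

/-- The explicit solutions of the profile equation. -/
noncomputable def profile (ν A η : ℝ) : ℝ := Real.exp (-(η ^ 2 / 4)) * (A * profileFun ν η)

/-- The derivative of `profile`. -/
noncomputable def profileDeriv (ν A η : ℝ) : ℝ :=
  Real.exp (-(η ^ 2 / 4)) * (A * (profileMoment (-ν) η - η / 2 * profileFun ν η))

section

variable {ν A : ℝ}

theorem profile_zero (ν A : ℝ) : profile ν A 0 = A * profileFun ν 0 := by simp [profile]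

theorem hasDerivAt_profile (hν0 : 0 < ν) (hν1 : ν < 1) {η : ℝ} (hη : 0 ≤ η) :
    HasDerivAt (profile ν A) (profileDeriv ν A η) η := by
  have h1 : HasDerivAt (fun η : ℝ => Real.exp (-(η ^ 2 / 4)))
      (Real.exp (-(η ^ 2 / 4)) * -(η / 2)) η := by
    have h := ((hasDerivAt_pow 2 η).div_const 4).neg.exp
    exact h.congr_deriv (by simp; ring)
  exact (h1.mul ((hasDerivAt_profileFun hν0 hν1 hη).const_mul A)).congr_deriv
    (by rw [profileDeriv]; ring)

theorem continuousOn_profileMoment_sub (hν0 : 0 < ν) (hν1 : ν < 1) :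
    ContinuousOn (fun η => A * (profileMoment (-ν) η - η / 2 * profileFun ν η)) (Ici 0) :=
  continuousOn_const.mul ((continuous_profileMoment (by linarith)).continuousOn.sub
    ((continuousOn_id.div_const 2).mul (continuousOn_profileFun hν0 hν1)))

theorem memH1K_profile (hν0 : 0 < ν) (hν1 : ν < 1) (A : ℝ) :
    MemH1K (profile ν A) (profileDeriv ν A) := by
  set a := profileFun ν 0 with ha
  set b := profileMoment (-ν) 0 with hb
  have ha0 : 0 < a := profileFun_zero_pos hν0 hν1
  have hb0 : 0 < b := profileMoment_pos (by linarith)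
  have hf : ∀ η, 0 ≤ η → |profileFun ν η| ≤ (a + b) * (1 + η ^ 2) := fun η hη => by
    rw [abs_of_pos (profileFun_pos hν0 hν1 hη)]
    refine (profileFun_le hν0 hν1 hη).trans ?_
    nlinarith [mul_nonneg ha0.le (sq_nonneg η), mul_nonneg hb0.le (sq_nonneg (η - 1 / 2))]
  have hf2 : ∀ η, 0 ≤ η → |η / 2 * profileFun ν η| ≤ (a + b) * (1 + η ^ 2) := fun η hη => by
    rw [abs_of_nonneg (mul_nonneg (by positivity) (profileFun_pos hν0 hν1 hη).le)]
    refine (mul_le_mul_of_nonneg_left (profileFun_le hν0 hν1 hη) (by positivity)).trans ?_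
    nlinarith [mul_nonneg ha0.le (sq_nonneg (η - 1 / 2)), mul_nonneg hb0.le (sq_nonneg η)]
  have hcd : ContinuousOn (profileDeriv ν A) (Ici 0) :=
    (Continuous.continuousOn (by fun_prop)).mul (continuousOn_profileMoment_sub hν0 hν1)
  refine ⟨memLp_exp_mul (C := |A| * (a + b))
      (continuousOn_const.mul (continuousOn_profileFun hν0 hν1)) fun η hη => ?_,
    memLp_exp_mul (C := |A| * (a + 2 * b + a)) (continuousOn_profileMoment_sub hν0 hν1)
      fun η hη => ?_, fun η hη => ?_⟩
  · rw [abs_mul, mul_assoc]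
    exact mul_le_mul_of_nonneg_left (hf η hη) (abs_nonneg _)
  · rw [abs_mul, mul_assoc]
    refine mul_le_mul_of_nonneg_left ((abs_sub _ _).trans ?_) (abs_nonneg _)
    have h1 : |profileMoment (-ν) η| ≤ b := by
      rw [abs_of_nonneg (profileMoment_nonneg _ _)]
      exact profileMoment_le (by linarith) hη
    have h2 := hf2 η hη
    nlinarith [mul_nonneg ha0.le (sq_nonneg η), mul_nonneg hb0.le (sq_nonneg η)]
  · rw [intervalIntegral.integral_eq_sub_of_hasDerivAt (f := profile ν A) (fun s hs => by
      rw [uIcc_of_le hη] at hs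
      exact hasDerivAt_profile hν0 hν1 hs.1) (ContinuousOn.intervalIntegrable (by
      rw [uIcc_of_le hη]; exact hcd.mono fun s hs => hs.1))]
    ring

/-- The weighted flux `q = ω' K` satisfies `q' = -ω K/(2(p-1))` by `profileFun_ode`, and `hA'` is
the nonlinear boundary condition `ω'(0) = ω(0)^p`. -/
theorem isPositiveProfile_profile {p : ℝ} (hp : 3 / 2 < p) (hp2 : p < 2)
    (hν : ν = 1 / (p - 1) - 1) (hA : 0 < A)
    (hA' : A * profileMoment (-ν) 0 = (A * profileFun ν 0) ^ p) :
    IsPositiveProfile p (profile ν A) := by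
  have hν0 : 0 < ν := by
    have : 1 < 1 / (p - 1) := by rw [lt_div_iff₀ (by linarith)]; linarith
    linarith
  have hν1 : ν < 1 := by
    have : 1 / (p - 1) < 2 := by rw [div_lt_iff₀ (by linarith)]; linarith
    linarith
  have hm : 1 / (2 * (p - 1)) = (ν + 1) / 2 := by
    have : p - 1 ≠ 0 := by linarith
    rw [hν]; field_simp; ring
  have hexp : ∀ η : ℝ, Real.exp (-(η ^ 2 / 4)) * weight η = 1 := fun η => by
    rw [weight, ← Real.exp_add]; simp
  have hmem := memH1K_profile hν0 hν1 A
  refine ⟨⟨profileDeriv ν A, hmem, fun ζ ζ' hζ => ?_⟩, fun η hη =>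
    mul_pos (Real.exp_pos _) (mul_pos hA (profileFun_pos hν0 hν1 hη.le))⟩
  set q : ℝ → ℝ := fun η => A * (profileMoment (-ν) η - η / 2 * profileFun ν η) with hq
  set q' : ℝ → ℝ := fun η => -((ν + 1) / 2 * (A * profileFun ν η)) with hq'
  have hqi : ∀ R, 0 ≤ R → IntervalIntegrable q' volume 0 R := fun R hR =>
    ContinuousOn.intervalIntegrable (by
      rw [uIcc_of_le hR]
      exact (continuousOn_const.mul (continuousOn_const.mul
        ((continuousOn_profileFun hν0 hν1).mono fun s hs => hs.1))).neg)
  have hder : ∀ η, 0 ≤ η → HasDerivAt q (q' η) η := fun η hη => by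
    have h1 := hasDerivAt_profileMoment (a := -ν) (by linarith) η
    have h2 := ((hasDerivAt_id η).div_const 2).mul (hasDerivAt_profileFun hν0 hν1 hη)
    refine ((h1.sub h2).const_mul A).congr_deriv ?_
    have h3 := profileFun_ode hν0 hν1 hη
    simp only [hq', id]
    linear_combination A * h3
  have key := integral_weak_of_flux (q := q) (q' := q') (m := (ν + 1) / 2) hmem hζ hqi
    (fun η hη => by
      rw [intervalIntegral.integral_eq_sub_of_hasDerivAt (f := q) (fun s hs => by
        rw [uIcc_of_le hη] at hs
        exact hder s hs.1) (hqi η hη)]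
      ring)
    (fun η _ => by
      rw [profileDeriv, hq]
      linear_combination (A * (profileMoment (-ν) η - η / 2 * profileFun ν η)) * hexp η)
    (fun η _ => by
      rw [profile, hq']
      linear_combination (-((ν + 1) / 2 * (A * profileFun ν η))) * hexp η)
  have hω0 : 0 < A * profileFun ν 0 := mul_pos hA (profileFun_zero_pos hν0 hν1)
  rw [hm, key, profile_zero, abs_of_pos hω0, ← Real.rpow_add_one hω0.ne', sub_add_cancel, ← hA', hq]
  ring

end

/-- The boundary values converge to `L t^(-(ν+1)/2)`, whose Poisson integral is the self-similar
function of the profile with `A = L / f(0)`. The value of `L` forced by the mass balance is the one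
for which this profile satisfies its boundary condition. -/
theorem IsBoundaryFamily.exists_profile {p : ℝ} {V : ℝ → ℝ → ℝ} (hV : IsBoundaryFamily p V)
    (hp : 3 / 2 < p) (hp2 : p < 2) : ∃ ω : ℝ → ℝ, IsPositiveProfile p ω ∧
      TendstoLocallyUniformlyOn (familySolution p V) (selfSimilar p ω) atTop (Ioi 0 ×ˢ Ici 0) := by
  have hp1 : 1 < p := by linarith
  obtain ⟨L, hL0, hL, hL'⟩ := hV.exists_tendsto_at_one hp hp2
  have hLp := hV.limit_rpow_eq hp hp2 hL0 hL hL'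
  set ν := 1 / (p - 1) - 1 with hν
  have hν0 : 0 < ν := by
    have : 1 < 1 / (p - 1) := by rw [lt_div_iff₀ (by linarith)]; linarith
    linarith
  have hν1 : ν < 1 := by
    have : 1 / (p - 1) < 2 := by rw [div_lt_iff₀ (by linarith)]; linarith
    linarith
  have hm : 1 / (2 * (p - 1)) = (ν + 1) / 2 := by
    have : p - 1 ≠ 0 := by linarith
    rw [hν]; field_simp; ring
  have hf0 := profileFun_zero_pos hν0 hν1
  set A := L / profileFun ν 0 with hA
  have hAf : A * profileFun ν 0 = L := div_mul_cancel₀ _ hf0.ne'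
  have hA0 : 0 < A := div_pos hL0 hf0
  rw [hm, show (ν + 1) / 2 - 1 / 2 = ν / 2 by ring,
      show 1 - (ν + 1) / 2 = (1 - ν) / 2 by ring] at hLp
  have hA' : A * profileMoment (-ν) 0 = (A * profileFun ν 0) ^ p := by
    rw [profileMoment_eq_mul_profileFun hν0 hν1, ← hLp, hAf, mul_left_comm, hAf,
      ← Real.rpow_add_one hL0.ne', sub_add_cancel]
  refine ⟨profile ν A, isPositiveProfile_profile hp hp2 hν hA0 hA', ?_⟩
  have hself : ∀ t x, selfSimilar p (profile ν A) (t, x)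
      = t ^ (-((ν + 1) / 2)) * (Real.exp (-((x / √t) ^ 2 / 4)) * (A * profileFun ν (x / √t))) :=
    fun t x => by rw [selfSimilar, hm, profile]
  have hlim : ∀ z ∈ Ioi (0 : ℝ) ×ˢ Ici (0 : ℝ), Tendsto (fun c => familySolution p V c z) atTop
      (𝓝 (selfSimilar p (profile ν A) z)) := by
    rintro ⟨t, x⟩ ⟨ht, hx⟩
    have ht' : 0 < t := ht
    rcases (mem_Ici.1 hx).eq_or_lt with h | h
    · simp only at h
      subst h
      simp only [hV.apply_zero]
      have := hV.tendsto_boundary hp1 hp2 hL ht'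
      rw [hm] at this
      rw [hself]
      convert this using 2
      simp [hAf, mul_comm]
    · obtain ⟨i1, e1⟩ := poissonKernel_conv_rpow hν0 hν1 ht' h
      have e : ∀ s, poissonKernel x (t - s) * (L * s ^ (-(1 / (2 * (p - 1)))))
          = A * (poissonKernel x (t - s) * (profileFun ν 0 * s ^ (-((ν + 1) / 2)))) := fun s => by
        rw [hm, ← hAf]; ring
      have := hV.tendsto_interior (t := t) hp1 hp2 hL hL' h (by simp only [e]; exact i1.const_mul A)
      simp only [e] at this
      rw [integral_const_mul, e1] at this
      rw [hself]
      convert this using 2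
      ring
  have hcont : ContinuousOn (selfSimilar p (profile ν A)) (Ioi 0 ×ˢ Ici 0) := by
    have hω : ContinuousOn (profile ν A) (Ici 0) := fun η hη =>
      (hasDerivAt_profile hν0 hν1 hη).continuousAt.continuousWithinAt
    refine ContinuousOn.mul (fun z hz => ?_) (hω.comp (fun z hz => ?_) fun z hz => ?_)
    · exact (continuousAt_fst.rpow_const (.inl (ne_of_gt hz.1))).continuousWithinAt
    · exact (continuousAt_snd.div (Real.continuous_sqrt.continuousAt.comp continuousAt_fst)
        (Real.sqrt_pos.2 hz.1).ne').continuousWithinAt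
    · exact div_nonneg hz.2 (Real.sqrt_nonneg _)
  -- Dini's theorem: the family is monotone in `c` and continuous, and its pointwise limit is
  -- continuous.
  exact Monotone.tendstoLocallyUniformlyOn_of_forall_tendsto (fun c => hV.continuousOn hp1 hp2 c)
    (fun z hz => hV.apply_mono hp1 hp2 z.1 hz.2) hcont hlim

end HalfLineHeat

theorem mainTheorem3 (p : ℝ) (hp1 : 1 < p) (hp2 : p < 2) :
    ∃ u : ℝ → ℝ × ℝ → ℝ,
      -- `u ℓ` is the (unique) solution with boundary flux `ℓ δ₀`
      (∀ ℓ : ℝ, 0 < ℓ →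
        HalfLineHeat.IsDiracFluxSolution p ℓ (u ℓ) ∧
        ContinuousOn (u ℓ) (Ioi 0 ×ˢ Ici 0) ∧
        ∀ v : ℝ × ℝ → ℝ, HalfLineHeat.IsDiracFluxSolution p ℓ v →
          (∀ᵐ z ∂(volume.restrict (Ioi (0 : ℝ) ×ˢ Ioi (0 : ℝ))), v z = u ℓ z) ∧
          (∀ᵐ t ∂(volume.restrict (Ioi (0 : ℝ))), v (t, 0) = u ℓ (t, 0))) ∧
      -- (i) blow-up everywhere, locally uniformly
      (p ≤ 3 / 2 →
        ∀ S : Set (ℝ × ℝ), IsCompact S → S ⊆ Ioi 0 ×ˢ Ici 0 →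
          ∀ M : ℝ, ∀ᶠ ℓ in atTop, ∀ z ∈ S, M ≤ u ℓ z) ∧
      -- (ii) convergence to the self-similar solution, locally uniformly
      (3 / 2 < p →
        ∃ ω : ℝ → ℝ, HalfLineHeat.IsPositiveProfile p ω ∧
          (∀ ω₁ : ℝ → ℝ, HalfLineHeat.IsPositiveProfile p ω₁ → EqOn ω₁ ω (Ici 0)) ∧
          TendstoLocallyUniformlyOn u (HalfLineHeat.selfSimilar p ω) atTop
            (Ioi 0 ×ˢ Ici 0)) := by
  obtain ⟨V, hV⟩ := HalfLineHeat.exists_isBoundaryFamily hp1 hp2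
  refine ⟨HalfLineHeat.familySolution p V, fun ℓ hℓ => ?_, fun hp S hS hSU M =>
    hV.eventually_le hp1 hp hS hSU M, fun hp => ?_⟩
  · have hu : HalfLineHeat.IsDiracFluxSolution p ℓ (HalfLineHeat.familySolution p V ℓ) := by
      have h := (hV ℓ).isDiracFluxSolution hp1 hp2
      rw [max_eq_left hℓ.le] at h
      rwa [HalfLineHeat.familySolution, max_eq_left hℓ.le]
    exact ⟨hu, hV.continuousOn hp1 hp2 ℓ, fun v hv => hu.unique hp1 hℓ.le hv⟩
  · obtain ⟨ω, hω, hlim⟩ := hV.exists_profile hp hp2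
    exact ⟨ω, hω, fun ω₁ h₁ => h₁.eqOn hp1 hω, hlim⟩
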